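/- All graphs are finite and simple. For $t\in\mathbb Z_{\ge 0}$, a $t$-boundaried graph is a graph $A$ with a set of boundary vertices that are injectively labelled by elements of $\{1,\dots,t\}$ (not every label need be used); $A\oplus F$ denotes the graph obtained from the disjoint union of two $t$-boundaried graphs $A,F$ by identifying equally labelled boundary vertices. For $\Pi\in\{\mathrm{DS},\mathrm{CDS}\}$ and $k\in\mathbb Z$, write $(G,k)\in\Pi$ if $G$ has a dominating set (for CDS: a dominating set that induces a connected subgraph) of size at most $k$. Write $A\equiv_{\Pi,t}B$ if there is $c\in\mathbb Z$ such that, for all $t$-boundaried graphs $F$ and all $k\in\mathbb Z$, $(A\oplus F,k)\in\Pi\iff(B\oplus F,k+c)\in\Pi$; such a $c$ is called a transposition constant from $A$ to $B$. For a graph $G$ and $X\subseteq V(G)$ let $\partial_G(X)$ be the set of vertices of $X$ that have a neighbour outside $X$. The set $X$ is a $t$-DS-protrusion of $G$ if $|\partial_G(X)|\le t$ and some $S\subseteq X$ with $|S|\le t$ is a dominating set of $G[X]$; it is a $t$-CDS-protrusion of $G$ if $|\partial_G(X)|\le t$ and there is $S\subseteq X$ with $|S|\le t$ such that $S\cap V(C)$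 is a connected dominating set of $C$ for every connected component $C$ of $G[X]$. Such an $X$ is regarded as the $t$-boundaried graph $G[X]$ with boundary $\partial_G(X)$, labelled injectively by elements of $\{1,\dots,t\}$ in any way. **Lemma.** 1. For every graph $H$ and every $t\in\mathbb Z_{\ge0}$ there are $\xi_t\in\mathbb Z_{\ge0}$ and an algorithm (both depending on $H$ and $t$) which, given a $t$-DS-protrusion $X$ (as a $t$-boundaried graph) of some graph $G$ such that $|X|>\xi_t$ and $H$ is not a topological minor of $G[X]$, outputs in time $O(|X|)$ a $t$-boundaried graph $X'$ with $|X'|\le\xi_t$ and $X\equiv_{\mathrm{DS},t}X'$, together with a transposition constant from $X$ to $X'$. The constant in $O(|X|)$ depends only on $H$ and $t$. 2. The same holds with $t$-CDS-protrusions and $\equiv_{\mathrm{CDS},t}$ in place of $t$-DS-protrusions and $\equiv_{\mathrm{DS},t}$, and with running time $O(|X|^{d})$ in place of $O(|X|)$, where $d$ is an absolute constant and the constant in $O(|X|^d)$ depends only on $H$ and $t$. Here graphs are given by adjacency lists (vertices numbered and neighbours listed in any order), and time is the number of steps of a random access machine with unit cost per instruction whose arithmetic is limited to adding and subtracting one.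 -/

import Mathlib

/-! ### Graphs: domination, topological minors -/

/-- `D` is a dominating set of `G`: the closed neighbourhood of `D` is everything. -/
def IsDominatingSet {V : Type} (G : SimpleGraph V) (D : Set V) : Prop :=
  ∀ v, v ∈ D ∨ ∃ u ∈ D, G.Adj u v

/-- `D` is a dominating set of `G` and the subgraph induced by `D` is connected. -/
def IsConnectedDominatingSet {V : Type} (G : SimpleGraph V) (D : Set V) : Prop :=
  IsDominatingSet G D ∧ (G.induce D).Connected

/-- `H` is a topological minor of `G`: there are branch vertices `φ w` in `G`, one for each vertex
`w` of `H`, and for each edge `uv` of `H` a path of `G` from `φ u` to `φ v` (the path of `vu` is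
the path of `uv` reversed), such that a path contains no branch vertices but its two ends, and the
paths of two different edges share no vertices but branch vertices.  The union of these paths and
of the branch vertices is the subgraph of `G` that is a subdivision of `H`. -/
def IsTopologicalMinor {W V : Type} (H : SimpleGraph W) (G : SimpleGraph V) : Prop :=
  ∃ (φ : W ↪ V) (P : ∀ u v, H.Adj u v → G.Walk (φ u) (φ v)),
    (∀ u v (h : H.Adj u v), (P u v h).IsPath) ∧
    (∀ u v (h : H.Adj u v), P v u h.symm = (P u v h).reverse) ∧
    (∀ u v (h : H.Adj u v) (w : W), φ w ∈ (P u v h).support → w = u ∨ w = v) ∧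
    (∀ u v (h : H.Adj u v) u' v' (h' : H.Adj u' v'), s(u, v) ≠ s(u', v') →
      ∀ x, x ∈ (P u v h).support → x ∈ (P u' v' h').support → x ∈ Set.range φ)

/-! ### Boundaried graphs, gluing, equivalence -/

/-- A `t`-boundaried graph: a finite graph with a set of boundary vertices that carry pairwise
different labels from a set of `t` labels (not all labels need be used). -/
structure BoundariedGraph (t : ℕ) where
  V : Type
  finite : Finite V
  graph : SimpleGraph V
  boundary : Set V
  label : boundary → Fin t
  label_injective : Function.Injective label

namespace BoundariedGraph

variable {t : ℕ}

/-- The identifications made in the disjoint union of `A` and `B`: a boundary vertex of `A` is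
identified with the boundary vertex of `B` that has the same label. -/
def glueRel (A B : BoundariedGraph t) : A.V ⊕ B.V → A.V ⊕ B.V → Prop
  | .inl u, .inl v => u = v
  | .inr u, .inr v => u = v
  | .inl u, .inr v => ∃ (hu : u ∈ A.boundary) (hv : v ∈ B.boundary),
      A.label ⟨u, hu⟩ = B.label ⟨v, hv⟩
  | .inr v, .inl u => ∃ (hu : u ∈ A.boundary) (hv : v ∈ B.boundary),
      A.label ⟨u, hu⟩ = B.label ⟨v, hv⟩

theorem glueRel_equivalence (A B : BoundariedGraph t) : Equivalence (glueRel A B) where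
  refl x := by cases x <;> simp [glueRel]
  symm {x y} h := by
    cases x <;> cases y <;> simp only [glueRel] at h ⊢
    · exact h.symm
    · exact h
    · exact h
    · exact h.symm
  trans {x y z} h k := by
    rcases x with x | x <;> rcases y with y | y <;> rcases z with z | z <;>
      simp only [glueRel] at h k ⊢
    · exact h.trans k
    · subst h; exact k
    · obtain ⟨h1, h2, h3⟩ := h
      obtain ⟨k1, k2, k3⟩ := k
      exact congrArg Subtype.val (A.label_injective (h3.trans k3.symm))
    · subst k; exact h
    · subst k; exact h
    · obtain ⟨h1, h2, h3⟩ := h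
      obtain ⟨k1, k2, k3⟩ := k
      exact congrArg Subtype.val (B.label_injective (h3.symm.trans k3))
    · subst h; exact k
    · exact h.trans k

/-- The vertex set of `A ⊕ B`. -/
def GlueVertex (A B : BoundariedGraph t) : Type :=
  Quotient (Setoid.mk (glueRel A B) (glueRel_equivalence A B))

/-- The vertex of `A ⊕ B` that a vertex of the disjoint union becomes. -/
def toGlue (A B : BoundariedGraph t) (x : A.V ⊕ B.V) : GlueVertex A B :=
  Quotient.mk (Setoid.mk (glueRel A B) (glueRel_equivalence A B)) x

/-- The graph `A ⊕ B`: the disjoint union with equally labelled boundary vertices identified; two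
vertices are adjacent if they come from adjacent vertices of `A` or from adjacent vertices
of `B`.  (`fromRel` symmetrizes and drops loops; there are none, labels being injective.) -/
def glue (A B : BoundariedGraph t) : SimpleGraph (GlueVertex A B) :=
  SimpleGraph.fromRel fun p q =>
    (∃ u v, A.graph.Adj u v ∧ p = toGlue A B (.inl u) ∧ q = toGlue A B (.inl v)) ∨
    (∃ u v, B.graph.Adj u v ∧ p = toGlue A B (.inr u) ∧ q = toGlue A B (.inr v))

end BoundariedGraph

/-- A parameterized graph problem: the property of a pair `(G, k)` of being a yes-instance. -/
def GraphProblem : Type 1 := ∀ V : Type, SimpleGraph V → ℤ → Prop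

/-- Dominating Set: does `G` have a dominating set of size at most `k`? -/
def DominatingSetProblem : GraphProblem := fun V G k =>
  ∃ D : Finset V, (D.card : ℤ) ≤ k ∧ IsDominatingSet G (D : Set V)

/-- Connected Dominating Set: does `G` have a connected dominating set of size at most `k`? -/
def ConnectedDominatingSetProblem : GraphProblem := fun V G k =>
  ∃ D : Finset V, (D.card : ℤ) ≤ k ∧ IsConnectedDominatingSet G (D : Set V)

/-- `c` is a transposition (translation) constant from `A` to `B`, which witnesses that the
`t`-boundaried graphs `A` and `B` are equivalent with respect to the problem `Q`. -/
def IsTranspositionConstant (Q : GraphProblem) {t : ℕ} (A B : BoundariedGraph t) (c : ℤ) : Prop :=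
  ∀ (F : BoundariedGraph t) (k : ℤ), Q _ (A.glue F) k ↔ Q _ (B.glue F) (k + c)

/-- The equivalence `A ≡ B` of `t`-boundaried graphs with respect to the problem `Q`. -/
def BoundariedEquiv (Q : GraphProblem) {t : ℕ} (A B : BoundariedGraph t) : Prop :=
  ∃ c : ℤ, IsTranspositionConstant Q A B c

/-! ### Generalized protrusions -/

/-- The vertices of `X` that have a neighbour outside `X`. -/
def vertexBoundary {V : Type} (G : SimpleGraph V) (X : Set V) : Set V :=
  {v | v ∈ X ∧ ∃ w, w ∉ X ∧ G.Adj v w}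

/-- `X` is an `r`-DS-protrusion of `G`. -/
def IsDSProtrusion {V : Type} (G : SimpleGraph V) (r : ℕ) (X : Set V) : Prop :=
  (vertexBoundary G X).ncard ≤ r ∧
    ∃ S : Set X, S.ncard ≤ r ∧ IsDominatingSet (G.induce X) S

/-- `X` is an `r`-CDS-protrusion of `G`: the part of `S` in each connected component of `G[X]` is a
connected dominating set of that component. -/
def IsCDSProtrusion {V : Type} (G : SimpleGraph V) (r : ℕ) (X : Set V) : Prop :=
  (vertexBoundary G X).ncard ≤ r ∧
    ∃ S : Set X, S.ncard ≤ r ∧ ∀ C : (G.induce X).ConnectedComponent,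
      IsConnectedDominatingSet ((G.induce X).induce C.supp) {v | (v : X) ∈ S}

/-- The graph `G[X]` as a `t`-boundaried graph: its boundary consists of the vertices of `X` with a
neighbour outside `X`, labelled by `lab`. -/
def inducedBoundaried {V : Type} [Finite V] (G : SimpleGraph V) (X : Set V) {t : ℕ}
    (lab : vertexBoundary G X → Fin t) (hlab : Function.Injective lab) : BoundariedGraph t where
  V := X
  finite := inferInstance
  graph := G.induce X
  boundary := {v | (v : V) ∈ vertexBoundary G X}
  label v := lab ⟨v.1.1, v.2⟩
  label_injective := by
    intro v w h
    have h' := Subtype.ext_iff.mp (hlab h)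
    exact Subtype.ext (Subtype.ext h')

/-! ### Random access machines

The machine has registers and arrays of natural numbers.  The only arithmetic is adding and
subtracting one, so the numbers that occur in the first `T` steps exceed the constants of the
program and the numbers in the initial memory by at most `T`: unit cost per instruction is
realistic, since words of logarithmic length suffice for polynomially many steps. -/

/-- The memory: register `x` holds `reg x`, and cell `i` of array `a` holds `arr a i`. -/
structure Memory where
  reg : ℕ → ℕ
  arr : ℕ → ℕ → ℕ

/-- Programs of the random access machine.  (A program, being finite, refers to finitely many
registers and arrays.) -/
inductive Program : Type
  /-- do nothing -/
  | skip : Program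
  /-- register `x` := the number `c` -/
  | const (x c : ℕ) : Program
  /-- register `x` := register `y` -/
  | copy (x y : ℕ) : Program
  /-- register `x` := register `x` + 1 -/
  | inc (x : ℕ) : Program
  /-- register `x` := register `x` - 1, and 0 stays 0 -/
  | dec (x : ℕ) : Program
  /-- register `x` := the cell of array `a` whose index is in register `i` -/
  | load (x a i : ℕ) : Program
  /-- the cell of array `a` whose index is in register `i` := register `x` -/
  | store (a i x : ℕ) : Program
  /-- first `p`, then `q` -/
  | seq (p q : Program) : Program
  /-- if register `x` < register `y` then `p` else `q` -/
  | ite (x y : ℕ) (p q : Program) : Program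
  /-- as long as register `x` < register `y`, repeat `p` -/
  | loop (x y : ℕ) (p : Program) : Program

namespace Memory

/-- Write `v` to register `x`. -/
def setReg (s : Memory) (x v : ℕ) : Memory :=
  { s with reg := Function.update s.reg x v }

/-- Write `v` to cell `i` of array `a`. -/
def setArr (s : Memory) (a i v : ℕ) : Memory :=
  { s with arr := Function.update s.arr a (Function.update (s.arr a) i v) }

end Memory

/-- `Runs p s n s'`: started on the memory `s`, the program `p` halts after exactly `n` steps with
the memory `s'`.  Every instruction and every test of a condition is one step. -/
inductive Runs : Program → Memory → ℕ → Memory → Prop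
  | skip (s : Memory) : Runs .skip s 1 s
  | const (s : Memory) (x c : ℕ) : Runs (.const x c) s 1 (s.setReg x c)
  | copy (s : Memory) (x y : ℕ) : Runs (.copy x y) s 1 (s.setReg x (s.reg y))
  | inc (s : Memory) (x : ℕ) : Runs (.inc x) s 1 (s.setReg x (s.reg x + 1))
  | dec (s : Memory) (x : ℕ) : Runs (.dec x) s 1 (s.setReg x (s.reg x - 1))
  | load (s : Memory) (x a i : ℕ) : Runs (.load x a i) s 1 (s.setReg x (s.arr a (s.reg i)))
  | store (s : Memory) (a i x : ℕ) : Runs (.store a i x) s 1 (s.setArr a (s.reg i) (s.reg x))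
  | seq {p q : Program} {s s' s'' : Memory} {m n : ℕ} :
      Runs p s m s' → Runs q s' n s'' → Runs (.seq p q) s (m + n) s''
  | ite_true {p q : Program} {s s' : Memory} {x y n : ℕ} :
      s.reg x < s.reg y → Runs p s n s' → Runs (.ite x y p q) s (n + 1) s'
  | ite_false {p q : Program} {s s' : Memory} {x y n : ℕ} :
      ¬ s.reg x < s.reg y → Runs q s n s' → Runs (.ite x y p q) s (n + 1) s'
  | loop_done {p : Program} {s : Memory} {x y : ℕ} :
      ¬ s.reg x < s.reg y → Runs (.loop x y p) s 1 s
  | loop_step {p : Program} {s s' s'' : Memory} {x y m n : ℕ} :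
      s.reg x < s.reg y → Runs p s m s' → Runs (.loop x y p) s' n s'' →
        Runs (.loop x y p) s (m + n + 1) s''

/-- The memory `s` holds the `t`-boundaried graph `A` by adjacency lists: register 0 holds the
number `n` of vertices, which are numbered `0, …, n - 1` in some way; the neighbours of the `i`-th
vertex are listed, each once and in any order, in the cells of array 1 from `arr 0 i` up to (not
including) `arr 0 (i + 1)`; and cell `i` of array 2 holds the label (in `1, …, t`) of the `i`-th
vertex if that is a boundary vertex and 0 if it is not.  Nothing is assumed about the rest of the
memory. -/
def Encodes {t : ℕ} (s : Memory) (A : BoundariedGraph t) : Prop :=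
  ∃ e : Fin (s.reg 0) ≃ A.V,
    s.arr 0 0 = 0 ∧
    ∀ i : Fin (s.reg 0),
      s.arr 0 i ≤ s.arr 0 (i + 1) ∧
      Set.BijOn (s.arr 1) (Set.Ico (s.arr 0 i) (s.arr 0 (i + 1)))
        {j | ∃ hj : j < s.reg 0, A.graph.Adj (e i) (e ⟨j, hj⟩)} ∧
      (∀ h : e i ∈ A.boundary, s.arr 2 i = (A.label ⟨e i, h⟩ : ℕ) + 1) ∧
      (e i ∉ A.boundary → s.arr 2 i = 0)

/-- Started on (a memory that holds) the `t`-boundaried graph `A`, the program `p` halts within `T`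
steps and outputs a `t`-boundaried graph `B` with at most `ξ` vertices that is equivalent to `A`
with respect to `Q`, together with a transposition constant from `A` to `B`, which it leaves as
the difference of registers 1 and 2. -/
def OutputsSmallEquivalent (Q : GraphProblem) {t : ℕ} (p : Program) (A : BoundariedGraph t)
    (ξ T : ℕ) : Prop :=
  ∀ s : Memory, Encodes s A →
    ∃ (n : ℕ) (s' : Memory) (B : BoundariedGraph t),
      Runs p s n s' ∧ n ≤ T ∧ Encodes s' B ∧ Nat.card B.V ≤ ξ ∧ BoundariedEquiv Q A B ∧
        IsTranspositionConstant Q A B ((s'.reg 1 : ℤ) - (s'.reg 2 : ℤ))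

/-! A boundaried graph `A` with a small dominating set has only boundedly many possible behaviours
under gluing. A dominating set of `A ⊕ F` links the two sides only through the labels that it
contains and the labelled vertices dominated from `F`; in the connected case also through the pairs
of labels that are joined inside `F`, which act as virtual edges. So ask, for label sets `S`, `T`, a
size `k ≤ 2 * t` and a set of virtual edges, whether the problem `partialDomination` is solvable in
`A`. Sizes above `2 * t` are irrelevant: more vertices on the side of `A` can be exchanged for at
most `t` dominators and at most `t` boundary vertices (`exists_small_exchange`,
`exists_small_connected_exchange`). Graphs in which the same labels occur and which give the same
answers are therefore equivalent with transposition constant 0 (`dominatingSet_of_transfers`,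
`connectedDominatingSet_of_transfers`). The program is a decision tree over these finitely many
questions, with a fixed representative written into each leaf (`exists_program_of_determined`); the
size bound is the largest representative, raised to at least `t` so that the input has an unlabelled
vertex.

Each question is answered by a bounded search tree. Excluding `H` excludes a large complete
bipartite subgraph (`bicliqueFree_of_not_isTopologicalMinor`). Collect undominated vertices one by
one. If there are `k * h + 1` of them, some member of any solution dominates `h + 1`, and only
boundedly many vertices do so; branch on these (`Effective.dec_extends`). If the collection stops
earlier, what remains is to find a connected set of bounded size that meets boundedly many sets,
which is dynamic programming over sizes and subsets of requirements (`treeAt_iff`, `dec_tree`).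

Without connectivity all of this consists of boundedly many linear scans. With connectivity the
dynamic program needs neighbourhoods of sets, each at quadratic cost, so that the exponent 2
suffices for part 2. -/

/-! ### Total correctness of programs -/

/-- Started on `s`, the program `p` halts within `N` steps on a memory that satisfies `Q`. -/
def Halts (p : Program) (s : Memory) (N : ℕ) (Q : Memory → Prop) : Prop :=
  ∃ n s', Runs p s n s' ∧ n ≤ N ∧ Q s'

@[simp] theorem Memory.setReg_arr (s : Memory) (x v : ℕ) : (s.setReg x v).arr = s.arr := rfl

@[simp] theorem Memory.setArr_reg (s : Memory) (a i v : ℕ) : (s.setArr a i v).reg = s.reg := rfl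

theorem Memory.setReg_reg (s : Memory) (x v r : ℕ) :
    (s.setReg x v).reg r = if r = x then v else s.reg r := by
  simp [Memory.setReg, Function.update_apply]

theorem Memory.setArr_arr (s : Memory) (a i v b j : ℕ) :
    (s.setArr a i v).arr b j = if b = a ∧ j = i then v else s.arr b j := by
  by_cases h : b = a
  · subst h; simp [Memory.setArr, Function.update_apply]
  · simp [Memory.setArr, h]

theorem Memory.setArr_arr_of_ne (s : Memory) {a i v b : ℕ} (h : b ≠ a) :
    (s.setArr a i v).arr b = s.arr b := by
  simp [Memory.setArr, Function.update_of_ne h]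

namespace Halts

variable {p q : Program} {s : Memory} {M N N' : ℕ} {Q Q' : Memory → Prop} {x y : ℕ}

theorem mono (h : Halts p s N Q) (hN : N ≤ N') (hQ : ∀ s', Q s' → Q' s') : Halts p s N' Q' := by
  obtain ⟨n, s', h1, h2, h3⟩ := h
  exact ⟨n, s', h1, h2.trans hN, hQ s' h3⟩

theorem skip (h : Q s) : Halts .skip s 1 Q := ⟨1, _, .skip s, le_rfl, h⟩

theorem const {v : ℕ} (h : Q (s.setReg x v)) : Halts (.const x v) s 1 Q :=
  ⟨1, _, .const s x v, le_rfl, h⟩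

theorem copy (h : Q (s.setReg x (s.reg y))) : Halts (.copy x y) s 1 Q :=
  ⟨1, _, .copy s x y, le_rfl, h⟩

theorem inc (h : Q (s.setReg x (s.reg x + 1))) : Halts (.inc x) s 1 Q :=
  ⟨1, _, .inc s x, le_rfl, h⟩

theorem load {a i : ℕ} (h : Q (s.setReg x (s.arr a (s.reg i)))) : Halts (.load x a i) s 1 Q :=
  ⟨1, _, .load s x a i, le_rfl, h⟩

theorem store {a i : ℕ} (h : Q (s.setArr a (s.reg i) (s.reg x))) : Halts (.store a i x) s 1 Q :=
  ⟨1, _, .store s a i x, le_rfl, h⟩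

theorem seq (h : Halts p s M fun s' => Halts q s' N Q) : Halts (.seq p q) s (M + N) Q := by
  obtain ⟨n, s', h1, h2, n', s'', h3, h4, h5⟩ := h
  exact ⟨n + n', s'', .seq h1 h3, add_le_add h2 h4, h5⟩

theorem ite (hp : s.reg x < s.reg y → Halts p s N Q) (hq : ¬ s.reg x < s.reg y → Halts q s N Q) :
    Halts (.ite x y p q) s (N + 1) Q := by
  by_cases h : s.reg x < s.reg y
  · obtain ⟨n, s', h1, h2, h3⟩ := hp h
    exact ⟨n + 1, s', .ite_true h h1, by omega, h3⟩
  · obtain ⟨n, s', h1, h2, h3⟩ := hq h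
    exact ⟨n + 1, s', .ite_false h h1, by omega, h3⟩

/-- The rule for counting loops. The invariant is indexed by the counter, which the body itself must
advance; every round pays one extra step for the test, and the last test gives the final 1. -/
theorem loop_range {I : ℕ → Memory → Prop} {b c : ℕ}
    (hI : ∀ i s, I i s → s.reg x = i ∧ s.reg y = b)
    (hp : ∀ i s, i < b → I i s → Halts p s c (I (i + 1))) {a : ℕ} (hab : a ≤ b) (hs : I a s) :
    Halts (.loop x y p) s ((b - a) * (c + 1) + 1) (I b) := by
  obtain ⟨k, rfl⟩ := Nat.exists_eq_add_of_le hab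
  clear hab
  induction k generalizing a s with
  | zero =>
    refine ⟨1, s, .loop_done ?_, by omega, hs⟩
    have := hI _ _ hs
    omega
  | succ k ih =>
    obtain ⟨n, s', h1, h2, h3⟩ := hp a s (by omega) hs
    have e : a + (k + 1) = a + 1 + k := by ring
    rw [e] at hI hp ⊢
    obtain ⟨n', s'', h4, h5, h6⟩ := ih (a := a + 1) h3 hI hp
    refine ⟨n + n' + 1, s'', .loop_step ?_ h1 h4, ?_, h6⟩
    · have := hI _ _ hs
      omega
    · have e1 : a + 1 + k - (a + 1) = k := by omega
      have e2 : a + 1 + k - a = k + 1 := by omega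
      rw [e1] at h5
      rw [e2, add_mul, one_mul]
      omega

end Halts

/-! ### Linear search -/

/-- Run `q` with `0, 1, …` in register `x` until it leaves a positive number in register 1, or the
number of vertices is reached. -/
def searchProgram (x : ℕ) (q : Program) : Program :=
  .seq (.const x 0) <| .seq (.const 1 0) <| .loop x 0 <|
    .seq q <| .seq (.const 3 0) <| .ite 3 1 (.copy x 0) (.inc x)

/-- A hit ends the scan, so its bound `B` is paid once, while `c v` bounds the cost of a failure at
`v`. This separation keeps a search cheap when only boundedly many failures are expensive. -/
theorem Halts.search {x n B : ℕ} {q : Program} {Inv : Memory → Prop}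
    {Succ : ℕ → Memory → Prop} {Fail : ℕ → Prop} {c : ℕ → ℕ} (hx0 : x ≠ 0) (hx1 : x ≠ 1)
    (hx3 : x ≠ 3)
    (hn : ∀ s, Inv s → s.reg 0 = n)
    (hset : ∀ s r v, (r = 1 ∨ r = 3 ∨ r = x) → Inv s → Inv (s.setReg r v))
    (hsucc : ∀ i s r v, (r = 3 ∨ r = x) → Succ i s → Succ i (s.setReg r v))
    (hq : ∀ v s, v < n → Inv s → s.reg x = v → ∃ N s', Runs q s N s' ∧ Inv s' ∧ s'.reg x = v ∧
      ((0 < s'.reg 1 ∧ Succ v s' ∧ N ≤ B) ∨ (s'.reg 1 = 0 ∧ Fail v ∧ N ≤ c v)))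
    {s : Memory} (hs : Inv s) :
    Halts (searchProgram x q) s (∑ v ∈ Finset.range n, (c v + 4) + B + 10) fun s' =>
      Inv s' ∧ ((0 < s'.reg 1 ∧ ∃ v < n, Succ v s') ∨ (s'.reg 1 = 0 ∧ ∀ v < n, Fail v)) := by
  have key : ∀ k a s, a + k = n → Inv s → s.reg x = a → s.reg 1 = 0 → (∀ v < a, Fail v) →
      Halts (.loop x 0 <| .seq q <| .seq (.const 3 0) <| .ite 3 1 (.copy x 0) (.inc x)) s
        (∑ v ∈ Finset.Ico a n, (c v + 4) + B + 6) fun s' =>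
        Inv s' ∧ ((0 < s'.reg 1 ∧ ∃ v < n, Succ v s') ∨ (s'.reg 1 = 0 ∧ ∀ v < n, Fail v)) := by
    intro k
    induction k with
    | zero =>
      intro a s ha h1 h2 h3 h4
      refine ⟨1, s, .loop_done ?_, by omega, h1, .inr ⟨h3, fun v hv => h4 v (by omega)⟩⟩
      rw [h2, hn s h1]; omega
    | succ k ih =>
      intro a s ha h1 h2 h3 h4
      have han : a < n := by omega
      have hlt : s.reg x < s.reg 0 := by rw [h2, hn s h1]; exact han
      obtain ⟨N, s', r1, r2, r3, r4⟩ := hq a s han h1 h2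
      have i3 := hset s' 3 0 (by simp) r2
      rcases r4 with ⟨g1, g2, g3⟩ | ⟨g1, g2, g3⟩
      -- A hit moves the scan register to `n`, which ends the loop and leaves register 1 positive.
      · have hi : Runs (.ite 3 1 (.copy x 0) (.inc x)) (s'.setReg 3 0) 2
            ((s'.setReg 3 0).setReg x ((s'.setReg 3 0).reg 0)) := by
          refine .ite_true ?_ (.copy _ _ _)
          simpa [Memory.setReg_reg] using g1
        have i4 := hset (s'.setReg 3 0) x ((s'.setReg 3 0).reg 0) (by simp) i3
        refine ⟨_, _, .loop_step hlt (.seq r1 (.seq (.const _ _ _) hi)) (.loop_done ?_), ?_, i4, ?_⟩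
        · simp only [Memory.setReg_reg, if_true]
          have := hn _ r2
          simp [hx0.symm]
        · omega
        · left
          constructor
          · simpa [Memory.setReg_reg, hx1.symm] using g1
          · exact ⟨a, han, hsucc _ _ _ _ (by simp) (hsucc _ _ _ _ (by simp) g2)⟩
      · have hi : Runs (.ite 3 1 (.copy x 0) (.inc x)) (s'.setReg 3 0) 2
            ((s'.setReg 3 0).setReg x ((s'.setReg 3 0).reg x + 1)) := by
          refine .ite_false ?_ (.inc _ _)
          simp [Memory.setReg_reg, g1]
        have i4 := hset (s'.setReg 3 0) x ((s'.setReg 3 0).reg x + 1) (by simp) i3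
        obtain ⟨N', s'', t1, t2, t3⟩ := ih (a + 1) _ (by omega) i4
          (by simp [Memory.setReg_reg, r3, hx3]) (by simp [Memory.setReg_reg, g1, hx1.symm])
          (by intro v hv
              rcases Nat.lt_succ_iff_lt_or_eq.mp hv with h | h
              · exact h4 v h
              · exact h ▸ g2)
        refine ⟨_, _, .loop_step hlt (.seq r1 (.seq (.const _ _ _) hi)) t1, ?_, t3⟩
        rw [Finset.sum_eq_sum_Ico_succ_bot han]
        omega
  have := key n 0 ((s.setReg x 0).setReg 1 0) (by simp)
    (hset _ _ _ (by simp) (hset _ _ _ (by simp) hs)) (by simp [Memory.setReg_reg, hx1])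
    (by simp [Memory.setReg_reg]) (by simp)
  rw [Nat.Ico_zero_eq_range] at this
  refine (Halts.seq (M := 1) (.const (Halts.seq (M := 1) (.const this)))).mono ?_ fun _ h => h
  omega

/-! ### Configurations and their representation in memory -/

open Classical in
/-- The label of a vertex as it is encoded: from `1` to `t`, and `0` off the boundary. -/
noncomputable def BoundariedGraph.lab {t : ℕ} (A : BoundariedGraph t) (v : A.V) : ℕ :=
  if h : v ∈ A.boundary then (A.label ⟨v, h⟩ : ℕ) + 1 else 0

/-- The closed neighbourhood of a vertex. -/
def SimpleGraph.closedNbhd {V : Type} (G : SimpleGraph V) (v : V) : Set V :=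
  {w | w = v ∨ G.Adj v w}

/-- A boundaried graph together with a sequence of vertices, the values of variables. -/
structure Conf (t : ℕ) where
  A : BoundariedGraph t
  x : ℕ → A.V

namespace Conf

variable {t : ℕ}

/-- Change the value of the variable `m`. -/
def setX (c : Conf t) (m : ℕ) (v : c.A.V) : Conf t where
  A := c.A
  x := Function.update c.x m v

theorem setX_x_self (c : Conf t) (m : ℕ) (v : c.A.V) : (c.setX m v).x m = v :=
  Function.update_self ..

theorem setX_x_of_ne (c : Conf t) {m i : ℕ} (v : c.A.V) (h : i ≠ m) : (c.setX m v).x i = c.x i :=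
  Function.update_of_ne h ..

end Conf

/-- A set of vertices that depends on the configuration. -/
abbrev VSet (t : ℕ) := (c : Conf t) → Set c.A.V

/-- The registers that hold the number of vertices and the first `m` variables. -/
def KeptReg (m r : ℕ) : Prop := r = 0 ∨ (10 ≤ r ∧ r < 10 + m)

/-- The arrays that hold the graph, the first `m` variables and the first `k` sets. -/
def KeptArr (m k a : ℕ) : Prop :=
  -- Arrays `3 * i + 3` and `3 * i + 4` belong to the variable `i` and array `3 * j + 5` to the set
  -- `j`; the residues modulo 3 let both families grow independently.
  a < 3 ∨ (a < 3 * m + 3 ∧ a % 3 ≠ 2) ∨ (a < 3 * k + 5 ∧ a % 3 = 2)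

/-- The memories `s` and `s'` agree in the graph, the first `m` variables and the first `k`
sets. -/
structure Agree (m k : ℕ) (s s' : Memory) : Prop where
  reg : ∀ r, KeptReg m r → s'.reg r = s.reg r
  arr : ∀ a, KeptArr m k a → s'.arr a = s.arr a

namespace Agree

variable {m k r a i v : ℕ} {s s' s'' : Memory}

theorem refl (m k : ℕ) (s : Memory) : Agree m k s s := ⟨fun _ _ => rfl, fun _ _ => rfl⟩

theorem trans (h : Agree m k s s') (h' : Agree m k s' s'') : Agree m k s s'' :=
  ⟨fun r hr => (h'.reg r hr).trans (h.reg r hr), fun a ha => (h'.arr a ha).trans (h.arr a ha)⟩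

theorem mono {m' k' : ℕ} (hm : m ≤ m') (hk : k ≤ k') (h : Agree m' k' s s') : Agree m k s s' :=
  ⟨fun r hr => h.reg r (by unfold KeptReg at *; omega),
    fun a ha => h.arr a (by unfold KeptArr at *; omega)⟩

theorem setReg (h : Agree m k s s') (hr : ¬ KeptReg m r) : Agree m k s (s'.setReg r v) := by
  refine ⟨fun r' hr' => ?_, h.arr⟩
  rw [Memory.setReg_reg, if_neg (by rintro rfl; exact hr hr'), h.reg r' hr']

theorem setArr (h : Agree m k s s') (ha : ¬ KeptArr m k a) : Agree m k s (s'.setArr a i v) := by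
  refine ⟨h.reg, fun a' ha' => ?_⟩
  rw [Memory.setArr_arr_of_ne _ (by rintro rfl; exact ha ha'), h.arr a' ha']

/-- Registers 1 and 3 to 9 are scratch. Register 2 is spared because membership tests expect the
vertex there. -/
theorem of_arr_eq (ha : s'.arr = s.arr) (hr : ∀ r, r < 1 ∨ r = 2 ∨ 10 ≤ r → s'.reg r = s.reg r) :
    Agree m k s s' :=
  ⟨fun r h => hr r (by unfold KeptReg at h; omega), fun _ _ => by rw [ha]⟩

theorem reg_zero (h : Agree m k s s') : s'.reg 0 = s.reg 0 := h.reg 0 (.inl rfl)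

end Agree

/-- The memory `s` holds the graph of `c`, whose vertices are numbered by `e`, the closed
neighbourhoods of the first `m` variables, these variables as one-element sets, and the
sets `zs`. -/
structure Stores {t : ℕ} (m : ℕ) (zs : List (VSet t)) (s : Memory) (c : Conf t) (e : ℕ → c.A.V) :
    Prop where
  inj : ∀ i < s.reg 0, ∀ j < s.reg 0, e i = e j → i = j
  surj : ∀ v, ∃ i < s.reg 0, e i = v
  off_le : ∀ i < s.reg 0, s.arr 0 i ≤ s.arr 0 (i + 1)
  deg_le : ∀ i < s.reg 0, s.arr 0 (i + 1) ≤ s.arr 0 i + s.reg 0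
  nbr_lt : ∀ i < s.reg 0, ∀ p, s.arr 0 i ≤ p → p < s.arr 0 (i + 1) → s.arr 1 p < s.reg 0
  adj : ∀ i < s.reg 0, ∀ j < s.reg 0,
    (∃ p, s.arr 0 i ≤ p ∧ p < s.arr 0 (i + 1) ∧ s.arr 1 p = j) ↔ c.A.graph.Adj (e i) (e j)
  lab : ∀ i < s.reg 0, s.arr 2 i = c.A.lab (e i)
  nbhd : ∀ i < m, ∀ v < s.reg 0, 0 < s.arr (3 * i + 3) v ↔ e v ∈ c.A.graph.closedNbhd (c.x i)
  single : ∀ i < m, ∀ v < s.reg 0, 0 < s.arr (3 * i + 4) v ↔ e v = c.x i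
  sets : ∀ j (hj : j < zs.length), ∀ v < s.reg 0, 0 < s.arr (3 * j + 5) v ↔ e v ∈ zs[j] c

namespace Stores

variable {t m : ℕ} {zs : List (VSet t)} {s s' : Memory} {c : Conf t} {e : ℕ → c.A.V}

theorem agree (h : Stores m zs s c e) (h' : Agree m zs.length s s') : Stores m zs s' c e := by
  have h0 := h'.reg_zero
  have a0 := h'.arr 0 (.inl (by omega))
  have a1 := h'.arr 1 (.inl (by omega))
  have a2 := h'.arr 2 (.inl (by omega))
  refine ⟨by simpa only [h0] using h.inj, by simpa only [h0] using h.surj,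
    by simpa only [h0, a0] using h.off_le, by simpa only [h0, a0] using h.deg_le,
    by simpa only [h0, a0, a1] using h.nbr_lt, by simpa only [h0, a0, a1] using h.adj,
    by simpa only [h0, a2] using h.lab, fun i hi => ?_, fun i hi => ?_, fun j hj => ?_⟩
  · rw [h0, h'.arr (3 * i + 3) (by unfold KeptArr; omega)]
    exact h.nbhd i hi
  · rw [h0, h'.arr (3 * i + 4) (by unfold KeptArr; omega)]
    exact h.single i hi
  · rw [h0, h'.arr (3 * j + 5) (by unfold KeptArr; omega)]
    exact h.sets j hj

theorem of_append {zs' : List (VSet t)} (h : Stores m (zs ++ zs') s c e) : Stores m zs s c e :=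
  { h with
    sets := fun j hj v hv => by
      rw [h.sets j (by simp; omega) v hv, List.getElem_append_left hj] }

theorem snoc {θ : VSet t} (h : Stores m zs s c e) (h' : Agree m zs.length s s')
    (hθ : ∀ v < s.reg 0, 0 < s'.arr (3 * zs.length + 5) v ↔ e v ∈ θ c) :
    Stores m (zs ++ [θ]) s' c e :=
  { h.agree h' with
    sets := fun j hj v hv => by
      rw [h'.reg_zero] at hv
      rcases Nat.lt_or_ge j zs.length with hj' | hj'
      · rw [List.getElem_append_left hj']
        exact (h.agree h').sets j hj' v (by rwa [h'.reg_zero])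
      · have : j = zs.length := by simp at hj; omega
        subst this
        simp [hθ v hv] }

theorem pos (h : Stores m zs s c e) : 0 < s.reg 0 := by
  obtain ⟨i, hi, -⟩ := h.surj (c.x 0)
  omega

end Stores

/-! ### Sets with membership test in constant time -/

/-- There is a program which, when `Pre` holds and the number of a vertex is in register 2, decides
in constant time whether the vertex belongs to `θ`. -/
def Loc {t : ℕ} (m : ℕ) (zs : List (VSet t)) (Pre : Conf t → Prop) (θ : VSet t) : Prop :=
  ∃ p C, ∀ (c : Conf t) (e : ℕ → c.A.V) (s : Memory), Pre c → Stores m zs s c e → s.reg 2 < s.reg 0 →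
    Halts p s C fun s' => s'.arr = s.arr ∧ (∀ r, r < 1 ∨ r = 2 ∨ 10 ≤ r → s'.reg r = s.reg r) ∧
      (0 < s'.reg 1 ↔ e (s.reg 2) ∈ θ c)

namespace Loc

variable {t m : ℕ} {zs : List (VSet t)} {Pre : Conf t → Prop} {θ θ' : VSet t}

theorem mono {zs' : List (VSet t)} {Pre' : Conf t → Prop} (h : Loc m zs Pre θ)
    (hPre : ∀ c, Pre' c → Pre c) (hθ : ∀ c, Pre' c → θ c = θ' c) :
    Loc m (zs ++ zs') Pre' θ' := by
  obtain ⟨p, C, h⟩ := h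
  refine ⟨p, C, fun c e s hc hs hv => ?_⟩
  rw [← hθ c hc]
  exact h c e s (hPre c hc) hs.of_append hv

theorem congr (h : Loc m zs Pre θ) (hθ : ∀ c, Pre c → θ c = θ' c) : Loc m zs Pre θ' := by
  simpa using h.mono (zs' := []) (fun _ => id) hθ

theorem of_array (a : ℕ) (h : ∀ (c : Conf t) (e : ℕ → c.A.V) (s : Memory), Pre c →
    Stores m zs s c e → ∀ v < s.reg 0, 0 < s.arr a v ↔ e v ∈ θ c) : Loc m zs Pre θ :=
  ⟨.load 1 a 2, 1, fun c e s hc hs hv => .load ⟨rfl, fun r hr => by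
    rw [Memory.setReg_reg, if_neg (by omega)], by
    simpa [Memory.setReg_reg] using h c e s hc hs _ hv⟩⟩

theorem closedNbhd {i : ℕ} (hi : i < m) :
    Loc m zs Pre fun c => c.A.graph.closedNbhd (c.x i) :=
  of_array (3 * i + 3) fun _ _ _ _ hs => hs.nbhd i hi

theorem singleton {i : ℕ} (hi : i < m) : Loc m zs Pre fun c => {c.x i} :=
  of_array (3 * i + 4) fun _ _ _ _ hs => hs.single i hi

theorem slot {j : ℕ} (hj : j < zs.length) : Loc m zs Pre fun c => zs[j] c :=
  of_array (3 * j + 5) fun _ _ _ _ hs => hs.sets j hj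

theorem univ : Loc m zs Pre fun _ => Set.univ :=
  ⟨.const 1 1, 1, fun c e s hc hs hv => .const ⟨rfl, fun r hr => by
    rw [Memory.setReg_reg, if_neg (by omega)], by simp [Memory.setReg_reg]⟩⟩

theorem compl (h : Loc m zs Pre θ) : Loc m zs Pre fun c => (θ c)ᶜ := by
  obtain ⟨p, C, h⟩ := h
  refine ⟨.seq p (.seq (.const 3 0) (.ite 3 1 (.const 1 0) (.const 1 1))), C + (1 + (1 + 1)),
    fun c e s hc hs hv => .seq ((h c e s hc hs hv).mono le_rfl ?_)⟩
  rintro s' ⟨h1, h2, h3⟩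
  have hr : ∀ w r, r < 1 ∨ r = 2 ∨ 10 ≤ r → ((s'.setReg 3 0).setReg 1 w).reg r = s.reg r := by
    intro w r hr
    rw [Memory.setReg_reg, if_neg (by omega), Memory.setReg_reg, if_neg (by omega), h2 r hr]
  refine .seq (.const (.ite (fun hlt => .const ⟨h1, hr _, ?_⟩) (fun hlt => .const ⟨h1, hr _, ?_⟩)))
  · simp only [Memory.setReg_reg] at hlt ⊢
    simp at hlt
    simpa using h3.mp hlt
  · simp only [Memory.setReg_reg] at hlt ⊢
    simp at hlt
    simpa [hlt] using h3

theorem inter (h : Loc m zs Pre θ) (h' : Loc m zs Pre θ') : Loc m zs Pre fun c => θ c ∩ θ' c := by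
  obtain ⟨p, C, h⟩ := h
  obtain ⟨p', C', h'⟩ := h'
  refine ⟨.seq p (.seq (.const 3 0) (.ite 3 1 p' .skip)), C + (1 + (C' + 1 + 1)),
    fun c e s hc hs hv => .seq ((h c e s hc hs hv).mono le_rfl ?_)⟩
  rintro s' ⟨h1, h2, h3⟩
  have hr : ∀ r, r < 1 ∨ r = 2 ∨ 10 ≤ r → (s'.setReg 3 0).reg r = s.reg r := by
    intro r hr
    rw [Memory.setReg_reg, if_neg (by omega), h2 r hr]
  have hs' : Stores m zs (s'.setReg 3 0) c e := hs.agree (.of_arr_eq h1 hr)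
  have e2 := hr 2 (by omega)
  have e0 := hr 0 (by omega)
  refine .seq (.const (.ite (fun hlt => ?_) (fun hlt => (Halts.skip ⟨h1, hr, ?_⟩).mono
    (by omega) fun _ => id)))
  · refine (h' c e _ hc hs' (by rw [e0, e2]; exact hv)).mono (by omega) ?_
    rintro s'' ⟨g1, g2, g3⟩
    refine ⟨g1.trans h1, fun r hr' => (g2 r hr').trans (hr r hr'), ?_⟩
    rw [g3, e2]
    simp only [Memory.setReg_reg] at hlt
    simp at hlt
    simp [h3.mp hlt]
  · simp only [Memory.setReg_reg] at hlt ⊢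
    simp at hlt
    have : e (s.reg 2) ∉ θ c := fun hm => by have := h3.mpr hm; omega
    simp [hlt, this]

theorem union (h : Loc m zs Pre θ) (h' : Loc m zs Pre θ') : Loc m zs Pre fun c => θ c ∪ θ' c :=
  (h.compl.inter h'.compl).compl.congr fun c _ => by simp [Set.compl_inter]

theorem empty : Loc m zs Pre fun _ => ∅ :=
  univ.compl.congr fun c _ => by simp

theorem biInter {ι : Type} (I : Finset ι) {f : ι → VSet t} (h : ∀ i ∈ I, Loc m zs Pre (f i)) :
    Loc m zs Pre fun c => ⋂ i ∈ I, f i c := by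
  classical
  induction I using Finset.induction_on with
  | empty => exact univ.congr fun c _ => by simp
  | insert a I ha ih =>
    refine ((h a (by simp)).inter (ih fun i hi => h i (by simp [hi]))).congr fun c _ => ?_
    simp

theorem biUnion {ι : Type} (I : Finset ι) {f : ι → VSet t} (h : ∀ i ∈ I, Loc m zs Pre (f i)) :
    Loc m zs Pre fun c => ⋃ i ∈ I, f i c :=
  (biInter I fun i hi => (h i hi).compl).compl.congr fun c _ => by simp [Set.compl_iInter]

theorem lab (l : ℕ) : Loc m zs Pre fun c => {v | c.A.lab v = l} := by
  -- The machine only tests `<`, so equality with `l` is two failed strict comparisons.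
  refine ⟨.seq (.load 1 2 2) (.seq (.const 3 l) (.ite 1 3 (.const 1 0)
    (.ite 3 1 (.const 1 0) (.const 1 1)))), 1 + (1 + (1 + 1 + 1)), fun c e s hc hs hv => ?_⟩
  have hl := hs.lab _ hv
  have hr : ∀ w r, r < 1 ∨ r = 2 ∨ 10 ≤ r →
      (((s.setReg 1 (s.arr 2 (s.reg 2))).setReg 3 l).setReg 1 w).reg r = s.reg r := by
    intro w r hr
    rw [Memory.setReg_reg, if_neg (by omega), Memory.setReg_reg, if_neg (by omega),
      Memory.setReg_reg, if_neg (by omega)]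
  refine .seq (.load (.seq (.const (.ite (fun hlt =>
      (Halts.const ⟨rfl, hr _, ?_⟩).mono (by omega) fun _ => id)
    (fun hlt => .ite (fun hlt' => .const ⟨rfl, hr _, ?_⟩) (fun hlt' => .const ⟨rfl, hr _, ?_⟩))))))
  all_goals
    simp [Memory.setReg_reg, hl] at *
    try omega

end Loc

/-! ### Predicates decidable in time `O(n ^ d)` -/

/-- There is a program that decides `Ψ` in time `O(n ^ d)` on the configurations that satisfy
`Pre`, and does not change what is stored about them. -/
def Dec {t : ℕ} (d m : ℕ) (zs : List (VSet t)) (Pre Ψ : Conf t → Prop) : Prop :=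
  ∃ p C, ∀ (c : Conf t) (e : ℕ → c.A.V) (s : Memory), Pre c → Stores m zs s c e →
    Halts p s (C * s.reg 0 ^ d) fun s' => Agree m zs.length s s' ∧ (0 < s'.reg 1 ↔ Ψ c)

namespace Dec

variable {t d m : ℕ} {zs : List (VSet t)} {Pre Ψ φ : Conf t → Prop} {θ : VSet t}

theorem mono {Pre' Ψ' : Conf t → Prop} (h : Dec d m zs Pre Ψ) (hPre : ∀ c, Pre' c → Pre c)
    (hΨ : ∀ c, Pre' c → (Ψ c ↔ Ψ' c)) : Dec d m zs Pre' Ψ' := by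
  obtain ⟨p, C, h⟩ := h
  refine ⟨p, C, fun c e s hc hs => ?_⟩
  rw [← hΨ c hc]
  exact h c e s (hPre c hc) hs

theorem const (P : Prop) : Dec d m zs Pre fun _ => P := by
  have key : ∀ w : ℕ, (0 < w ↔ P) → Dec d m zs Pre fun _ => P := by
    refine fun w hw => ⟨.const 1 w, 1, fun c e s hc hs => ?_⟩
    refine Halts.mono (N := 1) (.const ⟨?_, ?_⟩) ?_ fun _ h => h
    · rw [one_mul]; exact Nat.one_le_pow _ _ hs.pos
    · exact (Agree.refl ..).setReg (by unfold KeptReg; omega)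
    · simpa [Memory.setReg_reg] using hw
  by_cases hP : P
  · exact key 1 (by simp [hP])
  · exact key 0 (by simp [hP])

/-- The answer to `φ` enters the precondition of the branch, so either program may rely on it. -/
theorem ite (h : Dec d m zs Pre φ) (h1 : Dec d m zs (fun c => Pre c ∧ φ c) Ψ)
    (h2 : Dec d m zs (fun c => Pre c ∧ ¬ φ c) Ψ) : Dec d m zs Pre Ψ := by
  obtain ⟨p, C, h⟩ := h
  obtain ⟨p1, C1, h1⟩ := h1
  obtain ⟨p2, C2, h2⟩ := h2
  refine ⟨.seq p (.seq (.const 3 0) (.ite 3 1 p1 p2)), C + (C1 + C2 + 2), fun c e s hc hs => ?_⟩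
  have hN : C * s.reg 0 ^ d + (1 + ((C1 + C2) * s.reg 0 ^ d + 1)) ≤
      (C + (C1 + C2 + 2)) * s.reg 0 ^ d := by
    have := Nat.one_le_pow d _ hs.pos
    nlinarith
  refine Halts.mono (.seq ((h c e s hc hs).mono le_rfl ?_)) hN fun _ => id
  rintro s' ⟨g1, g2⟩
  have a1 : Agree m zs.length s (s'.setReg 3 0) := g1.setReg (by unfold KeptReg; omega)
  have hs1 := hs.agree a1
  refine .seq (.const (.ite (fun hlt => ?_) (fun hlt => ?_)))
  · have hφ : φ c := g2.mp (by simpa [Memory.setReg_reg] using hlt)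
    refine (h1 c e _ ⟨hc, hφ⟩ hs1).mono ?_ fun s'' hs'' => ⟨a1.trans hs''.1, hs''.2⟩
    rw [a1.reg_zero]
    nlinarith [Nat.zero_le (C2 * s.reg 0 ^ d)]
  · have hφ : ¬ φ c := fun hφ => hlt (by simpa [Memory.setReg_reg] using g2.mpr hφ)
    refine (h2 c e _ ⟨hc, hφ⟩ hs1).mono ?_ fun s'' hs'' => ⟨a1.trans hs''.1, hs''.2⟩
    rw [a1.reg_zero]
    nlinarith [Nat.zero_le (C1 * s.reg 0 ^ d)]

end Dec

/-! ### Searching all vertices for the value of the next variable -/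

theorem Halts.range_search {t m B n : ℕ} {zs : List (VSet t)} {s : Memory} {q : Program}
    {Succ : ℕ → Memory → Prop} {Fail : ℕ → Prop} {c : ℕ → ℕ} (hn : s.reg 0 = n)
    (hsucc : ∀ i s r v, (r = 3 ∨ r = 10 + m) → Succ i s → Succ i (s.setReg r v))
    (hq : ∀ v s', v < n → Agree m zs.length s s' → s'.reg (10 + m) = v → ∃ N s'', Runs q s' N s'' ∧
      Agree m zs.length s' s'' ∧ s''.reg (10 + m) = v ∧
      ((0 < s''.reg 1 ∧ Succ v s'' ∧ N ≤ B) ∨ (s''.reg 1 = 0 ∧ Fail v ∧ N ≤ c v))) :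
    Halts (searchProgram (10 + m) q) s (∑ v ∈ Finset.range n, (c v + 4) + B + 10) fun s' =>
      Agree m zs.length s s' ∧
        ((0 < s'.reg 1 ∧ ∃ v < n, Succ v s') ∨ (s'.reg 1 = 0 ∧ ∀ v < n, Fail v)) := by
  refine Halts.search (Inv := Agree m zs.length s) (by omega) (by omega) (by omega) ?_ ?_
    hsucc ?_ (Agree.refl ..)
  · intro s' h; rw [h.reg_zero, hn]
  · intro s' r v hr h
    exact h.setReg (by unfold KeptReg; omega)
  · intro v s' hv h1 h2
    obtain ⟨N, s'', g1, g2, g3⟩ := hq v s' hv h1 h2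
    exact ⟨N, s'', g1, h1.trans g2, g3⟩

/-- Decide membership of the vertex with number in register `10 + m`. -/
theorem Loc.test {t m : ℕ} {zs : List (VSet t)} {Pre : Conf t → Prop} {θ : VSet t}
    (h : Loc m zs Pre θ) : ∃ p C, ∀ (c : Conf t) (e : ℕ → c.A.V) (s : Memory), Pre c →
      Stores m zs s c e → s.reg (10 + m) < s.reg 0 →
      Halts p s C fun s' => Agree m zs.length s s' ∧ s'.reg (10 + m) = s.reg (10 + m) ∧
        (0 < s'.reg 1 ↔ e (s.reg (10 + m)) ∈ θ c) := by
  obtain ⟨p, C, h⟩ := h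
  refine ⟨.seq (.copy 2 (10 + m)) p, 1 + C, fun c e s hc hs hv => .seq (.copy ?_)⟩
  have a1 : Agree m zs.length s (s.setReg 2 (s.reg (10 + m))) :=
    (Agree.refl ..).setReg (by unfold KeptReg; omega)
  refine (h c e _ hc (hs.agree a1) (by simpa [Memory.setReg_reg] using hv)).mono le_rfl ?_
  rintro s' ⟨h1, h2, h3⟩
  refine ⟨a1.trans (.of_arr_eq h1 h2), ?_, ?_⟩
  · rw [h2 _ (by omega), Memory.setReg_reg, if_neg (by omega)]
  · simpa [Memory.setReg_reg] using h3

theorem Dec.nonempty {t d m : ℕ} {zs : List (VSet t)} {Pre : Conf t → Prop} {θ : VSet t}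
    (hd : 1 ≤ d) (h : Loc m zs Pre θ) : Dec d m zs Pre fun c => (θ c).Nonempty := by
  obtain ⟨p, C, h⟩ := h.test
  refine ⟨searchProgram (10 + m) p, (C + 4) + C + 10, fun c e s hc hs => ?_⟩
  refine (Halts.range_search (zs := zs) (n := s.reg 0) (B := C) (c := fun _ => C)
    (Succ := fun v _ => e v ∈ θ c) (Fail := fun v => e v ∉ θ c) rfl (fun _ _ _ _ _ => id) ?_).mono
    ?_ ?_
  · intro v s' hv h1 h2
    obtain ⟨N, s'', g1, g2, g3, g4, g5⟩ := h c e s' hc (hs.agree h1) (by rw [h2, h1.reg_zero]; exact hv)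
    rw [h2] at g4 g5
    refine ⟨N, s'', g1, g3, g4, ?_⟩
    rcases Nat.eq_zero_or_pos (s''.reg 1) with h0 | h0
    · exact .inr ⟨h0, fun hm => by have := g5.mpr hm; omega, g2⟩
    · exact .inl ⟨h0, g5.mp h0, g2⟩
  · have := hs.pos
    have := Nat.le_self_pow (show d ≠ 0 by omega) (s.reg 0)
    simp only [Finset.sum_const, Finset.card_range, smul_eq_mul]
    nlinarith
  · rintro s' ⟨h1, h2⟩
    refine ⟨h1, ?_⟩
    rcases h2 with ⟨h2, v, hv, h3⟩ | ⟨h2, h3⟩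
    · exact ⟨fun _ => ⟨_, h3⟩, fun _ => h2⟩
    · refine ⟨fun h => by omega, ?_⟩
      rintro ⟨w, hw⟩
      obtain ⟨i, hi, rfl⟩ := hs.surj w
      exact absurd hw (h3 i hi)

/-! ### Assigning a vertex to a variable -/

/-- Fill the arrays of the variable `m`, whose value has its number in register `10 + m`. -/
def fillProgram (m : ℕ) : Program :=
  .seq (.const 4 0) <| .seq (.const 3 0) <|
  .seq (.loop 3 0 <| .seq (.store (3 * m + 3) 3 4) <| .seq (.store (3 * m + 4) 3 4) (.inc 3)) <|
  .seq (.const 4 1) <| .seq (.store (3 * m + 3) (10 + m) 4) <|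
  .seq (.store (3 * m + 4) (10 + m) 4) <|
  .seq (.load 5 0 (10 + m)) <| .seq (.copy 6 (10 + m)) <| .seq (.inc 6) <| .seq (.load 6 0 6) <|
  .loop 5 6 <| .seq (.load 7 1 5) <| .seq (.store (3 * m + 3) 7 4) (.inc 5)

/-- The cost is linear whatever the degree: two arrays are cleared and one list of at most `n`
neighbours is read. The scan register and register 1 survive, so the search that runs this program
can continue. -/
theorem fillProgram_halts {t m : ℕ} {c : Conf t} {e : ℕ → c.A.V} {s : Memory}
    (hs : Stores m [] s c e) (hv : s.reg (10 + m) < s.reg 0) :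
    Halts (fillProgram m) s (20 * s.reg 0) fun s' => Agree m 0 s s' ∧
      s'.reg (10 + m) = s.reg (10 + m) ∧ s'.reg 1 = s.reg 1 ∧
      Stores (m + 1) [] s' (c.setX m (e (s.reg (10 + m)))) e := by
  set n := s.reg 0 with hn
  set v := s.reg (10 + m) with hv'
  let Base : Memory → Prop := fun s' =>
    Agree m 0 s s' ∧ s'.reg (10 + m) = v ∧ s'.reg 1 = s.reg 1
  have hreg : ∀ s' r w, Base s' → 3 ≤ r → r < 10 → Base (s'.setReg r w) := by
    rintro s' r w ⟨b1, b2, b3⟩ h1 h2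
    exact ⟨b1.setReg (by unfold KeptReg; omega), by rw [Memory.setReg_reg, if_neg (by omega), b2],
      by rw [Memory.setReg_reg, if_neg (by omega), b3]⟩
  have harr : ∀ s' a i w, Base s' → (a = 3 * m + 3 ∨ a = 3 * m + 4) → Base (s'.setArr a i w) := by
    rintro s' a i w ⟨b1, b2, b3⟩ h1
    exact ⟨b1.setArr (by unfold KeptArr; omega), b2, b3⟩
  have h0 : ∀ s', Base s' → s'.reg 0 = n := fun s' h => h.1.reg_zero
  have hA : ∀ s' a, Base s' → a < 3 → s'.arr a = s.arr a := fun s' a h ha =>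
    h.1.arr a (.inl ha)
  set a := s.arr 0 v with ha
  set b := s.arr 0 (v + 1) with hb
  have hab : a ≤ b := hs.off_le v hv
  have hban : b ≤ a + n := hs.deg_le v hv
  have hN : 20 * n ≥ 1 + (1 + ((n - 0) * (3 + 1) + 1 + (1 + (1 + (1 + (1 + (1 + (1 + (1 +
      ((b - a) * (3 + 1) + 1)))))))))) := by omega
  refine Halts.mono (Halts.seq (M := 1) <| .const <| .seq (M := 1) <| .const <| .seq ?_) hN
    fun _ => id
  have b0 : Base ((s.setReg 4 0).setReg 3 0) :=
    hreg _ _ _ (hreg _ _ _ ⟨Agree.refl .., rfl, rfl⟩ (by omega) (by omega)) (by omega) (by omega)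
  refine Halts.mono (Halts.loop_range (b := n) (c := 3) (a := 0) (I := fun i s' =>
      Base s' ∧ s'.reg 4 = 0 ∧ s'.reg 3 = i ∧
        ∀ w < i, s'.arr (3 * m + 3) w = 0 ∧ s'.arr (3 * m + 4) w = 0) ?_ ?_ (by omega) ?_) le_rfl ?_
  · rintro i s' ⟨g1, g2, g3, g4⟩
    exact ⟨g3, h0 s' g1⟩
  · rintro i s' hi ⟨g1, g2, g3, g4⟩
    refine Halts.seq (M := 1) <| .store <| .seq (M := 1) <| .store <| .inc ⟨?_, ?_, ?_, ?_⟩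
    · exact hreg _ _ _ (harr _ _ _ _ (harr _ _ _ _ g1 (.inl rfl)) (.inr rfl)) (by omega) (by omega)
    · simp [Memory.setReg_reg, g2]
    · simp [Memory.setReg_reg, g3]
    · intro w hw
      simp only [Memory.setReg_arr, Memory.setArr_arr, Memory.setArr_reg, g2, g3]
      have n1 : 3 * m + 3 ≠ 3 * m + 4 := by omega
      simp only [n1, n1.symm, false_and, if_false, true_and]
      constructor <;> split_ifs
      · rfl
      · exact (g4 w (by omega)).1
      · rfl
      · exact (g4 w (by omega)).2
  · exact ⟨b0, by simp [Memory.setReg_reg], by simp [Memory.setReg_reg], by simp⟩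
  · rintro s1 ⟨g1, g2, g3, g4⟩
    set s2 := ((s1.setReg 4 1).setArr (3 * m + 3) v 1).setArr (3 * m + 4) v 1 with hs2
    have b2 : Base s2 := harr _ _ _ _ (harr _ _ _ _ (hreg _ _ _ g1 (by omega) (by omega))
      (.inl rfl)) (.inr rfl)
    have b3 := hreg s2 5 a b2 (by omega) (by omega)
    have b4 := hreg _ 6 v b3 (by omega) (by omega)
    have b5 := hreg _ 6 (v + 1) b4 (by omega) (by omega)
    have b6 := hreg _ 6 b b5 (by omega) (by omega)
    refine Halts.seq (M := 1) <| .const <| .seq (M := 1) <| .store <| .seq (M := 1) <| .store <|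
      .seq (M := 1) <| .load <| .seq (M := 1) <| .copy <| .seq (M := 1) <| .inc <|
      .seq (M := 1) <| .load ?_
    have g1v := g1.2.1
    have h10 : 10 + m ≠ 4 ∧ 10 + m ≠ 5 ∧ 10 + m ≠ 6 := by omega
    simp only [Memory.setReg_reg, Memory.setArr_reg, h10, if_false, if_true, g1v]
    rw [← hs2]
    have e0 := hA s2 0 b2 (by omega)
    simp only [Memory.setReg_arr, e0, ← ha, ← hb]
    -- Before list cell `p` is read, the marked vertices are `v` and the neighbours listed in cells
    -- `a, …, p - 1`.
    refine Halts.mono (Halts.loop_range (b := b) (c := 3) (a := a) (I := fun p s' =>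
      Base s' ∧ s'.reg 4 = 1 ∧ s'.reg 5 = p ∧ (s'.reg 6 = b ∧ a ≤ p) ∧
        ∀ w < n, (0 < s'.arr (3 * m + 4) w ↔ w = v) ∧ (0 < s'.arr (3 * m + 3) w ↔
          w = v ∨ ∃ p', a ≤ p' ∧ p' < p ∧ s.arr 1 p' = w)) ?_ ?_ hab ?_) le_rfl ?_
    · rintro i s' ⟨g1, g2, g3, g4, g5⟩
      exact ⟨g3, g4.1⟩
    · rintro i s' hi ⟨k1, k2, k3, ⟨k4, hai⟩, k5⟩
      have e1 := hA s' 1 k1 (by omega)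
      refine Halts.seq (M := 1) <| .load <| .seq (M := 1) <| .store <| .inc ⟨?_, ?_, ?_, ?_, ?_⟩
      · exact hreg _ _ _ (harr _ _ _ _ (hreg _ _ _ k1 (by omega) (by omega)) (.inl rfl))
          (by omega) (by omega)
      · simp [Memory.setReg_reg, k2]
      · simp [Memory.setReg_reg, k3]
      · exact ⟨by simp [Memory.setReg_reg, k4], by omega⟩
      · intro w hw
        simp only [Memory.setReg_arr, Memory.setArr_arr, Memory.setReg_reg, if_true]
        obtain ⟨k6, k7⟩ := k5 w hw
        constructor
        · simpa using k6
        · simp only [k3, e1, true_and]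
          have k2' : (if (4 : ℕ) = 7 then s.arr 1 i else s'.reg 4) = 1 := by simp [k2]
          rw [k2']
          split_ifs with hwi
          · simp only [zero_lt_one, true_iff]
            exact .inr ⟨i, hai, by omega, hwi.symm⟩
          · rw [k7]
            refine or_congr_right ⟨?_, ?_⟩
            · rintro ⟨p', q1, q2, q3⟩; exact ⟨p', q1, by omega, q3⟩
            · rintro ⟨p', q1, q2, q3⟩
              refine ⟨p', q1, ?_, q3⟩
              rcases Nat.lt_succ_iff_lt_or_eq.mp q2 with h | h
              · exact h
              · subst h; exact absurd q3.symm hwi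
    · refine ⟨b6, by simp [hs2, Memory.setReg_reg], by simp [Memory.setReg_reg],
        ⟨by simp [Memory.setReg_reg], le_rfl⟩, fun w hw => ?_⟩
      obtain ⟨g5, g6⟩ := g4 w hw
      have : ¬ ∃ p', a ≤ p' ∧ p' < a ∧ s.arr 1 p' = w := by rintro ⟨p', _, _, _⟩; omega
      simp only [this, or_false, Memory.setReg_arr, hs2, Memory.setArr_arr, true_and]
      have n1 : 3 * m + 3 ≠ 3 * m + 4 := by omega
      simp only [n1, n1.symm, false_and, if_false]
      constructor
      · split_ifs with hw' <;> simp [hw', g6]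
      · split_ifs with hw' <;> simp [hw', g5]
    · rintro s' ⟨k1, k2, k3, k4, k5⟩
      refine ⟨k1.1, k1.2.1, k1.2.2, ?_⟩
      have hst := hs.agree (s' := s') k1.1
      have hn' := h0 s' k1
      refine { hst with nbhd := ?_, single := ?_, sets := by simp }
      · intro i hi w hw
        rcases Nat.lt_succ_iff_lt_or_eq.mp hi with h | rfl
        · rw [Conf.setX_x_of_ne _ _ h.ne]
          exact hst.nbhd i h w hw
        · rw [hn'] at hw
          rw [Conf.setX_x_self, (k5 w hw).2, hs.adj v hv w hw]
          change _ ↔ e w = e v ∨ _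
          refine or_congr_left ⟨fun h => by rw [h], fun h => hs.inj w hw v hv h⟩
      · intro i hi w hw
        rcases Nat.lt_succ_iff_lt_or_eq.mp hi with h | rfl
        · rw [Conf.setX_x_of_ne _ _ h.ne]
          exact hst.single i h w hw
        · rw [hn'] at hw
          rw [Conf.setX_x_self, (k5 w hw).1]
          exact ⟨fun h => by rw [h], fun h => hs.inj w hw v hv h⟩

theorem Stores.setReg {t m r v : ℕ} {zs : List (VSet t)} {s : Memory} {c : Conf t} {e : ℕ → c.A.V}
    (h : Stores m zs s c e) (hr : r ≠ 0) : Stores m zs (s.setReg r v) c e := by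
  have h0 : (s.setReg r v).reg 0 = s.reg 0 := by rw [Memory.setReg_reg, if_neg hr.symm]
  constructor <;> simp only [h0, Memory.setReg_arr]
  exacts [h.inj, h.surj, h.off_le, h.deg_le, h.nbr_lt, h.adj, h.lab, h.nbhd, h.single, h.sets]

-- The program `q` runs only on members of `θ`. Nonmembers cost a constant, and `B'` is charged only
-- for members that fail.
open Classical in
theorem Loc.search {t m : ℕ} {Pre : Conf t → Prop} {θ : VSet t} (h : Loc m [] Pre θ) :
    ∃ p C, ∀ (q : Program) (c : Conf t) (e : ℕ → c.A.V) (s : Memory) (B B' : ℕ)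
      (Succ : ℕ → Memory → Prop) (Fail : ℕ → Prop), Pre c → Stores m [] s c e →
      (∀ i s r v, (r = 3 ∨ r = 10 + m) → Succ i s → Succ i (s.setReg r v)) →
      (∀ v s', v < s.reg 0 → e v ∈ θ c → Stores m [] s' c e → s'.reg 0 = s.reg 0 →
        s'.reg (10 + m) = v → 0 < s'.reg 1 → ∃ N s'', Runs q s' N s'' ∧ Agree m 0 s' s'' ∧
        s''.reg (10 + m) = v ∧
        ((0 < s''.reg 1 ∧ Succ v s'' ∧ N ≤ B) ∨ (s''.reg 1 = 0 ∧ Fail v ∧ N ≤ B'))) →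
      Halts (searchProgram (10 + m) (.seq p (.seq (.const 3 0) (.ite 3 1 q .skip)))) s
        (∑ v ∈ Finset.range (s.reg 0), (C + if e v ∈ θ c ∧ Fail v then B' else 0) + C + B)
        fun s' => Agree m 0 s s' ∧ ((0 < s'.reg 1 ∧ ∃ v < s.reg 0, e v ∈ θ c ∧ Succ v s') ∨
          (s'.reg 1 = 0 ∧ ∀ v < s.reg 0, e v ∈ θ c → Fail v)) := by
  obtain ⟨p, C, h⟩ := h.test
  refine ⟨p, C + 12, fun q c e s B B' Succ Fail hc hs hS hq => ?_⟩
  refine (Halts.range_search (zs := ([] : List (VSet t))) (m := m) (n := s.reg 0) (B := C + 2 + B)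
    (c := fun v => C + 3 + if e v ∈ θ c ∧ Fail v then B' else 0)
    (Succ := fun v s' => e v ∈ θ c ∧ Succ v s') (Fail := fun v => e v ∈ θ c → Fail v) rfl
    (fun i s r v hr g => ⟨g.1, hS i s r v hr g.2⟩) ?_).mono ?_ fun _ g => g
  · intro v s' hv a1 hv'
    have hs' := hs.agree a1
    obtain ⟨N, s'', g1, g2, g3, g4, g5⟩ := h c e s' hc hs' (by rw [hv', a1.reg_zero]; exact hv)
    rw [hv'] at g4 g5
    have a2 : Agree m 0 s' (s''.setReg 3 0) := g3.setReg (by unfold KeptReg; omega)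
    have e1 : (s''.setReg 3 0).reg 1 = s''.reg 1 := by simp [Memory.setReg_reg]
    have e3 : (s''.setReg 3 0).reg 3 = 0 := by simp [Memory.setReg_reg]
    have e10 : (s''.setReg 3 0).reg (10 + m) = v := by
      rw [Memory.setReg_reg, if_neg (by omega), g4]
    rcases Nat.eq_zero_or_pos (s''.reg 1) with h0 | h0
    · have hm : e v ∉ θ c := fun hm => by have := g5.mpr hm; omega
      refine ⟨_, _, .seq g1 (.seq (.const _ _ _) (.ite_false (by omega) (.skip _))), a2, e10,
        .inr ⟨by omega, fun hm' => absurd hm' hm, by omega⟩⟩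
    · have hm := g5.mp h0
      obtain ⟨N', s3, k1, k2, k3, k4⟩ := hq v _ hv hm (hs'.agree a2)
        (a2.reg_zero.trans a1.reg_zero) e10 (by omega)
      refine ⟨_, _, .seq g1 (.seq (.const _ _ _) (.ite_true (by omega) k1)), a2.trans k2, k3, ?_⟩
      rcases k4 with ⟨k4, k5, k6⟩ | ⟨k4, k5, k6⟩
      · exact .inl ⟨k4, ⟨hm, k5⟩, by omega⟩
      · refine .inr ⟨k4, fun _ => k5, ?_⟩
        rw [if_pos ⟨hm, k5⟩]; omega
  · have : ∀ v ∈ Finset.range (s.reg 0), (C + 3 + if e v ∈ θ c ∧ Fail v then B' else 0) + 4 ≤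
        C + 12 + if e v ∈ θ c ∧ Fail v then B' else 0 := fun v _ => by omega
    have := Finset.sum_le_sum this
    omega

namespace Dec

variable {t d m : ℕ} {zs : List (VSet t)} {Pre Pre' Ψ Ψ' φ : Conf t → Prop} {θ : VSet t}

/-- Assign some member of `θ` to the variable `m`, or find that there is none. -/
theorem find (hd : 1 ≤ d) (h : Loc m [] Pre θ) (h1 : Dec d (m + 1) [] Pre' Ψ')
    (hPre : ∀ c v, Pre c → v ∈ θ c → Pre' (c.setX m v) ∧ (Ψ' (c.setX m v) ↔ Ψ c))
    (h2 : Dec d m [] (fun c => Pre c ∧ θ c = ∅) Ψ) : Dec d m [] Pre Ψ := by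
  obtain ⟨p, C, h⟩ := h.search
  obtain ⟨p1, C1, h1⟩ := h1
  obtain ⟨p2, C2, h2⟩ := h2
  refine ⟨.seq (searchProgram (10 + m) (.seq p (.seq (.const 3 0)
      (.ite 3 1 (fillProgram m) .skip)))) (.seq (.const 3 0) (.ite 3 1 p1 p2)),
    (C + C + 20) + 2 + C1 + C2, fun c e s hc hs => ?_⟩
  have hn := hs.pos
  have hnd := Nat.le_self_pow (show d ≠ 0 by omega) (s.reg 0)
  -- Filling the arrays never fails, so the search stops at the first member of `θ` and the linear
  -- cost of filling is paid once.
  have key := h (fillProgram m) c e s (20 * s.reg 0) 0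
    (fun v s' => Stores (m + 1) [] s' (c.setX m (e v)) e) (fun _ => False) hc hs
    (fun i s r v hr g => g.setReg (by omega)) (by
      intro v s' hv hm hs' h0 hv' hr
      obtain ⟨N, s'', g1, g2, g3, g4, g5, g6⟩ :=
        fillProgram_halts hs' (by rw [hv', h0]; exact hv)
      rw [hv'] at g4 g6
      exact ⟨N, s'', g1, g3, g4, .inl ⟨by omega, g6, by rw [← h0]; exact g2⟩⟩)
  refine Halts.mono (.seq (N := 1 + ((C1 + C2) * s.reg 0 ^ d + 1)) (key.mono le_rfl ?_)) ?_
    fun _ => id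
  · rintro s1 ⟨a1, g⟩
    have e1 : (s1.setReg 3 0).reg 1 = s1.reg 1 := by simp [Memory.setReg_reg]
    have e3 : (s1.setReg 3 0).reg 3 = 0 := by simp [Memory.setReg_reg]
    have a2 : Agree m 0 s (s1.setReg 3 0) := a1.setReg (by unfold KeptReg; omega)
    refine .seq (.const (.ite (fun hlt => ?_) (fun hlt => ?_)))
    · rcases g with ⟨g1, v, hv, hm, g2⟩ | ⟨g1, -⟩
      · refine (h1 (c.setX m (e v)) e _ (hPre c _ hc hm).1 (g2.setReg (by omega))).mono ?_ ?_
        · rw [a2.reg_zero]; nlinarith [Nat.zero_le (C2 * s.reg 0 ^ d)]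
        · rintro s2 ⟨a3, g3⟩
          exact ⟨a2.trans (a3.mono (by omega) le_rfl), by rw [g3, (hPre c _ hc hm).2]⟩
      · omega
    · rcases g with ⟨g1, -⟩ | ⟨g1, g2⟩
      · omega
      · have hθ : θ c = ∅ := by
          refine Set.eq_empty_of_forall_notMem fun w hw => ?_
          obtain ⟨i, hi, rfl⟩ := hs.surj w
          exact g2 i hi hw
        refine (h2 c e _ ⟨hc, hθ⟩ (hs.agree a2)).mono ?_ ?_
        · rw [a2.reg_zero]; nlinarith [Nat.zero_le (C1 * s.reg 0 ^ d)]
        · rintro s2 ⟨a3, g3⟩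
          exact ⟨a2.trans a3, g3⟩
  · simp only [and_false, if_false, add_zero, Finset.sum_const, Finset.card_range, smul_eq_mul]
    nlinarith

/-- Decide whether some member of `θ`, as the value of the variable `m`, satisfies `Ψ'`, where only
boundedly many members of `θ` do not satisfy `Ψ'`. -/
theorem exists_of_bounded (hd : 1 ≤ d) (M : ℕ) (h : Loc m [] Pre θ) (h1 : Dec d (m + 1) [] Pre' Ψ')
    (hPre : ∀ c v, Pre c → v ∈ θ c → Pre' (c.setX m v))
    (hM : ∀ c, Pre c → {v ∈ θ c | ¬ Ψ' (c.setX m v)}.ncard ≤ M) :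
    Dec d m [] Pre fun c => ∃ v ∈ θ c, Ψ' (c.setX m v) := by
  classical
  obtain ⟨p, C, h⟩ := h.search
  obtain ⟨p1, C1, h1⟩ := h1
  refine ⟨searchProgram (10 + m) (.seq p (.seq (.const 3 0)
      (.ite 3 1 (.seq (fillProgram m) p1) .skip))),
    C + C + (M + 1) * (20 + C1), fun c e s hc hs => ?_⟩
  have hn := hs.pos
  have hnd := Nat.le_self_pow (show d ≠ 0 by omega) (s.reg 0)
  obtain ⟨Fail, hFail⟩ : ∃ F : ℕ → Prop, ∀ v, F v ↔ ¬ Ψ' (c.setX m (e v)) := ⟨_, fun _ => Iff.rfl⟩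
  have key := h (.seq (fillProgram m) p1) c e s ((20 + C1) * s.reg 0 ^ d)
    ((20 + C1) * s.reg 0 ^ d) (fun v _ => Ψ' (c.setX m (e v))) Fail hc hs
    (fun i s r v hr g => g) (by
      intro v s' hv hm hs' h0 hv' hr
      obtain ⟨N, s'', g1, g2, g3, g4, g5, g6⟩ :=
        fillProgram_halts hs' (by rw [hv', h0]; exact hv)
      rw [hv'] at g4 g6
      obtain ⟨N', s3, k1, k2, k3, k4⟩ := h1 (c.setX m (e v)) e _ (hPre c _ hc hm) g6
      have hN : N + N' ≤ (20 + C1) * s.reg 0 ^ d := by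
        rw [h0] at g2
        rw [g3.reg_zero, h0] at k2
        nlinarith
      refine ⟨N + N', s3, .seq g1 k1, g3.trans (k3.mono (by omega) le_rfl), ?_, ?_⟩
      · rw [k3.reg _ (by unfold KeptReg; omega), g4]
      · rcases Nat.eq_zero_or_pos (s3.reg 1) with h0 | h0
        · exact .inr ⟨h0, (hFail v).mpr fun hm => by have := k4.mpr hm; omega, hN⟩
        · exact .inl ⟨h0, k4.mp h0, hN⟩)
  refine key.mono ?_ ?_
  · rw [Finset.sum_add_distrib, ← Finset.sum_filter, Finset.sum_const, Finset.sum_const,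
      Finset.card_range, smul_eq_mul, smul_eq_mul]
    -- Expensive failures are distinct members of `θ` that violate `Ψ'`, hence at most `M`; with one
    -- possible success this gives the factor `M + 1`.
    have hcard : ((Finset.range (s.reg 0)).filter
        fun v => e v ∈ θ c ∧ Fail v).card ≤ M := by
      have : Finite c.A.V := c.A.finite
      refine le_trans ?_ (hM c hc)
      rw [← Set.ncard_coe_finset]
      refine Set.ncard_le_ncard_of_injOn e ?_ ?_ (Set.toFinite _)
      · intro v hv
        have := (Finset.mem_filter.mp hv).2
        exact ⟨this.1, (hFail v).mp this.2⟩
      · intro v hv w hw hvw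
        simp only [Finset.coe_filter, Finset.mem_range, Set.mem_ofPred_eq] at hv hw
        exact hs.inj v hv.1 w hw.1 hvw
    have := Nat.mul_le_mul_right ((20 + C1) * s.reg 0 ^ d) hcard
    nlinarith
  · rintro s' ⟨a1, g⟩
    refine ⟨a1, ?_⟩
    rcases g with ⟨g1, v, hv, g2⟩ | ⟨g1, g2⟩
    · exact ⟨fun _ => ⟨_, g2⟩, fun _ => g1⟩
    · refine ⟨fun h => by omega, ?_⟩
      rintro ⟨w, hw, hw'⟩
      obtain ⟨i, hi, rfl⟩ := hs.surj w
      exact absurd hw' ((hFail i).mp (g2 i hi hw))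

/-! ### Tabulating sets -/

/-- Tabulate the set `θ`. -/
theorem tabulate (hd : 1 ≤ d) (h : Loc m zs Pre θ) (h1 : Dec d m (zs ++ [θ]) Pre Ψ) :
    Dec d m zs Pre Ψ := by
  obtain ⟨p, C, h⟩ := h
  obtain ⟨p1, C1, h1⟩ := h1
  set k := zs.length with hk
  refine ⟨.seq (.const 2 0) (.seq (.loop 2 0 (.seq p (.seq (.store (3 * k + 5) 2 1) (.inc 2)))) p1),
    C + 5 + C1, fun c e s hc hs => ?_⟩
  have hn := hs.pos
  have hnd := Nat.le_self_pow (show d ≠ 0 by omega) (s.reg 0)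
  have hN : 1 + ((s.reg 0 - 0) * (C + (1 + 1) + 1) + 1 + C1 * s.reg 0 ^ d) ≤
      (C + 5 + C1) * s.reg 0 ^ d := by
    rw [Nat.sub_zero]; nlinarith
  refine Halts.mono (.seq (.const (.seq (Halts.mono (Halts.loop_range (b := s.reg 0)
    (c := C + (1 + 1)) (a := 0) (I := fun i s' => Agree m k s s' ∧ s'.reg 2 = i ∧
      ∀ w < i, 0 < s'.arr (3 * k + 5) w ↔ e w ∈ θ c) ?_ ?_ (by omega) ?_) le_rfl ?_)))) hN fun _ => id
  · rintro i s' ⟨g1, g2, g3⟩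
    exact ⟨g2, g1.reg_zero⟩
  · rintro i s' hi ⟨g1, g2, g3⟩
    refine .seq ((h c e s' hc (hs.agree g1) (by rw [g2, g1.reg_zero]; exact hi)).mono le_rfl ?_)
    rintro s'' ⟨k1, k2, k3⟩
    have e2 := k2 2 (by omega)
    refine .seq (.store (.inc ⟨?_, ?_, ?_⟩))
    · exact ((g1.trans (.of_arr_eq k1 k2)).setArr (by unfold KeptArr; omega)).setReg
        (by unfold KeptReg; omega)
    · simp [Memory.setReg_reg, e2, g2]
    · intro w hw
      simp only [Memory.setReg_arr, Memory.setArr_arr, true_and, e2, g2, k1]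
      rw [g2] at k3
      split_ifs with hwi
      · rw [k3, hwi]
      · exact g3 w (by omega)
  · exact ⟨(Agree.refl ..).setReg (by unfold KeptReg; omega), by simp [Memory.setReg_reg], by simp⟩
  · rintro s1 ⟨g1, g2, g3⟩
    refine (h1 c e s1 hc (hs.snoc g1 g3)).mono (by rw [g1.reg_zero]) ?_
    rintro s2 ⟨k1, k2⟩
    exact ⟨g1.trans (k1.mono le_rfl (by simp; omega)), k2⟩

/-- Tabulate the neighbourhood of a tabulated set. -/
theorem tabulate_nbhd (hd : 2 ≤ d) {j : ℕ} (hj : j < zs.length)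
    (h1 : Dec d m (zs ++ [fun c => {v | ∃ w, c.A.graph.Adj v w ∧ w ∈ zs[j] c}]) Pre Ψ) :
    Dec d m zs Pre Ψ := by
  obtain ⟨p1, C1, h1⟩ := h1
  set k := zs.length with hk
  refine ⟨.seq (.const 2 0) (.seq (.loop 2 0 (
    .seq (.const 8 0) <| .seq (.load 5 0 2) <| .seq (.copy 6 2) <| .seq (.inc 6) <|
    .seq (.load 6 0 6) <| .seq (.const 4 0) <|
    .seq (.loop 5 6 (.seq (.load 7 1 5) <| .seq (.load 7 (3 * j + 5) 7) <|
      .seq (.ite 4 7 (.const 8 1) .skip) (.inc 5))) <|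
    .seq (.store (3 * k + 5) 2 8) (.inc 2))) p1), 30 + C1, fun c e s hc hs => ?_⟩
  have hn := hs.pos
  -- There are `n` adjacency lists with at most `n` entries each; this is where `2 ≤ d` is needed.
  have hnd : s.reg 0 * s.reg 0 ≤ s.reg 0 ^ d := by
    rw [← sq]; exact Nat.pow_le_pow_right hn hd
  set n := s.reg 0 with hn0
  have hN : 1 + ((n - 0) * ((8 + (n * 6 + 1)) + 1) + 1 + C1 * n ^ d) ≤ (30 + C1) * n ^ d := by
    rw [Nat.sub_zero]; nlinarith
  refine Halts.mono (.seq (.const (.seq (Halts.mono (Halts.loop_range (b := n)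
    (c := 8 + (n * 6 + 1)) (a := 0) (I := fun i s' => Agree m k s s' ∧ s'.reg 2 = i ∧
      ∀ w < i, 0 < s'.arr (3 * k + 5) w ↔ ∃ u, c.A.graph.Adj (e w) u ∧ u ∈ zs[j] c)
      ?_ ?_ (by omega) ?_) le_rfl ?_)))) hN fun _ => id
  · rintro i s' ⟨g1, g2, g3⟩
    exact ⟨g2, g1.reg_zero⟩
  · rintro i s' hi ⟨g1, g2, g3⟩
    have hs' := hs.agree g1
    have e0 : s'.arr 0 = s.arr 0 := g1.arr 0 (.inl (by omega))
    set a := s.arr 0 i with ha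
    set b := s.arr 0 (i + 1) with hb
    have hab : a ≤ b := hs.off_le i hi
    have hban : b ≤ a + n := hs.deg_le i hi
    have hN : 1 + (1 + (1 + (1 + (1 + (1 + ((b - a) * (1 + (1 + (1 + 1 + 1)) + 1) + 1 + (1 + 1))))))) ≤
        8 + (n * 6 + 1) := by
      have := Nat.mul_le_mul_right 6 (show b - a ≤ n by omega)
      omega
    have hset : ∀ s'' r w, Agree m k s s'' → 1 ≤ r → r < 10 → Agree m k s (s''.setReg r w) :=
      fun s'' r w g h1 h2 => g.setReg (by unfold KeptReg; omega)
    refine Halts.mono (Halts.seq (M := 1) <| .const <| .seq (M := 1) <| .load <|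
      .seq (M := 1) <| .copy <| .seq (M := 1) <| .inc <| .seq (M := 1) <| .load <|
      .seq (M := 1) <| .const <| .seq <| Halts.mono (Halts.loop_range (b := b)
      (c := 1 + (1 + (1 + 1 + 1))) (a := a) (I := fun p s'' =>
        Agree m k s s'' ∧ s''.arr (3 * k + 5) = s'.arr (3 * k + 5) ∧ s''.reg 2 = i ∧ s''.reg 4 = 0 ∧
        s''.reg 5 = p ∧ s''.reg 6 = b ∧ a ≤ p ∧
        (0 < s''.reg 8 ↔ ∃ p', a ≤ p' ∧ p' < p ∧ 0 < s.arr (3 * j + 5) (s.arr 1 p'))) ?_ ?_ hab ?_)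
        le_rfl ?_) hN fun _ => id
    · rintro p s'' ⟨-, -, -, -, k1, k2, -⟩
      exact ⟨k1, k2⟩
    · rintro p s'' hp ⟨k1, k2, k3, k4, k5, k6, k7, k8⟩
      have e1 : s''.arr 1 = s.arr 1 := k1.arr 1 (.inl (by omega))
      have ej : s''.arr (3 * j + 5) = s.arr (3 * j + 5) := k1.arr _ (by unfold KeptArr; omega)
      refine .seq <| .load <| .seq <| .load ?_
      simp only [Memory.setReg_reg, Memory.setReg_arr, if_true, e1, ej, k5]
      have k1' := hset _ 7 (s.arr (3 * j + 5) (s.arr 1 p)) (hset _ 7 (s.arr 1 p) k1 (by omega)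
        (by omega)) (by omega) (by omega)
      have hex : ∀ P : Prop, (P ↔ 0 < s.arr (3 * j + 5) (s.arr 1 p)) →
          ((∃ p', a ≤ p' ∧ p' < p + 1 ∧ 0 < s.arr (3 * j + 5) (s.arr 1 p')) ↔
            (∃ p', a ≤ p' ∧ p' < p ∧ 0 < s.arr (3 * j + 5) (s.arr 1 p')) ∨ P) := by
        intro P hP
        constructor
        · rintro ⟨p', q1, q2, q3⟩
          rcases Nat.lt_succ_iff_lt_or_eq.mp q2 with h | rfl
          · exact .inl ⟨p', q1, h, q3⟩
          · exact .inr (hP.mpr q3)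
        · rintro (⟨p', q1, q2, q3⟩ | h)
          · exact ⟨p', q1, by omega, q3⟩
          · exact ⟨p, k7, by omega, hP.mp h⟩
      refine .seq (.ite (fun hlt => .const (.inc ⟨?_, ?_, ?_, ?_, ?_, ?_, ?_, ?_⟩))
        (fun hlt => .skip (.inc ⟨?_, ?_, ?_, ?_, ?_, ?_, ?_, ?_⟩)))
      · exact hset _ _ _ (hset _ _ _ k1' (by omega) (by omega)) (by omega) (by omega)
      · exact k2
      · simp [Memory.setReg_reg, k3]
      · simp [Memory.setReg_reg, k4]
      · simp [Memory.setReg_reg, k5]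
      · simp [Memory.setReg_reg, k6]
      · omega
      · simp [Memory.setReg_reg, k4] at hlt ⊢
        exact ⟨p, k7, by omega, hlt⟩
      · exact hset _ _ _ k1' (by omega) (by omega)
      · exact k2
      · simp [Memory.setReg_reg, k3]
      · simp [Memory.setReg_reg, k4]
      · simp [Memory.setReg_reg, k5]
      · simp [Memory.setReg_reg, k6]
      · omega
      · rw [hex False]
        · simpa [Memory.setReg_reg] using k8
        · simp [Memory.setReg_reg, k4] at hlt ⊢
          exact hlt
    · simp only [Memory.setReg_reg, Memory.setReg_arr, e0]
      have hai : s.arr 0 i = a := rfl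
      have hbi : s.arr 0 (i + 1) = b := rfl
      refine ⟨?_, trivial, ?_, ?_, ?_, ?_, le_rfl, ?_⟩
      · exact hset _ _ _ (hset _ _ _ (hset _ _ _ (hset _ _ _ (hset _ _ _ (hset _ _ _ g1
          (by omega) (by omega)) (by omega) (by omega)) (by omega) (by omega)) (by omega)
          (by omega)) (by omega) (by omega)) (by omega) (by omega)
      · simp [g2]
      · simp
      · simp [g2, hai]
      · simp [g2, hbi]
      · simp
        intros; omega
    · rintro s'' ⟨k1, k2, k3, k4, k5, k6, k7, k8⟩
      refine .seq <| .store <| .inc ⟨?_, ?_, ?_⟩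
      · exact hset _ _ _ (k1.setArr (by unfold KeptArr; omega)) (by omega) (by omega)
      · simp [Memory.setReg_reg, k3]
      · intro w hw
        simp only [Memory.setReg_arr, Memory.setArr_arr, true_and, k3, k2]
        split_ifs with hwi
        · rw [k8, hwi]
          constructor
          · rintro ⟨p', q1, q2, q3⟩
            have hlt := hs.nbr_lt i hi p' q1 q2
            exact ⟨e (s.arr 1 p'), (hs.adj i hi _ hlt).mp ⟨p', q1, q2, rfl⟩,
              (hs.sets j hj _ hlt).mp q3⟩
          · rintro ⟨u, hu, hu'⟩
            obtain ⟨l, hl, rfl⟩ := hs.surj u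
            obtain ⟨p', q1, q2, rfl⟩ := (hs.adj i hi _ hl).mpr hu
            exact ⟨p', q1, q2, (hs.sets j hj _ hl).mpr hu'⟩
        · exact g3 w (by omega)
  · exact ⟨(Agree.refl ..).setReg (by unfold KeptReg; omega), by simp [Memory.setReg_reg], by simp⟩
  · rintro s1 ⟨g1, g2, g3⟩
    refine (h1 c e s1 hc (hs.snoc g1 g3)).mono (by rw [g1.reg_zero]) ?_
    rintro s2 ⟨k1, k2⟩
    exact ⟨g1.trans (k1.mono le_rfl (by simp; omega)), k2⟩

end Dec

open Relation

/-! ### Connected sets of bounded size -/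

theorem reflTransGen_map {α β : Type} {r : α → α → Prop} {p : β → β → Prop} (f : α → β)
    (h : ∀ a b, r a b → p (f a) (f b)) {a b : α} (hab : ReflTransGen r a b) :
    ReflTransGen p (f a) (f b) := by
  induction hab with
  | refl => exact .refl
  | tail _ h' ih => exact ih.tail (h _ _ h')

/-- Any two elements of `D` are joined by a path of `ρ` in `D`. -/
def ConnOn {V : Type} (ρ : V → V → Prop) (D : Set V) : Prop :=
  ∀ u ∈ D, ∀ v ∈ D, ReflTransGen (fun a b => ρ a b ∧ a ∈ D ∧ b ∈ D) u v

theorem ConnOn.of_root {V : Type} {ρ : V → V → Prop} {D : Set V} (hρ : ∀ a b, ρ a b → ρ b a)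
    (v : V) (h : ∀ u ∈ D, ReflTransGen (fun a b => ρ a b ∧ a ∈ D ∧ b ∈ D) v u) : ConnOn ρ D := by
  have hsymm : Std.Symm (fun a b => ρ a b ∧ a ∈ D ∧ b ∈ D) :=
    ⟨fun a b h => ⟨hρ _ _ h.1, h.2.2, h.2.1⟩⟩
  exact fun u hu w hw => (ReflTransGen.stdSymm.symm _ _ (h u hu)).trans (h w hw)

/-- There is a connected set of size at most `s` that contains `v`, is contained in `α` and
meets `req r` for each `r ∈ Q`. -/
def TreeAt {V ι : Type} (ρ : V → V → Prop) (α : Set V) (req : ι → Set V) (s : ℕ) (Q : Finset ι)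
    (v : V) : Prop :=
  ∃ D : Finset V, v ∈ D ∧ D.card ≤ s ∧ ↑D ⊆ α ∧ ConnOn ρ (D : Set V) ∧ ∀ r ∈ Q, ∃ w ∈ D, w ∈ req r

/-- Take a connected set with a vertex besides `v`, and a neighbour `w` of `v` in it. The component
of `w` after deletion of `v` splits off, and the rest stays connected through `v`. Both parts are
nonempty, hence smaller, and each requirement is met in one of them. Conversely the edge `vw` joins
two connected sets. This is the recursion of the dynamic program. -/
theorem treeAt_iff {V ι : Type} [DecidableEq ι] {ρ : V → V → Prop} (hρ : ∀ a b, ρ a b → ρ b a)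
    {α : Set V} {req : ι → Set V} {s : ℕ} {Q : Finset ι} {v : V} :
    TreeAt ρ α req (s + 1) Q v ↔ (v ∈ α ∧ ∀ r ∈ Q, v ∈ req r) ∨
      ∃ s₁ ≤ s, ∃ s₂ ≤ s, ∃ Q₁ Q₂ : Finset ι, s₁ + s₂ = s + 1 ∧ Q₁ ∪ Q₂ = Q ∧
        TreeAt ρ α req s₁ Q₁ v ∧ ∃ w, ρ v w ∧ TreeAt ρ α req s₂ Q₂ w := by
  classical
  constructor
  · rintro ⟨D, hv, hs, hα, hD, hQ⟩
    by_cases hne : ∃ u ∈ D, u ≠ v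
    · right
      obtain ⟨u, hu, huv⟩ := hne
      obtain ⟨w, hw, hwv, hvw⟩ : ∃ w ∈ D, w ≠ v ∧ ρ v w := by
        have : ∀ x, ReflTransGen (fun a b => ρ a b ∧ a ∈ (D : Set V) ∧ b ∈ (D : Set V)) v x →
            x = v ∨ ∃ w ∈ D, w ≠ v ∧ ρ v w := by
          intro x hx
          induction hx with
          | refl => exact .inl rfl
          | @tail y z _ hyz ih =>
            rcases ih with rfl | h
            · by_cases hz : z = y
              · exact .inl hz
              · exact .inr ⟨z, hyz.2.2, hz, hyz.1⟩
            · exact .inr h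
        exact (this u (hD v hv u hu)).resolve_left huv
      -- Steps of `r` stay in `D` and never enter `v`, so `r` explores the component of `w` in `D`
      -- without `v`.
      let r : V → V → Prop := fun a b => ρ a b ∧ b ∈ D ∧ b ≠ v
      have hr : ∀ x, ReflTransGen r w x → x ∈ D ∧ x ≠ v := by
        intro x hx
        cases hx with
        | refl => exact ⟨hw, hwv⟩
        | tail _ h => exact h.2
      set D₂ := D.filter (ReflTransGen r w) with hD₂
      set D₁ := D \ D₂ with hD₁
      have hw₂ : w ∈ D₂ := Finset.mem_filter.mpr ⟨hw, .refl⟩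
      have hv₁ : v ∈ D₁ := Finset.mem_sdiff.mpr ⟨hv, fun h =>
        (hr v (Finset.mem_filter.mp h).2).2 rfl⟩
      have hsub₁ : D₁ ⊆ D := Finset.sdiff_subset
      have hsub₂ : D₂ ⊆ D := Finset.filter_subset _ _
      have hcard : D₁.card + D₂.card = D.card := Finset.card_sdiff_add_card_eq_card hsub₂
      have hp₁ : 0 < D₁.card := Finset.card_pos.mpr ⟨v, hv₁⟩
      have hp₂ : 0 < D₂.card := Finset.card_pos.mpr ⟨w, hw₂⟩
      have hc₁ : ConnOn ρ (D₁ : Set V) := by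
        refine .of_root hρ v fun x hx => ?_
        have hxD : x ∈ D := hsub₁ hx
        have := hD v hv x hxD
        clear hxD
        induction this with
        | refl => exact .refl
        | @tail y z _ hyz ih =>
          by_cases hy : y ∈ D₁
          · exact (ih hy).tail ⟨hyz.1, hy, hx⟩
          · have hy₂ : y ∈ D₂ := by
              by_contra h
              exact hy (Finset.mem_sdiff.mpr ⟨hyz.2.1, h⟩)
            -- A walk that has strayed into `D₂` can leave it only through `v`, where a walk inside
            -- `D₁` can start afresh.
            by_cases hz : z = v
            · exact hz ▸ .refl
            · refine absurd ?_ (Finset.mem_sdiff.mp hx).2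
              exact Finset.mem_filter.mpr ⟨hyz.2.2,
                (Finset.mem_filter.mp hy₂).2.tail ⟨hyz.1, hyz.2.2, hz⟩⟩
      have hc₂ : ConnOn ρ (D₂ : Set V) := by
        refine .of_root hρ w fun x hx => ?_
        have := (Finset.mem_filter.mp hx).2
        clear hx
        induction this with
        | refl => exact .refl
        | @tail y z hy hyz ih =>
          exact ih.tail ⟨hyz.1, Finset.mem_filter.mpr ⟨(hr y hy).1, hy⟩,
            Finset.mem_filter.mpr ⟨hyz.2.1, hy.tail hyz⟩⟩
      -- The second size is the remaining budget, not the size of `D₂`, so that the two add up to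
      -- exactly `s + 1`.
      refine ⟨D₁.card, by omega, s + 1 - D₁.card, by omega,
        Q.filter fun r => ∃ w ∈ D₁, w ∈ req r, Q.filter fun r => ∃ w ∈ D₂, w ∈ req r, by omega, ?_,
        ⟨D₁, hv₁, le_rfl, fun x hx => hα (hsub₁ hx), hc₁, fun r hr => (Finset.mem_filter.mp hr).2⟩,
        w, hvw, ⟨D₂, hw₂, by omega, fun x hx => hα (hsub₂ hx), hc₂,
          fun r hr => (Finset.mem_filter.mp hr).2⟩⟩
      ext q
      simp only [Finset.mem_union, Finset.mem_filter, ← and_or_left, and_iff_left_iff_imp]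
      intro hq
      obtain ⟨y, hy, hyq⟩ := hQ q hq
      by_cases hy₂ : y ∈ D₂
      · exact .inr ⟨y, hy₂, hyq⟩
      · exact .inl ⟨y, Finset.mem_sdiff.mpr ⟨hy, hy₂⟩, hyq⟩
    · left
      push Not at hne
      refine ⟨hα hv, fun r hr => ?_⟩
      obtain ⟨w, hw, hwr⟩ := hQ r hr
      exact hne w hw ▸ hwr
  · rintro (⟨hα, hQ⟩ | ⟨s₁, hs₁, s₂, hs₂, Q₁, Q₂, hs, rfl, ⟨D₁, hv₁, hc₁, hα₁, hD₁, hQ₁⟩, w, hvw,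
      ⟨D₂, hw₂, hc₂, hα₂, hD₂, hQ₂⟩⟩)
    · refine ⟨{v}, by simp, by simp, by simpa using hα, ?_, fun r hr => ⟨v, by simp, hQ r hr⟩⟩
      intro a ha b hb
      simp only [Finset.coe_singleton, Set.mem_singleton_iff] at ha hb
      subst ha; subst hb
      exact .refl
    · refine ⟨D₁ ∪ D₂, by simp [hv₁], (Finset.card_union_le _ _).trans (by omega), ?_, ?_, ?_⟩
      · rw [Finset.coe_union]
        exact Set.union_subset hα₁ hα₂
      · have m₁ : ∀ a ∈ D₁, a ∈ ((D₁ ∪ D₂ : Finset V) : Set V) := fun a h => by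
          simp [h]
        have m₂ : ∀ a ∈ D₂, a ∈ ((D₁ ∪ D₂ : Finset V) : Set V) := fun a h => by
          simp [h]
        refine .of_root hρ v fun x hx => ?_
        rcases Finset.mem_union.mp (Finset.mem_coe.mp hx) with h | h
        · exact reflTransGen_map id (fun a b h => ⟨h.1, m₁ a h.2.1, m₁ b h.2.2⟩) (hD₁ v hv₁ x h)
        · exact .head ⟨hvw, m₁ v hv₁, m₂ w hw₂⟩
            (reflTransGen_map id (fun a b h => ⟨h.1, m₂ a h.2.1, m₂ b h.2.2⟩) (hD₂ w hw₂ x h))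
      · intro r hr
        rcases Finset.mem_union.mp hr with h | h
        · obtain ⟨y, hy, hyr⟩ := hQ₁ r h
          exact ⟨y, by simp [hy], hyr⟩
        · obtain ⟨y, hy, hyr⟩ := hQ₂ r h
          exact ⟨y, by simp [hy], hyr⟩

/-! ### Relations whose neighbourhoods can be tabulated -/

/-- A binary relation on the vertices of each boundaried graph. -/
abbrev VRel (t : ℕ) := (A : BoundariedGraph t) → A.V → A.V → Prop

/-- The vertices that are related by `ρ` to members of `θ`. -/
def VRel.image {t : ℕ} (ρ : VRel t) (θ : VSet t) : VSet t := fun c => {v | ∃ w, ρ c.A v w ∧ w ∈ θ c}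

/-- Membership in the image of a set under `ρ` can be made available in time `O(n ^ d)`. -/
def VRel.Tabulable {t : ℕ} (d : ℕ) (ρ : VRel t) : Prop :=
  -- This is in continuation form: to decide `Ψ` it suffices to decide it with the image at hand.
  -- The continuation receives the tables `zs'` added meanwhile and a precondition `Pre'` that may
  -- reflect a case distinction.
  ∀ (m : ℕ) (zs : List (VSet t)) (Pre : Conf t → Prop) (θ : VSet t) (Ψ : Conf t → Prop),
    Loc m zs Pre θ →
    (∀ zs' Pre', (∀ c, Pre' c → Pre c) → Loc m (zs ++ zs') Pre' (ρ.image θ) →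
      Dec d m (zs ++ zs') Pre' Ψ) →
    Dec d m zs Pre Ψ

namespace VRel.Tabulable

variable {t d : ℕ}

/-- The image is everything or nothing according to whether `θ` has a member, so one emptiness test
replaces a table. This is what keeps plain domination linear. -/
theorem top (hd : 1 ≤ d) : Tabulable d (t := t) fun _ _ _ => True := by
  intro m zs Pre θ Ψ hθ h
  refine (Dec.nonempty hd hθ).ite ?_ ?_
  · have := h [] (fun c => Pre c ∧ (θ c).Nonempty) (fun c h => h.1)
    rw [List.append_nil] at this
    refine this (Loc.univ.congr fun c hc => ?_)
    ext v
    simpa [VRel.image, Set.Nonempty] using hc.2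
  · have := h [] (fun c => Pre c ∧ ¬ (θ c).Nonempty) (fun c h => h.1)
    rw [List.append_nil] at this
    refine this (Loc.empty.congr fun c hc => ?_)
    ext v
    simpa [VRel.image, Set.not_nonempty_iff_eq_empty, Set.eq_empty_iff_forall_notMem] using hc.2

theorem lab (hd : 1 ≤ d) (l l' : ℕ) :
    Tabulable d (t := t) fun A v w => A.lab v = l ∧ A.lab w = l' := by
  intro m zs Pre θ Ψ hθ h
  refine (Dec.nonempty hd (hθ.inter (Loc.lab l'))).ite ?_ ?_
  · have := h [] (fun c => Pre c ∧ (θ c ∩ {v | c.A.lab v = l'}).Nonempty) (fun c h => h.1)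
    rw [List.append_nil] at this
    refine this ((Loc.lab l).congr fun c hc => ?_)
    obtain ⟨w, hw, hl⟩ := hc.2
    ext v
    exact ⟨fun hv => ⟨w, ⟨hv, hl⟩, hw⟩, fun ⟨_, hv, _⟩ => hv.1⟩
  · have := h [] (fun c => Pre c ∧ ¬ (θ c ∩ {v | c.A.lab v = l'}).Nonempty) (fun c h => h.1)
    rw [List.append_nil] at this
    refine this (Loc.empty.congr fun c hc => ?_)
    ext v
    exact ⟨fun h => h.elim, fun ⟨w, hv, hw⟩ => (hc.2 ⟨w, hw, hv.2⟩).elim⟩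

theorem adj (hd : 2 ≤ d) : Tabulable d (t := t) fun A v w => A.graph.Adj v w := by
  intro m zs Pre θ Ψ hθ h
  refine Dec.tabulate (by omega) hθ (Dec.tabulate_nbhd hd (j := zs.length) (by simp) ?_)
  rw [List.append_assoc]
  refine h _ Pre (fun _ => id) ?_
  rw [← List.append_assoc]
  refine (Loc.slot (j := zs.length + 1) (by simp)).congr fun c hc => ?_
  simp [VRel.image]

theorem or {ρ ρ' : VRel t} (hρ : Tabulable d ρ) (hρ' : Tabulable d ρ') :
    Tabulable d fun A v w => ρ A v w ∨ ρ' A v w := by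
  intro m zs Pre θ Ψ hθ h
  refine hρ m zs Pre θ Ψ hθ fun zs₁ Pre₁ h₁ l₁ => ?_
  refine hρ' m (zs ++ zs₁) Pre₁ θ Ψ (hθ.mono h₁ fun _ _ => rfl) fun zs₂ Pre₂ h₂ l₂ => ?_
  rw [List.append_assoc] at *
  refine h _ Pre₂ (fun c hc => h₁ c (h₂ c hc)) ?_
  have l₁' := l₁.mono (zs' := zs₂) h₂ fun _ _ => rfl
  rw [List.append_assoc] at l₁'
  refine (l₁'.union l₂).congr fun c hc => ?_
  ext v
  simp only [VRel.image, Set.mem_union]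
  constructor
  · rintro (⟨w, h1, h2⟩ | ⟨w, h1, h2⟩)
    exacts [⟨w, .inl h1, h2⟩, ⟨w, .inr h1, h2⟩]
  · rintro ⟨w, h1 | h1, h2⟩
    exacts [.inl ⟨w, h1, h2⟩, .inr ⟨w, h1, h2⟩]

theorem adj_or_lab (hd : 2 ≤ d) (E : Finset (ℕ × ℕ)) :
    Tabulable d (t := t) fun A v w => A.graph.Adj v w ∨ (A.lab v, A.lab w) ∈ E := by
  classical
  induction E using Finset.induction_on with
  | empty => simpa using adj hd
  | insert a E _ ih =>
    convert ih.or (lab (by omega) a.1 a.2) using 4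
    rename_i A v w
    rw [Finset.mem_insert, Prod.ext_iff]
    tauto

theorem finset {ρ : VRel t} (hρ : Tabulable d ρ) {ι : Type} (I : Finset ι) {m : ℕ}
    {zs : List (VSet t)} {Pre : Conf t → Prop} {θ : ι → VSet t} {Ψ : Conf t → Prop}
    (hθ : ∀ i ∈ I, Loc m zs Pre (θ i))
    (h : ∀ zs' Pre', (∀ c, Pre' c → Pre c) → (∀ i ∈ I, Loc m (zs ++ zs') Pre' (ρ.image (θ i))) →
      Dec d m (zs ++ zs') Pre' Ψ) : Dec d m zs Pre Ψ := by
  classical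
  induction I using Finset.induction_on generalizing zs Pre with
  | empty => simpa using h [] Pre (fun _ => id) (by simp)
  | insert a I _ ih =>
    refine hρ m zs Pre (θ a) Ψ (hθ a (by simp)) fun zs₁ Pre₁ h₁ l₁ => ?_
    refine ih (fun i hi => (hθ i (by simp [hi])).mono h₁ fun _ _ => rfl) fun zs₂ Pre₂ h₂ l₂ => ?_
    have l₁' := l₁.mono (zs' := zs₂) h₂ fun _ _ => rfl
    rw [List.append_assoc] at *
    refine h _ Pre₂ (fun c hc => h₁ c (h₂ c hc)) fun i hi => ?_
    rcases Finset.mem_insert.mp hi with rfl | hi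
    · exact l₁'
    · exact l₂ i hi

/-- The vertices `v` with `TreeAt ρ α req s Q v`. -/
def tree {ι : Type} (ρ : VRel t) (α : VSet t) (req : ι → VSet t) (s : ℕ) (Q : Finset ι) : VSet t :=
  fun c => {v | TreeAt (ρ c.A) (α c) (fun r => req r c) s Q v}

/-- Once the sets for sizes up to `s` and their images under `ρ` have constant-time tests,
`treeAt_iff` writes those for `s + 1` as finite Boolean combinations. There are finitely many sizes
and subsets of requirements, so boundedly many images are tabulated. -/
theorem dec_tree {ρ : VRel t} (hρ : Tabulable d ρ) (hsymm : ∀ A v w, ρ A v w → ρ A w v)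
    {ι : Type} [Fintype ι] {m : ℕ} {α : VSet t} {req : ι → VSet t} {Ψ : Conf t → Prop} (s : ℕ)
    {zs : List (VSet t)} {Pre : Conf t → Prop} (hα : Loc m zs Pre α)
    (hreq : ∀ r, Loc m zs Pre (req r))
    (h : ∀ zs' Pre', (∀ c, Pre' c → Pre c) →
      (∀ s' ≤ s, ∀ Q, Loc m (zs ++ zs') Pre' (tree ρ α req s' Q)) → Dec d m (zs ++ zs') Pre' Ψ) :
    Dec d m zs Pre Ψ := by
  classical
  induction s generalizing zs Pre with
  | zero =>
    have := h [] Pre (fun _ => id)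
    rw [List.append_nil] at this
    refine this fun s' hs' Q => Loc.empty.congr fun c hc => ?_
    obtain rfl : s' = 0 := by omega
    refine (Set.eq_empty_of_forall_notMem ?_).symm
    rintro v ⟨D, hv, hD, -⟩
    have := Finset.card_pos.mpr ⟨v, hv⟩
    omega
  | succ s ih =>
    refine ih hα hreq fun zs₁ Pre₁ h₁ l₁ => ?_
    refine hρ.finset (Finset.range (s + 1) ×ˢ (Finset.univ : Finset (Finset ι)))
      (θ := fun i => tree ρ α req i.1 i.2) ?_ fun zs₂ Pre₂ h₂ l₂ => ?_
    · rintro ⟨s', Q⟩ hi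
      simp only [Finset.mem_product, Finset.mem_range] at hi
      exact l₁ s' (by omega) Q
    · have hα' := hα.mono (zs' := zs₁ ++ zs₂) (fun c hc => h₁ c (h₂ c hc)) fun _ _ => rfl
      have hreq' := fun r =>
        (hreq r).mono (zs' := zs₁ ++ zs₂) (fun c hc => h₁ c (h₂ c hc)) fun _ _ => rfl
      have l₁' := fun s' hs' Q => (l₁ s' hs' Q).mono (zs' := zs₂) h₂ fun _ _ => rfl
      rw [List.append_assoc] at *
      refine h _ Pre₂ (fun c hc => h₁ c (h₂ c hc)) fun s' hs' Q => ?_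
      rcases Nat.lt_succ_iff_lt_or_eq.mp (Nat.lt_succ_of_le hs') with hlt | rfl
      · exact l₁' s' (by omega) Q
      have base : Loc m (zs ++ (zs₁ ++ zs₂)) Pre₂ fun c => α c ∩ ⋂ r ∈ Q, req r c :=
        hα'.inter (Loc.biInter Q fun r _ => hreq' r)
      let J := ((Finset.range (s + 1) ×ˢ Finset.range (s + 1)) ×ˢ
        (Finset.univ : Finset (Finset ι × Finset ι))).filter
          fun j => j.1.1 + j.1.2 = s + 1 ∧ j.2.1 ∪ j.2.2 = Q
      have step : Loc m (zs ++ (zs₁ ++ zs₂)) Pre₂ fun c => ⋃ j ∈ J,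
          (tree ρ α req j.1.1 j.2.1 c ∩ ρ.image (tree ρ α req j.1.2 j.2.2) c) := by
        refine Loc.biUnion J (f := fun j c =>
          tree ρ α req j.1.1 j.2.1 c ∩ ρ.image (tree ρ α req j.1.2 j.2.2) c) fun j hj => ?_
        simp only [J, Finset.mem_filter, Finset.mem_product, Finset.mem_range, Finset.mem_univ,
          and_true] at hj
        exact (l₁' _ (by omega) _).inter (l₂ (j.1.2, j.2.2) (by simp; omega))
      refine (base.union step).congr fun c hc => ?_
      ext v
      refine Iff.trans ?_ (treeAt_iff (hsymm c.A)).symm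
      simp only [Set.mem_union, Set.mem_inter_iff, Set.mem_iInter, Set.mem_iUnion, J,
        Finset.mem_filter, Finset.mem_product, Finset.mem_range, Finset.mem_univ, and_true]
      refine or_congr Iff.rfl ⟨?_, ?_⟩
      · rintro ⟨j, hj, hv, hv'⟩
        exact ⟨j.1.1, by omega, j.1.2, by omega, j.2.1, j.2.2, hj.2.1, hj.2.2, hv, hv'⟩
      · rintro ⟨s₁, h₁, s₂, h₂, Q₁, Q₂, e, e', hv, hv'⟩
        exact ⟨((s₁, s₂), (Q₁, Q₂)),
          ⟨⟨Nat.lt_succ_of_le h₁, Nat.lt_succ_of_le h₂⟩, e, e'⟩, hv, hv'⟩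

theorem exists_tree {ρ : VRel t} (hd : 1 ≤ d) (hρ : Tabulable d ρ)
    (hsymm : ∀ A v w, ρ A v w → ρ A w v)
    {ι : Type} [Fintype ι] {m : ℕ} {α : VSet t} {req : ι → VSet t} (s : ℕ) (Q : Finset ι)
    {zs : List (VSet t)} {Pre : Conf t → Prop} (hα : Loc m zs Pre α)
    (hreq : ∀ r, Loc m zs Pre (req r)) :
    Dec d m zs Pre fun c => (tree ρ α req s Q c).Nonempty :=
  hρ.dec_tree hsymm s hα hreq fun _ _ _ h => Dec.nonempty hd (h s le_rfl Q)

end VRel.Tabulable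

/-! ### Domination in graphs without large complete bipartite subgraphs -/

/-- No more than `b` vertices have `h` common neighbours. -/
def BicliqueFree {V : Type} (h b : ℕ) (G : SimpleGraph V) : Prop :=
  ∀ P Q : Finset V, P.card = h → (∀ p ∈ P, ∀ q ∈ Q, G.Adj p q) → Q.card ≤ b

theorem SimpleGraph.mem_closedNbhd_comm {V : Type} {G : SimpleGraph V} {v w : V} :
    v ∈ G.closedNbhd w ↔ w ∈ G.closedNbhd v :=
  or_congr eq_comm (G.adj_comm w v)

/-- The data of a domination problem: a solution is a nonempty `ρ`-connected set of at most `k`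
vertices from `α` that dominates `τ` and meets each of the sets `req i`. -/
structure DomProblem (t : ℕ) where
  α : (A : BoundariedGraph t) → Set A.V
  τ : (A : BoundariedGraph t) → Set A.V
  r : ℕ
  req : Fin r → (A : BoundariedGraph t) → Set A.V
  ρ : VRel t
  k : ℕ

namespace DomProblem

variable {t d : ℕ} (P : DomProblem t)

/-- `D` is a solution of the problem `P` in `A`. -/
structure Sol (A : BoundariedGraph t) (D : Finset A.V) : Prop where
  nonempty : D.Nonempty
  subset : ∀ v ∈ D, v ∈ P.α A
  card_le : D.card ≤ P.k
  conn : ConnOn (P.ρ A) (D : Set A.V)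
  meets : ∀ i, ∃ w ∈ D, w ∈ P.req i A
  dominates : ∀ v ∈ P.τ A, ∃ w ∈ D, v ∈ A.graph.closedNbhd w

/-- The sets of the problem have membership test in constant time, and its relation can be
tabulated. -/
structure Effective (d : ℕ) : Prop where
  α : ∀ m zs Pre, Loc m zs Pre fun c => P.α c.A
  τ : ∀ m zs Pre, Loc m zs Pre fun c => P.τ c.A
  req : ∀ i m zs Pre, Loc m zs Pre fun c => P.req i c.A
  ρ : VRel.Tabulable d P.ρ
  symm : ∀ A v w, P.ρ A v w → P.ρ A w v

/-- There is a solution that contains the variables from `I`. -/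
def Extends (I : Finset ℕ) (c : Conf t) : Prop :=
  ∃ D, P.Sol c.A D ∧ ∀ i ∈ I, c.x i ∈ D

variable {P}

theorem extends_setX {I : Finset ℕ} {m : ℕ} (hI : ∀ i ∈ I, i < m) (c : Conf t) (v : c.A.V) :
    P.Extends I (c.setX m v) ↔ P.Extends I c := by
  refine exists_congr fun D => and_congr_right fun _ => forall₂_congr fun i hi => ?_
  rw [Conf.setX_x_of_ne _ _ (hI i hi).ne]
  rfl

theorem extends_insert_setX {I : Finset ℕ} {m : ℕ} (hI : ∀ i ∈ I, i < m) (c : Conf t)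
    (v : c.A.V) :
    P.Extends (insert m I) (c.setX m v) ↔ ∃ D, P.Sol c.A D ∧ v ∈ D ∧ ∀ i ∈ I, c.x i ∈ D := by
  refine exists_congr fun D => and_congr_right fun _ => ?_
  rw [Finset.forall_mem_insert, Conf.setX_x_self]
  refine and_congr Iff.rfl (forall₂_congr fun i hi => ?_)
  rw [Conf.setX_x_of_ne _ _ (hI i hi).ne]
  rfl

/-- If all but boundedly many vertices are dominated already, then the search for a solution is the
search for a connected set with bounded requirements. -/
theorem Effective.dec_of_few (hP : P.Effective d) (hd : 1 ≤ d) {m : ℕ} {I J : Finset ℕ}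
    (hI : ∀ i ∈ I, i < m) (hJ : ∀ j ∈ J, j < m) :
    Dec d m [] (fun c => (∀ v ∈ P.τ c.A, (∃ i ∈ I, v ∈ c.A.graph.closedNbhd (c.x i)) ∨
      ∃ j ∈ J, v = c.x j) ∧ ∀ j ∈ J, c.x j ∈ P.τ c.A) (P.Extends I) := by
  -- Besides the requirements of `P`, the set must contain each chosen vertex and meet the closed
  -- neighbourhood of each vertex from `J`.
  let req : Fin P.r ⊕ I ⊕ J → VSet t := Sum.elim (fun i c => P.req i c.A)
    (Sum.elim (fun i c => {c.x i}) fun j c => c.A.graph.closedNbhd (c.x j))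
  refine (hP.ρ.exists_tree hd hP.symm (α := fun c => P.α c.A) (req := req) P.k Finset.univ
    (hP.α _ _ _) ?_).mono (fun _ => id) ?_
  · rintro (i | i | j)
    · exact hP.req i _ _ _
    · exact Loc.singleton (hI i i.2)
    · exact Loc.closedNbhd (hJ j j.2)
  · rintro c ⟨h1, h2⟩
    constructor
    · rintro ⟨v, D, hv, hk, hα, hconn, hreq⟩
      have hx : ∀ i ∈ I, c.x i ∈ D := by
        intro i hi
        obtain ⟨w, hw, hw'⟩ := hreq (.inr (.inl ⟨i, hi⟩)) (Finset.mem_univ _)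
        have : w = c.x i := hw'
        exact this ▸ hw
      refine ⟨D, ⟨⟨v, hv⟩, hα, hk, hconn, fun i => hreq (.inl i) (Finset.mem_univ _), ?_⟩, hx⟩
      intro u hu
      rcases h1 u hu with ⟨i, hi, hu'⟩ | ⟨j, hj, rfl⟩
      · exact ⟨_, hx i hi, hu'⟩
      · obtain ⟨w, hw, hw'⟩ := hreq (.inr (.inr ⟨j, hj⟩)) (Finset.mem_univ _)
        exact ⟨w, hw, SimpleGraph.mem_closedNbhd_comm.mp hw'⟩
    · rintro ⟨D, hD, hx⟩
      obtain ⟨v, hv⟩ := hD.nonempty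
      refine ⟨v, D, hv, hD.card_le, hD.subset, hD.conn, ?_⟩
      rintro (i | i | j) -
      · exact hD.meets i
      · exact ⟨_, hx i i.2, rfl⟩
      · obtain ⟨w, hw, hw'⟩ := hD.dominates _ (h2 j j.2)
        exact ⟨w, hw, SimpleGraph.mem_closedNbhd_comm.mp hw'⟩

end DomProblem

/-- Among `h + 1` closed neighbourhoods that contain `v`, at most one is centred at `v` itself. So
`v` is a common neighbour of `h` distinct vertices from `J`, and every choice of these `h` admits at
most `b` such `v`. -/
theorem ncard_common_le {V : Type} [Finite V] {h b : ℕ} {G : SimpleGraph V}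
    (hG : BicliqueFree h b G) {J : Finset ℕ} {x : ℕ → V} (hx : Set.InjOn x J) {S : Set V}
    (hS : ∀ v ∈ S, ∃ J' ∈ J.powersetCard (h + 1), ∀ j ∈ J', v ∈ G.closedNbhd (x j)) :
    S.ncard ≤ (J.powersetCard h).card * b := by
  classical
  have := Fintype.ofFinite V
  let T : Finset V := (J.powersetCard h).biUnion fun J' =>
    Finset.univ.filter fun v => ∀ j ∈ J', G.Adj (x j) v
  have hST : S ⊆ T := by
    intro v hv
    obtain ⟨J', hJ', hv'⟩ := hS v hv
    obtain ⟨hsub, hcard⟩ := Finset.mem_powersetCard.mp hJ'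
    have hne : h ≤ (J'.filter fun j => ¬ v = x j).card := by
      have h1 : (J'.filter fun j => v = x j).card ≤ 1 := by
        refine Finset.card_le_one.mpr fun i hi j hj => ?_
        rw [Finset.mem_filter] at hi hj
        exact hx (hsub hi.1) (hsub hj.1) (hi.2.symm.trans hj.2)
      have h2 := Finset.card_filter_add_card_filter_not (s := J') (fun j => v = x j)
      omega
    obtain ⟨J'', hJ'', hc⟩ := Finset.exists_subset_card_eq hne
    simp only [T, Finset.coe_biUnion, Set.mem_iUnion]
    refine ⟨J'', Finset.mem_coe.mpr (Finset.mem_powersetCard.mpr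
      ⟨fun j hj => hsub (Finset.mem_filter.mp (hJ'' hj)).1, hc⟩), ?_⟩
    simp only [Finset.coe_filter, Finset.mem_univ, true_and]
    intro j hj
    have hj' := Finset.mem_filter.mp (hJ'' hj)
    exact (hv' j hj'.1).resolve_left hj'.2
  refine (Set.ncard_le_ncard hST (Set.toFinite _)).trans ?_
  rw [Set.ncard_coe_finset]
  refine Finset.card_biUnion_le_card_mul _ _ _ fun J' hJ' => ?_
  obtain ⟨hsub, hcard⟩ := Finset.mem_powersetCard.mp hJ'
  refine hG (J'.image x) _ ?_ ?_
  · rw [Finset.card_image_of_injOn (hx.mono hsub), hcard]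
  · intro p hp q hq
    obtain ⟨j, hj, rfl⟩ := Finset.mem_image.mp hp
    exact (Finset.mem_filter.mp hq).2 j hj

/-! ### The bounded search tree -/

namespace DomProblem

variable {t d : ℕ} {P : DomProblem t}

/-- The variables from `I` are distinct, those from `J` are distinct and belong to `τ`, but are not
dominated by the variables from `I`. -/
structure Undominated (P : DomProblem t) (I J : Finset ℕ) (c : Conf t) : Prop where
  injI : Set.InjOn c.x I
  injJ : Set.InjOn c.x J
  mem : ∀ j ∈ J, c.x j ∈ P.τ c.A
  notMem : ∀ j ∈ J, ∀ i ∈ I, c.x j ∉ c.A.graph.closedNbhd (c.x i)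

theorem Undominated.insert {I J : Finset ℕ} {c : Conf t} (hc : P.Undominated I J c) {m : ℕ}
    (hI : ∀ i ∈ I, i < m) (hJ : ∀ j ∈ J, j < m) {v : c.A.V} (hv : v ∈ P.τ c.A)
    (hvI : ∀ i ∈ I, v ∉ c.A.graph.closedNbhd (c.x i)) (hvJ : ∀ j ∈ J, v ≠ c.x j) :
    P.Undominated I (insert m J) (c.setX m v) := by
  have eI : ∀ i ∈ I, (c.setX m v).x i = c.x i := fun i hi => Conf.setX_x_of_ne _ _ (hI i hi).ne
  have eJ : ∀ i ∈ J, (c.setX m v).x i = c.x i := fun i hi => Conf.setX_x_of_ne _ _ (hJ i hi).ne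
  have em : (c.setX m v).x m = v := Conf.setX_x_self _ _ _
  refine ⟨?_, ?_, ?_, ?_⟩
  · intro i hi j hj h
    rw [eI i hi, eI j hj] at h
    exact hc.injI hi hj h
  · intro i hi j hj h
    rcases Finset.mem_insert.mp hi with hi' | hi' <;>
      rcases Finset.mem_insert.mp hj with hj' | hj'
    · rw [hi', hj']
    · rw [hi', em, eJ j hj'] at h
      exact absurd h (hvJ j hj')
    · rw [hj', em, eJ i hi'] at h
      exact absurd h.symm (hvJ i hi')
    · rw [eJ i hi', eJ j hj'] at h
      exact hc.injJ hi' hj' h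
  · intro j hj
    rcases Finset.mem_insert.mp hj with rfl | hj
    · rw [em]; exact hv
    · rw [eJ j hj]; exact hc.mem j hj
  · intro j hj i hi
    rw [eI i hi]
    rcases Finset.mem_insert.mp hj with rfl | hj
    · rw [em]; exact hvI i hi
    · rw [eJ j hj]; exact hc.notMem j hj i hi

/-- Some member of a solution dominates many members of a large undominated set. -/
theorem Undominated.exists_candidate {I J : Finset ℕ} {c : Conf t} (hc : P.Undominated I J c)
    {h : ℕ} (hJ : J.card = P.k * h + 1) {D : Finset c.A.V} (hD : P.Sol c.A D) :
    ∃ v ∈ D, ∃ J' ∈ J.powersetCard (h + 1), ∀ j ∈ J', v ∈ c.A.graph.closedNbhd (c.x j) := by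
  classical
  have hw : ∀ j ∈ J, ∃ v ∈ D, v ∈ c.A.graph.closedNbhd (c.x j) := fun j hj => by
    obtain ⟨w, hw, hw'⟩ := hD.dominates _ (hc.mem j hj)
    exact ⟨w, hw, SimpleGraph.mem_closedNbhd_comm.mp hw'⟩
  have : Nonempty c.A.V := ⟨c.x 0⟩
  choose! f hf hf' using hw
  -- Pigeonhole: `k * h + 1` vertices have at most `k` dominators, so some dominator serves more
  -- than `h` of them.
  obtain ⟨v, hv, hlt⟩ := Finset.exists_lt_card_fiber_of_mul_lt_card_of_maps_to
    (s := J) (t := D) (n := h) hf (by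
    have := Nat.mul_le_mul_right h hD.card_le
    omega)
  obtain ⟨J', hJ', hcard⟩ := Finset.exists_subset_card_eq (Nat.succ_le_of_lt hlt)
  refine ⟨v, hv, J', Finset.mem_powersetCard.mpr
    ⟨fun j hj => (Finset.mem_filter.mp (hJ' hj)).1, hcard⟩, fun j hj => ?_⟩
  obtain ⟨hj', rfl⟩ := Finset.mem_filter.mp (hJ' hj)
  exact hf' j hj'

/-- A candidate dominates something that the chosen vertices do not. So every branching adds a new
vertex, and the depth of the search is at most `k`. -/
theorem Undominated.ne_of_candidate {I J J' : Finset ℕ} {c : Conf t} (hc : P.Undominated I J c)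
    {h : ℕ} {v : c.A.V} (hJ' : J' ∈ J.powersetCard (h + 1))
    (hv : ∀ j ∈ J', v ∈ c.A.graph.closedNbhd (c.x j)) {i : ℕ} (hi : i ∈ I) : v ≠ c.x i := by
  rintro rfl
  obtain ⟨hsub, hcard⟩ := Finset.mem_powersetCard.mp hJ'
  obtain ⟨j, hj⟩ := Finset.card_pos.mp (show 0 < J'.card by omega)
  exact hc.notMem j (hsub hj) i hi (SimpleGraph.mem_closedNbhd_comm.mp (hv j hj))

/-- Collect undominated vertices until there are many of them or no more are left. -/
theorem Effective.dec_of_many (hP : P.Effective d) (hd : 1 ≤ d) {h b : ℕ} {I : Finset ℕ}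
    (step : ∀ {m : ℕ} {J : Finset ℕ}, (∀ i ∈ I, i < m) → (∀ j ∈ J, j < m) →
      J.card = P.k * h + 1 →
      Dec d m [] (fun c => BicliqueFree h b c.A.graph ∧ P.Undominated I J c) (P.Extends I))
    (r : ℕ) {m : ℕ} {J : Finset ℕ} (hI : ∀ i ∈ I, i < m) (hJ : ∀ j ∈ J, j < m)
    (hr : J.card + r = P.k * h + 1) :
    Dec d m [] (fun c => BicliqueFree h b c.A.graph ∧ P.Undominated I J c) (P.Extends I) := by
  induction r generalizing m J with
  | zero => exact step hI hJ hr
  | succ r ih =>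
    have hmJ : m ∉ J := fun hm => (hJ m hm).false
    have hθ : Loc m [] (fun c => BicliqueFree h b c.A.graph ∧ P.Undominated I J c) fun c =>
        P.τ c.A ∩ ((⋂ i ∈ I, (c.A.graph.closedNbhd (c.x i))ᶜ) ∩ ⋂ j ∈ J, {c.x j}ᶜ) :=
      (hP.τ _ _ _).inter ((Loc.biInter I (f := fun i c => (c.A.graph.closedNbhd (c.x i))ᶜ)
        fun i hi => (Loc.closedNbhd (hI i hi)).compl).inter
          (Loc.biInter J (f := fun j c => {c.x j}ᶜ) fun j hj => (Loc.singleton (hJ j hj)).compl))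
    -- Any undominated vertex will do: `P.Extends I` does not depend on the new variable, so no
    -- branching is needed here.
    refine Dec.find hd hθ (ih (m := m + 1) (J := insert m J)
      (fun i hi => (hI i hi).trans m.lt_succ_self) ?_ ?_) ?_ ?_
    · intro j hj
      rcases Finset.mem_insert.mp hj with rfl | hj
      · exact Nat.lt_succ_self _
      · exact (hJ j hj).trans (Nat.lt_succ_self _)
    · rw [Finset.card_insert_of_notMem hmJ]; omega
    · rintro c v ⟨hG, hc⟩ ⟨hv, hvI, hvJ⟩
      rw [Set.mem_iInter₂] at hvI hvJ
      exact ⟨⟨hG, hc.insert hI hJ hv hvI hvJ⟩, extends_setX hI c v⟩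
    -- If the collection gets stuck, `J` contains all of `τ` that is not yet dominated.
    · refine (hP.dec_of_few hd hI hJ).mono ?_ fun _ _ => Iff.rfl
      rintro c ⟨⟨hG, hc⟩, he⟩
      refine ⟨fun v hv => ?_, hc.mem⟩
      by_contra hcon
      push Not at hcon
      have : v ∈ P.τ c.A ∩ ((⋂ i ∈ I, (c.A.graph.closedNbhd (c.x i))ᶜ) ∩ ⋂ j ∈ J, {c.x j}ᶜ) :=
        ⟨hv, Set.mem_iInter₂.mpr hcon.1, Set.mem_iInter₂.mpr hcon.2⟩
      rw [he] at this
      exact this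

/-- The search for a solution among graphs without large complete bipartite subgraphs. -/
theorem Effective.dec_extends (hP : P.Effective d) (hd : 1 ≤ d) (h b f : ℕ) :
    ∀ {m : ℕ} {I : Finset ℕ}, (∀ i ∈ I, i < m) → I.card + f = P.k →
      Dec d m [] (fun c => BicliqueFree h b c.A.graph ∧ Set.InjOn c.x I) (P.Extends I) := by
  induction f with
  | zero =>
    intro m I hI hk
    refine (hP.dec_of_many hd (h := h) (b := b) (J := ∅) (m := m) ?_ (P.k * h + 1) hI (by simp)
      (by simp)).mono ?_ fun _ _ => Iff.rfl
    · intro m J hI hJ hJk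
      -- The budget is used up by `I`, yet a solution would contain a candidate outside `I` as well.
      refine (Dec.const False).mono (fun _ => id) fun c hc => ?_
      simp only [false_iff]
      rintro ⟨D, hD, hx⟩
      obtain ⟨v, hv, J', hJ', hv'⟩ := hc.2.exists_candidate hJk hD
      classical
      have hsub : I.image c.x ⊂ D := by
        refine Finset.ssubset_iff_subset_ne.mpr ⟨Finset.image_subset_iff.mpr hx, ?_⟩
        rintro rfl
        obtain ⟨i, hi, rfl⟩ := Finset.mem_image.mp hv
        exact hc.2.ne_of_candidate hJ' hv' hi rfl
      have := Finset.card_lt_card hsub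
      rw [Finset.card_image_of_injOn hc.2.injI] at this
      have := hD.card_le
      omega
    · rintro c ⟨hG, hc⟩
      exact ⟨hG, hc, by simp, by simp, by simp⟩
  | succ f ih =>
    intro m I hI hk
    refine (hP.dec_of_many hd (h := h) (b := b) (J := ∅) (m := m) ?_ (P.k * h + 1) hI (by simp)
      (by simp)).mono ?_ fun _ _ => Iff.rfl
    · intro m J hI hJ hJk
      have hmI : m ∉ I := fun hm => (hI m hm).false
      have hθ : Loc m [] (fun c => BicliqueFree h b c.A.graph ∧ P.Undominated I J c) fun c =>
          ⋃ J' ∈ J.powersetCard (h + 1), ⋂ j ∈ J', c.A.graph.closedNbhd (c.x j) := by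
        refine Loc.biUnion _ (f := fun J' c => ⋂ j ∈ J', c.A.graph.closedNbhd (c.x j))
          fun J' hJ' => Loc.biInter J' (f := fun j c => c.A.graph.closedNbhd (c.x j)) fun j hj =>
            Loc.closedNbhd (hJ j ((Finset.mem_powersetCard.mp hJ').1 hj))
      have hmem : ∀ (c : Conf t) v, (v ∈ ⋃ J' ∈ J.powersetCard (h + 1), ⋂ j ∈ J',
          c.A.graph.closedNbhd (c.x j)) ↔
          ∃ J' ∈ J.powersetCard (h + 1), ∀ j ∈ J', v ∈ c.A.graph.closedNbhd (c.x j) := by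
        intro c v
        simp only [Set.mem_iUnion, Set.mem_iInter, exists_prop]
      -- Every solution contains a candidate, and `ncard_common_le` bounds the number of candidates
      -- and thereby that of failing branches.
      refine (Dec.exists_of_bounded hd ((J.powersetCard h).card * b) hθ (ih (m := m + 1)
        (I := insert m I) ?_ ?_) ?_ ?_).mono (fun _ => id) ?_
      · intro j hj
        rcases Finset.mem_insert.mp hj with rfl | hj
        · exact Nat.lt_succ_self _
        · exact (hI j hj).trans (Nat.lt_succ_self _)
      · rw [Finset.card_insert_of_notMem hmI]; omega
      · rintro c v ⟨hG, hc⟩ hv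
        obtain ⟨J', hJ', hv'⟩ := (hmem c v).mp hv
        refine ⟨hG, ?_⟩
        have hne : ∀ i ∈ I, v ≠ c.x i := fun i hi => hc.ne_of_candidate hJ' hv' hi
        have eI : ∀ i ∈ I, (c.setX m v).x i = c.x i :=
          fun i hi => Conf.setX_x_of_ne _ _ (hI i hi).ne
        have em : (c.setX m v).x m = v := Conf.setX_x_self _ _ _
        intro i hi j hj h
        rcases Finset.mem_insert.mp hi with hi' | hi' <;>
          rcases Finset.mem_insert.mp hj with hj' | hj'
        · rw [hi', hj']
        · rw [hi', em, eI j hj'] at h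
          exact absurd h (hne j hj')
        · rw [hj', em, eI i hi'] at h
          exact absurd h.symm (hne i hi')
        · rw [eI i hi', eI j hj'] at h
          exact hc.injI hi' hj' h
      · rintro c ⟨hG, hc⟩
        have : Finite c.A.V := c.A.finite
        exact ncard_common_le hG hc.injJ fun v hv => (hmem c v).mp hv.1
      · rintro c ⟨hG, hc⟩
        constructor
        · rintro ⟨v, -, hv⟩
          obtain ⟨D, hD, -, hx⟩ := (extends_insert_setX hI c v).mp hv
          exact ⟨D, hD, hx⟩
        · rintro ⟨D, hD, hx⟩
          obtain ⟨v, hv, hv'⟩ := hc.exists_candidate hJk hD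
          exact ⟨v, (hmem c v).mpr hv', (extends_insert_setX hI c v).mpr ⟨D, hD, hv, hx⟩⟩
    · rintro c ⟨hG, hc⟩
      exact ⟨hG, hc, by simp, by simp, by simp⟩

/-- Solvability is decidable in time `O(n ^ d)`. -/
theorem Effective.dec_exists (hP : P.Effective d) (hd : 1 ≤ d) (h b : ℕ)
    {Pre : Conf t → Prop} (hPre : ∀ c, Pre c → BicliqueFree h b c.A.graph) :
    Dec d 0 [] Pre fun c => ∃ D, P.Sol c.A D := by
  refine (hP.dec_extends hd h b P.k (m := 0) (I := ∅) (by simp) (by simp)).mono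
    (fun c hc => ⟨hPre c hc, by simp⟩) fun c _ => ?_
  simp [Extends]

end DomProblem

namespace BoundariedGraph

variable {t : ℕ} {A B F : BoundariedGraph t}

/-! ### The vertices and edges of a glued graph -/

theorem lab_le (v : A.V) : A.lab v ≤ t := by
  unfold lab
  split_ifs
  · exact (A.label _).2
  · omega

theorem lab_ne_zero {v : A.V} : A.lab v ≠ 0 ↔ v ∈ A.boundary := by
  unfold lab
  split_ifs with h <;> simp [h]

theorem lab_eq_iff {a : A.V} {f : F.V} (ha : a ∈ A.boundary) (hf : f ∈ F.boundary) :
    A.lab a = F.lab f ↔ A.label ⟨a, ha⟩ = F.label ⟨f, hf⟩ := by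
  simp [lab, ha, hf, Fin.ext_iff]

theorem lab_injOn {v w : A.V} (h : A.lab v = A.lab w) (h0 : A.lab v ≠ 0) : v = w := by
  have hv := lab_ne_zero.mp h0
  have hw := lab_ne_zero.mp (h ▸ h0)
  exact congrArg Subtype.val (A.label_injective ((lab_eq_iff hv hw).mp h))

/-- The vertex of `A ⊕ F` that a vertex of `A` becomes. -/
def inL (A F : BoundariedGraph t) (a : A.V) : GlueVertex A F := toGlue A F (.inl a)

/-- The vertex of `A ⊕ F` that a vertex of `F` becomes. -/
def inR (A F : BoundariedGraph t) (f : F.V) : GlueVertex A F := toGlue A F (.inr f)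

theorem toGlue_eq_iff {x y : A.V ⊕ F.V} : toGlue A F x = toGlue A F y ↔ glueRel A F x y :=
  @Quotient.eq _ (Setoid.mk (glueRel A F) (glueRel_equivalence A F)) x y

theorem inL_injective : Function.Injective (inL A F) := fun _ _ h => toGlue_eq_iff.mp h

theorem inR_injective : Function.Injective (inR A F) := fun _ _ h => toGlue_eq_iff.mp h

theorem inL_eq_inR {a : A.V} {f : F.V} : inL A F a = inR A F f ↔ A.lab a = F.lab f ∧ A.lab a ≠ 0 := by
  refine toGlue_eq_iff.trans ⟨?_, ?_⟩
  · rintro ⟨ha, hf, h⟩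
    exact ⟨(lab_eq_iff ha hf).mpr h, lab_ne_zero.mpr ha⟩
  · rintro ⟨h, h0⟩
    have ha := lab_ne_zero.mp h0
    have hf := lab_ne_zero.mp (h ▸ h0)
    exact ⟨ha, hf, (lab_eq_iff ha hf).mp h⟩

theorem glueVertex_cases (p : GlueVertex A F) : (∃ a, p = inL A F a) ∨ ∃ f, p = inR A F f := by
  induction p using Quotient.inductionOn with
  | _ x =>
    rcases x with a | f
    · exact .inl ⟨a, rfl⟩
    · exact .inr ⟨f, rfl⟩

theorem glue_adj {p q : GlueVertex A F} : (A.glue F).Adj p q ↔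
    (∃ u v, A.graph.Adj u v ∧ p = inL A F u ∧ q = inL A F v) ∨
      ∃ u v, F.graph.Adj u v ∧ p = inR A F u ∧ q = inR A F v := by
  unfold glue
  rw [SimpleGraph.fromRel_adj]
  constructor
  · rintro ⟨-, h | (⟨u, v, h, h1, h2⟩ | ⟨u, v, h, h1, h2⟩)⟩
    · exact h
    · exact .inl ⟨v, u, h.symm, h2, h1⟩
    · exact .inr ⟨v, u, h.symm, h2, h1⟩
  · intro h
    refine ⟨?_, .inl h⟩
    rintro rfl
    rcases h with ⟨u, v, h, h1, h2⟩ | ⟨u, v, h, h1, h2⟩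
    · exact h.ne (inL_injective (h1.symm.trans h2))
    · exact h.ne (inR_injective (h1.symm.trans h2))

theorem glue_adj_inL {u v : A.V} (h : A.graph.Adj u v) :
    (A.glue F).Adj (inL A F u) (inL A F v) := glue_adj.mpr (.inl ⟨u, v, h, rfl, rfl⟩)

theorem glue_adj_inR {u v : F.V} (h : F.graph.Adj u v) :
    (A.glue F).Adj (inR A F u) (inR A F v) := glue_adj.mpr (.inr ⟨u, v, h, rfl, rfl⟩)

theorem mem_closedNbhd_inL {u v : A.V} (h : v ∈ A.graph.closedNbhd u) :
    inL A F v ∈ (A.glue F).closedNbhd (inL A F u) :=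
  h.imp (congrArg _) glue_adj_inL

theorem mem_closedNbhd_inR {u v : F.V} (h : v ∈ F.graph.closedNbhd u) :
    inR A F v ∈ (A.glue F).closedNbhd (inR A F u) :=
  h.imp (congrArg _) glue_adj_inR

theorem mem_closedNbhd_glue {p q : GlueVertex A F} (h : q ∈ (A.glue F).closedNbhd p) :
    (∃ u v, v ∈ A.graph.closedNbhd u ∧ p = inL A F u ∧ q = inL A F v) ∨
      ∃ u v, v ∈ F.graph.closedNbhd u ∧ p = inR A F u ∧ q = inR A F v := by
  rcases h with rfl | h
  · rcases glueVertex_cases q with ⟨a, rfl⟩ | ⟨f, rfl⟩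
    · exact .inl ⟨a, a, .inl rfl, rfl, rfl⟩
    · exact .inr ⟨f, f, .inl rfl, rfl, rfl⟩
  · rcases glue_adj.mp h with ⟨u, v, h, h1, h2⟩ | ⟨u, v, h, h1, h2⟩
    · exact .inl ⟨u, v, .inr h, h1, h2⟩
    · exact .inr ⟨u, v, .inr h, h1, h2⟩

theorem isDominatingSet_iff {V : Type} {G : SimpleGraph V} {D : Set V} :
    IsDominatingSet G D ↔ ∀ v, ∃ u ∈ D, v ∈ G.closedNbhd u := by
  refine forall_congr' fun v => ⟨?_, ?_⟩
  · rintro (h | ⟨u, hu, h⟩)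
    · exact ⟨v, h, .inl rfl⟩
    · exact ⟨u, hu, .inr h⟩
  · rintro ⟨u, hu, rfl | h⟩
    · exact .inl hu
    · exact .inr ⟨u, hu, h⟩

/-! ### Exchanging one side of a dominating set of a glued graph -/

/-- The same labels occur in `A` and in `B`. -/
def SameLabels (A B : BoundariedGraph t) : Prop :=
  ∀ l ≠ 0, (∃ a, A.lab a = l) ↔ ∃ b, B.lab b = l

/-- `D'` arises from the subset `D` of `A ⊕ F`, which contains the vertices `DA` of `A`, when these
are exchanged for the vertices `DB` of `B`. -/
structure Exchange (D : Finset (GlueVertex A F)) (DA : Finset A.V) (DB : Finset B.V)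
    (D' : Finset (GlueVertex B F)) : Prop where
  card_le : D'.card + DA.card ≤ DB.card + D.card
  inL_mem : ∀ b, inL B F b ∈ D' ↔ b ∈ DB
  inR_mem : ∀ f, inR A F f ∈ D → inR B F f ∈ D'
  cases : ∀ p ∈ D', (∃ b ∈ DB, p = inL B F b) ∨ ∃ f, inR A F f ∈ D ∧ p = inR B F f
  dominates : IsDominatingSet (B.glue F) (D' : Set (GlueVertex B F))

/-- Take `DB` together with the vertices of `D` from `F` that are not glued to `A`; the glued ones
belong to `DA`, and `hS` restores their labels. A vertex of `F` that was dominated from `A` is a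
boundary vertex whose label also occurs in `B` by `hL`, so `hDB` takes care of it. -/
theorem exists_exchange (hL : SameLabels A B) {D : Finset (GlueVertex A F)} {DA : Finset A.V}
    (hDA : ∀ a, a ∈ DA ↔ inL A F a ∈ D) {DB : Finset B.V}
    (hD : IsDominatingSet (A.glue F) (D : Set (GlueVertex A F)))
    (hS : ∀ a ∈ DA, A.lab a ≠ 0 → ∃ b ∈ DB, B.lab b = A.lab a)
    (hDB : ∀ b, (∃ w ∈ DB, b ∈ B.graph.closedNbhd w) ∨ (B.lab b ≠ 0 ∧
      ∃ f f', F.lab f = B.lab b ∧ inR A F f' ∈ D ∧ f ∈ F.graph.closedNbhd f')) :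
    ∃ D', Exchange D DA DB D' := by
  classical
  let DF := (D.preimage (inR A F) inR_injective.injOn).filter fun f =>
    ∀ a, A.lab a = F.lab f → A.lab a = 0
  have hDF : ∀ f, f ∈ DF ↔ inR A F f ∈ D ∧ ∀ a, A.lab a = F.lab f → A.lab a = 0 := by
    intro f; simp [DF]
  let D' := DB.image (inL B F) ∪ DF.image (inR B F)
  have hR : ∀ f, inR A F f ∈ D → inR B F f ∈ D' := by
    intro f hf
    by_cases h : ∀ a, A.lab a = F.lab f → A.lab a = 0
    · exact Finset.mem_union_right _ (Finset.mem_image_of_mem _ ((hDF f).mpr ⟨hf, h⟩))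
    · push Not at h
      obtain ⟨a, ha, ha0⟩ := h
      have haD : a ∈ DA := (hDA a).mpr (by rwa [inL_eq_inR.mpr ⟨ha, ha0⟩])
      obtain ⟨b, hb, hba⟩ := hS a haD ha0
      refine Finset.mem_union_left _ (Finset.mem_image.mpr ⟨b, hb, ?_⟩)
      exact inL_eq_inR.mpr ⟨hba.trans ha, hba ▸ ha0⟩
  have hL' : ∀ b ∈ DB, inL B F b ∈ D' := fun b hb =>
    Finset.mem_union_left _ (Finset.mem_image_of_mem _ hb)
  refine ⟨D', ?_, ?_, hR, ?_, ?_⟩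
  · have h1 : D'.card ≤ DB.card + DF.card :=
      (Finset.card_union_le _ _).trans (add_le_add Finset.card_image_le Finset.card_image_le)
    have h2 : DA.card + DF.card ≤ D.card := by
      rw [← Finset.card_image_of_injective DA (inL_injective (F := F)),
        ← Finset.card_image_of_injective DF (inR_injective (A := A)), ← Finset.card_union_of_disjoint]
      · refine Finset.card_le_card (Finset.union_subset ?_ ?_)
        · intro p hp
          obtain ⟨a, ha, rfl⟩ := Finset.mem_image.mp hp
          exact (hDA a).mp ha
        · intro p hp
          obtain ⟨f, hf, rfl⟩ := Finset.mem_image.mp hp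
          exact ((hDF f).mp hf).1
      -- No vertex of `DF` is glued to `A`, so `DA` and `DF` are counted separately in `D`.
      · rw [Finset.disjoint_left]
        rintro p hp hp'
        obtain ⟨a, ha, rfl⟩ := Finset.mem_image.mp hp
        obtain ⟨f, hf, hfa⟩ := Finset.mem_image.mp hp'
        obtain ⟨e1, e2⟩ := inL_eq_inR.mp hfa.symm
        exact e2 (((hDF f).mp hf).2 a e1)
    omega
  · refine fun b => ⟨fun h => ?_, hL' b⟩
    rcases Finset.mem_union.mp h with h | h
    · obtain ⟨b', hb', e⟩ := Finset.mem_image.mp h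
      exact inL_injective e ▸ hb'
    · obtain ⟨f, hf, e⟩ := Finset.mem_image.mp h
      obtain ⟨e1, e2⟩ := inL_eq_inR.mp e.symm
      obtain ⟨a, ha⟩ := (hL _ e2).mpr ⟨b, rfl⟩
      exact absurd (((hDF f).mp hf).2 a (ha.trans e1)) (ha ▸ e2)
  · intro p hp
    rcases Finset.mem_union.mp hp with h | h
    · obtain ⟨b', hb', e⟩ := Finset.mem_image.mp h
      exact .inl ⟨b', hb', e.symm⟩
    · obtain ⟨f, hf, e⟩ := Finset.mem_image.mp h
      exact .inr ⟨f, ((hDF f).mp hf).1, e.symm⟩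
  · rw [isDominatingSet_iff] at hD ⊢
    have hb : ∀ b, ∃ u ∈ (D' : Set (GlueVertex B F)), inL B F b ∈ (B.glue F).closedNbhd u := by
      intro b
      rcases hDB b with ⟨w, hw, h⟩ | ⟨h0, f, f', hf, hf', h⟩
      · exact ⟨_, hL' w hw, mem_closedNbhd_inL h⟩
      · refine ⟨_, hR f' hf', ?_⟩
        rw [inL_eq_inR.mpr ⟨hf.symm, h0⟩]
        exact mem_closedNbhd_inR h
    intro p
    rcases glueVertex_cases p with ⟨b, rfl⟩ | ⟨f, rfl⟩
    · exact hb b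
    · obtain ⟨u, hu, h⟩ := hD (inR A F f)
      rcases mem_closedNbhd_glue h with ⟨a', a, h, rfl, e⟩ | ⟨f', f'', h, rfl, e⟩
      · obtain ⟨e1, e2⟩ := inL_eq_inR.mp e.symm
        obtain ⟨b, hb'⟩ := (hL _ e2).mp ⟨a, rfl⟩
        have := hb b
        rwa [inL_eq_inR.mpr ⟨hb'.trans e1, hb' ▸ e2⟩] at this
      · obtain rfl := inR_injective e
        exact ⟨_, hR f' hu, mem_closedNbhd_inR h⟩

/-! ### The domination problems that determine the equivalence class -/

/-- Find a `ρ`-connected set of at most `k` vertices that contains the boundary vertices with a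
label from `S` and no others, and dominates all vertices but those with a label from `T`. -/
def partialDomination (ρ : VRel t) (S T : Finset ℕ) (k : ℕ) : DomProblem t where
  α A := {v | A.lab v = 0 ∨ A.lab v ∈ S}
  τ A := {v | A.lab v ∉ T}
  r := t
  -- Nonzero encoded labels start at 1, hence the shift. For a label outside `S` the requirement is
  -- void.
  req i A := {v | (i : ℕ) + 1 ∈ S → A.lab v = i + 1}
  ρ := ρ
  k := k

theorem partialDomination_effective {d : ℕ} {ρ : VRel t} (hρ : VRel.Tabulable d ρ)
    (hsymm : ∀ A v w, ρ A v w → ρ A w v) (S T : Finset ℕ) (k : ℕ) :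
    (partialDomination ρ S T k).Effective d where
  α m zs Pre := by
    refine ((Loc.lab 0).union (Loc.biUnion S (f := fun l c => {v | c.A.lab v = l})
      fun l _ => Loc.lab l)).congr fun c _ => ?_
    ext v
    simp [partialDomination]
  τ m zs Pre := by
    refine (Loc.biUnion T (f := fun l c => {v | c.A.lab v = l})
      fun l _ => Loc.lab l).compl.congr fun c _ => ?_
    ext v
    simp [partialDomination]
  req i m zs Pre := by
    by_cases h : (i : ℕ) + 1 ∈ S
    · exact (Loc.lab ((i : ℕ) + 1)).congr fun c _ => by simp [partialDomination, h]
    · exact Loc.univ.congr fun c _ => by simp [partialDomination, h]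
  ρ := hρ
  symm := hsymm

/-- What is solvable in `A` with at most `2 * t` vertices is solvable in `B`. -/
def Transfers (ρ : VRel t) (A B : BoundariedGraph t) : Prop :=
  ∀ S ⊆ Finset.range (t + 1), ∀ T ⊆ Finset.range (t + 1), ∀ k ≤ 2 * t,
    (∃ D, (partialDomination ρ S T k).Sol A D) → ∃ D, (partialDomination ρ S T k).Sol B D

/-- Let `S` be the labels used by `DA` and `T` those of boundary vertices dominated from `F`. Then
`DA` solves the problem for `S`, `T` and its own size, and a solution of this problem in `B` can
replace it at no greater cost. -/
theorem Transfers.exists_exchange {ρ : VRel t} (h : Transfers ρ A B) (hL : SameLabels A B)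
    (hA : ∃ a, A.lab a = 0) {D : Finset (GlueVertex A F)} {DA : Finset A.V}
    (hDA : ∀ a, a ∈ DA ↔ inL A F a ∈ D) (hk : DA.card ≤ 2 * t)
    (hD : IsDominatingSet (A.glue F) (D : Set (GlueVertex A F)))
    (hconn : ConnOn (ρ A) (DA : Set A.V)) :
    ∃ (DB : Finset B.V) (D' : Finset (GlueVertex B F)), Exchange D DA DB D' ∧
      DB.card ≤ DA.card ∧ DB.Nonempty ∧ ConnOn (ρ B) (DB : Set B.V) ∧
      ∀ l ≠ 0, (∃ a ∈ DA, A.lab a = l) ↔ ∃ b ∈ DB, B.lab b = l := by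
  classical
  let S := (Finset.range (t + 1)).filter fun l => l ≠ 0 ∧ ∃ a ∈ DA, A.lab a = l
  let T := (Finset.range (t + 1)).filter fun l => l ≠ 0 ∧
    ∃ f f', F.lab f = l ∧ inR A F f' ∈ D ∧ f ∈ F.graph.closedNbhd f'
  have hmS : ∀ l, l ∈ S ↔ l ≠ 0 ∧ ∃ a ∈ DA, A.lab a = l := by
    intro l
    rw [Finset.mem_filter, and_iff_right_iff_imp]
    rintro ⟨-, a, -, rfl⟩
    exact Finset.mem_range.mpr (Nat.lt_succ_of_le (lab_le a))
  have hmT : ∀ l, l ∈ T ↔ l ≠ 0 ∧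
      ∃ f f', F.lab f = l ∧ inR A F f' ∈ D ∧ f ∈ F.graph.closedNbhd f' := by
    intro l
    rw [Finset.mem_filter, and_iff_right_iff_imp]
    rintro ⟨-, f, -, rfl, -⟩
    exact Finset.mem_range.mpr (Nat.lt_succ_of_le (lab_le f))
  have hdom : ∀ a, A.lab a ∉ T → ∃ w ∈ DA, a ∈ A.graph.closedNbhd w := by
    intro a ha
    obtain ⟨u, hu, h⟩ := isDominatingSet_iff.mp hD (inL A F a)
    rcases mem_closedNbhd_glue h with ⟨a', a'', h', rfl, e⟩ | ⟨f', f, h', rfl, e⟩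
    · obtain rfl := inL_injective e
      exact ⟨a', (hDA a').mpr hu, h'⟩
    · obtain ⟨e1, e2⟩ := inL_eq_inR.mp e
      exact absurd ((hmT _).mpr ⟨e2, f, f', e1.symm, hu, h'⟩) ha
  -- An unlabelled vertex of `A` has no neighbours on the side of `F`, so it is dominated from `DA`.
  have hne : DA.Nonempty := by
    obtain ⟨a, ha⟩ := hA
    obtain ⟨w, hw, -⟩ := hdom a fun h => ((hmT _).mp h).1 ha
    exact ⟨w, hw⟩
  obtain ⟨DB, hDB⟩ := h S (Finset.filter_subset _ _) T (Finset.filter_subset _ _) DA.card hk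
    ⟨DA, hne, fun a ha => by
      by_cases h0 : A.lab a = 0
      · exact .inl h0
      · exact .inr ((hmS _).mpr ⟨h0, a, ha, rfl⟩), le_rfl, hconn, fun i => by
      by_cases hi : (i : ℕ) + 1 ∈ S
      · obtain ⟨-, a, ha, hl⟩ := (hmS _).mp hi
        exact ⟨a, ha, fun _ => hl⟩
      · obtain ⟨a, ha⟩ := hne
        exact ⟨a, ha, fun h => absurd h hi⟩, hdom⟩
  have hlab : ∀ l ≠ 0, (∃ a ∈ DA, A.lab a = l) ↔ ∃ b ∈ DB, B.lab b = l := by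
    intro l hl
    constructor
    · intro h
      have hS : l ∈ S := (hmS l).mpr ⟨hl, h⟩
      have hlt : l < t + 1 := by
        obtain ⟨a, -, rfl⟩ := h
        exact Nat.lt_succ_of_le (lab_le a)
      obtain ⟨b, hb, hb'⟩ := hDB.meets ⟨l - 1, show l - 1 < t by omega⟩
      have e : l - 1 + 1 = l := by omega
      refine ⟨b, hb, ?_⟩
      have h1 : (l - 1 + 1 ∈ S → B.lab b = l - 1 + 1) := hb'
      rw [e] at h1
      exact h1 hS
    · rintro ⟨b, hb, rfl⟩
      exact ((hmS _).mp ((hDB.subset b hb).resolve_left hl)).2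
  obtain ⟨D', hD'⟩ := BoundariedGraph.exists_exchange hL hDA hD
    (fun a ha h0 => (hlab _ h0).mp ⟨a, ha, rfl⟩) (fun b => by
      by_cases hb : B.lab b ∈ T
      · exact .inr ((hmT _).mp hb)
      · exact .inl (hDB.dominates b hb))
  exact ⟨DB, D', hD', hDB.card_le, hDB.nonempty, hDB.conn, hlab⟩

/-! ### Solutions with few vertices on one side -/

theorem card_boundary_le (A : BoundariedGraph t) : ∃ X : Finset A.V, X.card ≤ t ∧
    ∀ v, v ∈ X ↔ A.lab v ≠ 0 := by
  have : Finite A.V := A.finite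
  refine ⟨(Set.toFinite {v | A.lab v ≠ 0}).toFinset, ?_, by simp⟩
  rw [← Set.ncard_eq_toFinset_card]
  have h := Set.ncard_le_ncard_of_injOn (s := {v | A.lab v ≠ 0}) (t := (Finset.Icc 1 t : Finset ℕ))
    A.lab (fun v hv => by
      have hv' : A.lab v ≠ 0 := hv
      rw [Finset.coe_Icc]
      exact ⟨by omega, lab_le v⟩) (fun v hv w _ h => lab_injOn h hv)
  rwa [Set.ncard_coe_finset, Nat.card_Icc, Nat.add_sub_cancel] at h

/-- A dominating set of a glued graph may be assumed to contain few vertices of one side if this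
side has a small dominating set. -/
theorem exists_small_exchange {S₀ : Finset A.V} (hS₀ : S₀.card ≤ t)
    (hdom : ∀ v, ∃ w ∈ S₀, v ∈ A.graph.closedNbhd w) {D : Finset (GlueVertex A F)}
    {DA : Finset A.V} (hDA : ∀ a, a ∈ DA ↔ inL A F a ∈ D)
    (hD : IsDominatingSet (A.glue F) (D : Set (GlueVertex A F))) :
    ∃ (DB : Finset A.V) (D' : Finset (GlueVertex A F)), Exchange D DA DB D' ∧ DB.card ≤ 2 * t ∧
      S₀ ⊆ DB ∧ (∀ v, A.lab v ≠ 0 → v ∈ DB) := by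
  classical
  obtain ⟨X, hX, hmX⟩ := A.card_boundary_le
  -- With all labelled vertices included, no label is lost, and `S₀` dominates `A` without help from
  -- `F`.
  obtain ⟨D', hD'⟩ := BoundariedGraph.exists_exchange (A := A) (B := A) (DB := S₀ ∪ X)
    (fun _ _ => Iff.rfl) hDA hD
    (fun a _ h0 => ⟨a, Finset.mem_union_right _ ((hmX a).mpr h0), rfl⟩)
    (fun b => .inl (by
      obtain ⟨w, hw, h⟩ := hdom b
      exact ⟨w, Finset.mem_union_left _ hw, h⟩))
  refine ⟨S₀ ∪ X, D', hD', ?_, Finset.subset_union_left, fun v hv =>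
    Finset.mem_union_right _ ((hmX v).mpr hv)⟩
  exact (Finset.card_union_le _ _).trans (by omega)

/-- If the part in `A` exceeds `2 * t`, it is first shrunk inside `A`, which makes the whole set
smaller; then it is transferred to `B`. -/
theorem dominatingSet_of_transfers (h : Transfers (fun _ _ _ => True) A B) (hL : SameLabels A B)
    (hA : ∃ a, A.lab a = 0)
    (hdom : ∃ S₀ : Finset A.V, S₀.card ≤ t ∧ ∀ v, ∃ w ∈ S₀, v ∈ A.graph.closedNbhd w) {k : ℤ}
    (hk : DominatingSetProblem _ (A.glue F) k) : DominatingSetProblem _ (B.glue F) k := by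
  have key : ∀ (D : Finset (GlueVertex A F)) (DA : Finset A.V),
      (∀ a, a ∈ DA ↔ inL A F a ∈ D) → DA.card ≤ 2 * t →
      IsDominatingSet (A.glue F) (D : Set (GlueVertex A F)) →
      ∃ D' : Finset (GlueVertex B F), D'.card ≤ D.card ∧
        IsDominatingSet (B.glue F) (D' : Set (GlueVertex B F)) := by
    intro D DA hDA hk hD
    obtain ⟨DB, D', hD', hc, -⟩ := h.exists_exchange hL hA hDA hk hD
      (fun u hu v hv => .single ⟨trivial, hu, hv⟩)
    have := hD'.card_le
    exact ⟨D', by omega, hD'.dominates⟩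
  obtain ⟨D, hDk, hD⟩ := hk
  obtain ⟨S₀, hS₀, hdom⟩ := hdom
  classical
  let DA := D.preimage (inL A F) inL_injective.injOn
  have hDA : ∀ a, a ∈ DA ↔ inL A F a ∈ D := fun a => Finset.mem_preimage
  by_cases hc : DA.card ≤ 2 * t
  · obtain ⟨D', h1, h2⟩ := key D DA hDA hc hD
    exact ⟨D', by omega, h2⟩
  · obtain ⟨DB, D₁, hD₁, hc₁, -⟩ := exists_small_exchange hS₀ hdom hDA hD
    obtain ⟨D', h1, h2⟩ := key D₁ DB (fun a => (hD₁.inL_mem a).symm) hc₁ hD₁.dominates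
    have := hD₁.card_le
    exact ⟨D', by omega, h2⟩

end BoundariedGraph

/-! ### Exchanging one side of a connected dominating set -/

theorem induce_connected_iff {V : Type} {G : SimpleGraph V} {D : Set V} :
    (G.induce D).Connected ↔ D.Nonempty ∧ ConnOn G.Adj D := by
  rw [SimpleGraph.connected_iff, and_comm, Set.nonempty_coe_sort]
  refine and_congr_right fun _ => ⟨fun h u hu v hv => ?_, fun h u v => ?_⟩
  · have := (SimpleGraph.reachable_iff_reflTransGen _ _).mp (h ⟨u, hu⟩ ⟨v, hv⟩)
    exact reflTransGen_map Subtype.val (fun a b hab => ⟨hab, a.2, b.2⟩) this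
  · rw [SimpleGraph.reachable_iff_reflTransGen]
    have key : ∀ w, ReflTransGen (fun a b => G.Adj a b ∧ a ∈ D ∧ b ∈ D) (u : V) w →
        ∀ hw : w ∈ D, ReflTransGen (G.induce D).Adj u ⟨w, hw⟩ := by
      intro w h
      induction h with
      | refl => exact fun _ => .refl
      | tail _ hab ih => exact fun hw => (ih hab.2.1).tail hab.1
    exact key v (h u u.2 v v.2) v.2

namespace BoundariedGraph

variable {t : ℕ} {A B F : BoundariedGraph t}

/-- Adjacency together with virtual edges between labelled vertices. -/
def adjOrLab (E : Finset (ℕ × ℕ)) : VRel t := fun A v w =>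
  A.graph.Adj v w ∨ (A.lab v, A.lab w) ∈ E

/-- Virtual edges join labels whose vertices of `F` are connected by `D` within `F`. Walks of `D`
between vertices of `A` shorten to walks in `DA` along edges and virtual edges, so `DA` is connected
in this sense. The replacement `DB` is too, and its virtual edges expand again, because the walks in
`F` survive in `D'`. -/
theorem connectedDominatingSet_swap
    (h : ∀ E ⊆ Finset.range (t + 1) ×ˢ Finset.range (t + 1), (∀ l l', (l, l') ∈ E → (l', l) ∈ E) →
      Transfers (adjOrLab E) A B) (hL : SameLabels A B)
    (hA : ∃ a, A.lab a = 0) {D : Finset (GlueVertex A F)} {DA : Finset A.V}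
    (hDA : ∀ a, a ∈ DA ↔ inL A F a ∈ D) (hk : DA.card ≤ 2 * t)
    (hD : IsConnectedDominatingSet (A.glue F) (D : Set (GlueVertex A F))) :
    ∃ D' : Finset (GlueVertex B F), D'.card ≤ D.card ∧
      IsConnectedDominatingSet (B.glue F) (D' : Set (GlueVertex B F)) := by
  classical
  obtain ⟨hD, hconn⟩ := hD
  obtain ⟨-, hconn⟩ := induce_connected_iff.mp hconn
  let r : F.V → F.V → Prop := fun f f' => F.graph.Adj f f' ∧ inR A F f ∈ D ∧ inR A F f' ∈ D
  have hr : Std.Symm r := ⟨fun f f' h => ⟨h.1.symm, h.2.2, h.2.1⟩⟩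
  let E := (Finset.range (t + 1) ×ˢ Finset.range (t + 1)).filter fun l => l.1 ≠ 0 ∧ l.2 ≠ 0 ∧
    ∃ f f', F.lab f = l.1 ∧ F.lab f' = l.2 ∧ ReflTransGen r f f'
  have hmE : ∀ l l', (l, l') ∈ E ↔ l ≠ 0 ∧ l' ≠ 0 ∧
      ∃ f f', F.lab f = l ∧ F.lab f' = l' ∧ ReflTransGen r f f' := by
    intro l l'
    rw [Finset.mem_filter, and_iff_right_iff_imp]
    rintro ⟨-, -, f, f', rfl, rfl, -⟩
    exact Finset.mem_product.mpr ⟨Finset.mem_range.mpr (Nat.lt_succ_of_le (lab_le f)),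
      Finset.mem_range.mpr (Nat.lt_succ_of_le (lab_le f'))⟩
  -- what can be reached from a vertex of `A`
  have reach : ∀ a ∈ DA, ∀ p, ReflTransGen (fun p q => (A.glue F).Adj p q ∧
      p ∈ (D : Set (GlueVertex A F)) ∧ q ∈ (D : Set (GlueVertex A F))) (inL A F a) p →
      (∀ a', p = inL A F a' → ReflTransGen (fun v w => adjOrLab E A v w ∧ v ∈ (DA : Set A.V) ∧
        w ∈ (DA : Set A.V)) a a') ∧
      (∀ f, p = inR A F f → ∃ a' ∈ DA, ∃ f', A.lab a' = F.lab f' ∧ A.lab a' ≠ 0 ∧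
        inR A F f' ∈ D ∧ ReflTransGen r f' f ∧ ReflTransGen (fun v w => adjOrLab E A v w ∧
          v ∈ (DA : Set A.V) ∧ w ∈ (DA : Set A.V)) a a') := by
    intro a ha p hp
    induction hp with
    | refl =>
      refine ⟨fun a' h => inL_injective h ▸ .refl, fun f h => ?_⟩
      obtain ⟨e1, e2⟩ := inL_eq_inR.mp h
      exact ⟨a, ha, f, e1, e2, h ▸ (hDA a).mp ha, .refl, .refl⟩
    | @tail p q _ hpq ih =>
      obtain ⟨hadj, hp, hq⟩ := hpq
      rcases glue_adj.mp hadj with ⟨u, v, huv, rfl, rfl⟩ | ⟨f, g, hfg, rfl, rfl⟩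
      · have hu : u ∈ DA := (hDA u).mpr hp
        have hv : v ∈ DA := (hDA v).mpr hq
        have hav := (ih.1 u rfl).tail ⟨.inl huv, hu, hv⟩
        refine ⟨fun a' h => inL_injective h ▸ hav, fun f h => ?_⟩
        obtain ⟨e1, e2⟩ := inL_eq_inR.mp h
        exact ⟨v, hv, f, e1, e2, h ▸ hq, .refl, hav⟩
      · obtain ⟨a', ha', f', e1, e2, hf', hff, haa⟩ := ih.2 f rfl
        have hfg' : ReflTransGen r f' g := hff.tail ⟨hfg, hp, hq⟩
        refine ⟨fun a'' h => ?_, fun g' h => ?_⟩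
        · obtain ⟨e3, e4⟩ := inL_eq_inR.mp h.symm
          refine haa.tail ⟨.inr ?_, ha', (hDA a'').mpr (h ▸ hq)⟩
          exact (hmE _ _).mpr ⟨e2, e4, f', g, e1.symm, e3.symm, hfg'⟩
        · exact ⟨a', ha', f', e1, e2, hf', inR_injective h ▸ hfg', haa⟩
  have hE : ∀ l l', (l, l') ∈ E → (l', l) ∈ E := by
    intro l l' h
    obtain ⟨h1, h2, f, f', e1, e2, h3⟩ := (hmE l l').mp h
    exact (hmE _ _).mpr ⟨h2, h1, f', f, e2, e1, ReflTransGen.stdSymm.symm _ _ h3⟩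
  obtain ⟨DB, D', hD', hc, ⟨b₀, hb₀⟩, hcB, hlab⟩ := (h E (Finset.filter_subset _ _) hE).exists_exchange
    hL hA hDA hk hD (fun u hu v hv => (reach u hu _ (hconn _ ((hDA u).mp hu) _ ((hDA v).mp hv))).1 v rfl)
  have hcard := hD'.card_le
  refine ⟨D', by omega, hD'.dominates, induce_connected_iff.mpr
    ⟨⟨_, (hD'.inL_mem b₀).mpr hb₀⟩, ?_⟩⟩
  have hF : ∀ {f f'}, ReflTransGen r f f' → ReflTransGen (fun p q => (B.glue F).Adj p q ∧
      p ∈ (D' : Set (GlueVertex B F)) ∧ q ∈ (D' : Set (GlueVertex B F)))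
      (inR B F f) (inR B F f') := fun h => reflTransGen_map (inR B F) (fun f f' h =>
    ⟨glue_adj_inR h.1, hD'.inR_mem f h.2.1, hD'.inR_mem f' h.2.2⟩) h
  have hB : ∀ b ∈ DB, ReflTransGen (fun p q => (B.glue F).Adj p q ∧
      p ∈ (D' : Set (GlueVertex B F)) ∧ q ∈ (D' : Set (GlueVertex B F)))
      (inL B F b₀) (inL B F b) := by
    intro b hb
    have := hcB b₀ hb₀ b hb
    clear hb
    induction this with
    | refl => exact .refl
    | @tail v w _ hvw ih =>
      obtain ⟨hvw | hvw, hv, hw⟩ := hvw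
      · exact ih.tail ⟨glue_adj_inL hvw, (hD'.inL_mem v).mpr hv, (hD'.inL_mem w).mpr hw⟩
      · obtain ⟨h1, h2, f, f', e1, e2, hff⟩ := (hmE _ _).mp hvw
        rw [inL_eq_inR.mpr ⟨e2.symm, h2⟩]
        rw [inL_eq_inR.mpr ⟨e1.symm, h1⟩] at ih
        exact ih.trans (hF hff)
  refine .of_root (fun p q h => h.symm) (inL B F b₀) fun p hp => ?_
  rcases hD'.cases p hp with ⟨b, hb, rfl⟩ | ⟨f, hf, rfl⟩
  · exact hB b hb
  · obtain ⟨a, ha⟩ : DA.Nonempty := by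
      obtain ⟨a, ha⟩ := hA
      obtain ⟨u, hu, h⟩ := isDominatingSet_iff.mp hD (inL A F a)
      rcases mem_closedNbhd_glue h with ⟨a', a'', -, rfl, -⟩ | ⟨f', f, -, -, e⟩
      · exact ⟨a', (hDA a').mpr hu⟩
      · exact absurd ha (inL_eq_inR.mp e).2
    -- A vertex of `D` from `F` hangs on a glued vertex `f'` by a walk inside `F`, and the label of
    -- `f'` is also used by `DB`.
    obtain ⟨a', ha', f', e1, e2, hf', hff, -⟩ := (reach a ha _ (hconn _ ((hDA a).mp ha) _ hf)).2 f rfl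
    obtain ⟨b, hb, e3⟩ := (hlab _ e2).mp ⟨a', ha', rfl⟩
    have := hB b hb
    rw [inL_eq_inR.mpr ⟨e3.trans e1, e3 ▸ e2⟩] at this
    exact this.trans (hF hff)

/-- `S` is a dominating set whose intersections with the connected components are connected. -/
structure IsComponentwiseCDS (A : BoundariedGraph t) (S : Finset A.V) : Prop where
  dominates : ∀ v, ∃ w ∈ S, v ∈ A.graph.closedNbhd w
  conn : ∀ u ∈ S, ∀ v ∈ S, A.graph.Reachable u v →
    ReflTransGen (fun a b => A.graph.Adj a b ∧ a ∈ S ∧ b ∈ S) u v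

/-- Attach each vertex of `D` from `A` to the members of `DB` in its component of `A`, and each
vertex of `D` from `F` to itself. Adjacent vertices of `D` have attachments that are connected in
`D'`, so the connectedness of `D` passes to `D'`. -/
theorem exists_small_connected_exchange {S₀ : Finset A.V} (hS₀ : S₀.card ≤ t)
    (hcds : A.IsComponentwiseCDS S₀) {D : Finset (GlueVertex A F)}
    {DA : Finset A.V} (hDA : ∀ a, a ∈ DA ↔ inL A F a ∈ D)
    (hD : IsConnectedDominatingSet (A.glue F) (D : Set (GlueVertex A F))) :
    ∃ (DB : Finset A.V) (D' : Finset (GlueVertex A F)), Exchange D DA DB D' ∧ DB.card ≤ 2 * t ∧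
      IsConnectedDominatingSet (A.glue F) (D' : Set (GlueVertex A F)) := by
  obtain ⟨hD, hconn⟩ := hD
  obtain ⟨⟨p₀, hp₀⟩, hconn⟩ := induce_connected_iff.mp hconn
  obtain ⟨DB, D', hD', hc, hsub, hbd⟩ := exists_small_exchange hS₀ hcds.dominates hDA hD
  refine ⟨DB, D', hD', hc, hD'.dominates, ?_⟩
  let R : GlueVertex A F → GlueVertex A F → Prop := ReflTransGen fun p q => (A.glue F).Adj p q ∧
    p ∈ (D' : Set (GlueVertex A F)) ∧ q ∈ (D' : Set (GlueVertex A F))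
  have hRs : ∀ {p q}, R p q → R q p := by
    have : Std.Symm fun p q => (A.glue F).Adj p q ∧
        p ∈ (D' : Set (GlueVertex A F)) ∧ q ∈ (D' : Set (GlueVertex A F)) :=
      ⟨fun p q h => ⟨h.1.symm, h.2.2, h.2.1⟩⟩
    intro p q h
    exact ReflTransGen.stdSymm.symm _ _ h
  have hDB : ∀ {b}, b ∈ DB → inL A F b ∈ D' := fun h => (hD'.inL_mem _).mpr h
  have nbr : ∀ {b w}, b ∈ DB → w ∈ DB → b ∈ A.graph.closedNbhd w → R (inL A F w) (inL A F b) := by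
    rintro b w hb hw (rfl | h)
    · exact .refl
    · exact .single ⟨glue_adj_inL h, hDB hw, hDB hb⟩
  have reach_of_nbr : ∀ {b w : A.V}, b ∈ A.graph.closedNbhd w → A.graph.Reachable w b := by
    rintro b w (rfl | h)
    · exact .rfl
    · exact h.reachable
  -- Two members of `DB` in one component of `A` have dominators in `S₀`, which are connected inside
  -- `S₀`.
  have fact : ∀ {a b}, a ∈ DB → b ∈ DB → A.graph.Reachable a b → R (inL A F a) (inL A F b) := by
    intro a b ha hb hab
    obtain ⟨w, hw, haw⟩ := hcds.dominates a
    obtain ⟨w', hw', hbw⟩ := hcds.dominates b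
    refine (hRs (nbr ha (hsub hw) haw)).trans (ReflTransGen.trans ?_ (nbr hb (hsub hw') hbw))
    exact reflTransGen_map (inL A F) (fun u v h => ⟨glue_adj_inL h.1, hDB (hsub h.2.1),
      hDB (hsub h.2.2)⟩) (hcds.conn w hw w' hw'
        (((reach_of_nbr haw).trans hab).trans (reach_of_nbr hbw).symm))
  let att : GlueVertex A F → GlueVertex A F → Prop := fun p y =>
    (∃ a, ∃ b ∈ DB, p = inL A F a ∧ y = inL A F b ∧ A.graph.Reachable a b) ∨
      ∃ f, inR A F f ∈ D ∧ p = inR A F f ∧ y = inR A F f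
  -- A glued vertex can be attached in both ways; it belongs to the boundary, hence to `DB`, which
  -- reconciles them.
  have att_unique : ∀ {p y y'}, att p y → att p y' → R y y' := by
    rintro p y y' (⟨a, b, hb, rfl, rfl, hab⟩ | ⟨f, hf, rfl, rfl⟩)
      (⟨a', b', hb', e, rfl, hab'⟩ | ⟨f', hf', e, rfl⟩)
    · obtain rfl := inL_injective e
      exact fact hb hb' (hab.symm.trans hab')
    · have ha : a ∈ DB := hbd a (inL_eq_inR.mp e).2
      rw [← e]
      exact fact hb ha hab.symm
    · have ha : a' ∈ DB := hbd a' (inL_eq_inR.mp e.symm).2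
      rw [e]
      exact fact ha hb' hab'
    · rw [e]
  have att_exists : ∀ p ∈ D, ∃ y, att p y := by
    intro p hp
    rcases glueVertex_cases p with ⟨a, rfl⟩ | ⟨f, rfl⟩
    · obtain ⟨w, hw, h⟩ := hcds.dominates a
      exact ⟨_, .inl ⟨a, w, hsub hw, rfl, rfl, (reach_of_nbr h).symm⟩⟩
    · exact ⟨_, .inr ⟨f, hp, rfl, rfl⟩⟩
  have att_adj : ∀ {p q y y'}, (A.glue F).Adj p q → p ∈ D → q ∈ D → att p y → att q y' → R y y' := by
    intro p q y y' hpq hp hq hy hy'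
    rcases glue_adj.mp hpq with ⟨u, v, huv, rfl, rfl⟩ | ⟨f, g, hfg, rfl, rfl⟩
    · obtain ⟨w, hw, h⟩ := hcds.dominates u
      have h' := (reach_of_nbr h).symm
      exact (att_unique hy (.inl ⟨u, w, hsub hw, rfl, rfl, h'⟩)).trans
        (att_unique (.inl ⟨v, w, hsub hw, rfl, rfl, huv.symm.reachable.trans h'⟩) hy')
    · exact ((att_unique hy (.inr ⟨f, hp, rfl, rfl⟩)).tail ⟨glue_adj_inR hfg, hD'.inR_mem f hp,
        hD'.inR_mem g hq⟩).trans (att_unique (.inr ⟨g, hq, rfl, rfl⟩) hy')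
  obtain ⟨y₀, hy₀⟩ := att_exists p₀ hp₀
  have att_conn : ∀ q ∈ D, ∀ y, att q y → R y₀ y := by
    intro q hq
    have := hconn p₀ hp₀ q hq
    clear hq
    induction this with
    | refl => exact fun y hy => att_unique hy₀ hy
    | @tail p q _ hpq ih =>
      intro y hy
      obtain ⟨y', hy'⟩ := att_exists p hpq.2.1
      exact (ih y' hy').trans (att_adj hpq.1 hpq.2.1 hpq.2.2 hy' hy)
  refine induce_connected_iff.mpr ⟨?_, .of_root (fun p q h => h.symm) y₀ fun y hy => ?_⟩
  · obtain ⟨u, hu, -⟩ := isDominatingSet_iff.mp hD'.dominates p₀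
    exact ⟨u, hu⟩
  · rcases hD'.cases y hy with ⟨b, hb, rfl⟩ | ⟨f, hf, rfl⟩
    -- Since `D` dominates `b`, either some vertex of `D` is attached to `b`, or `b` is glued and is
    -- equal or adjacent to a vertex of `D` from `F`.
    · obtain ⟨u, hu, h⟩ := isDominatingSet_iff.mp hD (inL A F b)
      rcases mem_closedNbhd_glue h with ⟨a', a, h', rfl, e⟩ | ⟨f', f, h', rfl, e⟩
      · obtain rfl := inL_injective e
        exact att_conn _ hu _ (.inl ⟨a', b, hb, rfl, rfl, reach_of_nbr h'⟩)
      · have h1 := att_conn _ hu _ (.inr ⟨f', hu, rfl, rfl⟩)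
        rcases h' with rfl | h'
        · rwa [e]
        · refine h1.tail ⟨?_, hD'.inR_mem f' hu, hy⟩
          rw [e]
          exact glue_adj_inR h'
    · exact att_conn _ hf _ (.inr ⟨f, hf, rfl, rfl⟩)

theorem connectedDominatingSet_of_transfers
    (h : ∀ E ⊆ Finset.range (t + 1) ×ˢ Finset.range (t + 1), (∀ l l', (l, l') ∈ E → (l', l) ∈ E) →
      Transfers (adjOrLab E) A B) (hL : SameLabels A B) (hA : ∃ a, A.lab a = 0)
    (hdom : ∃ S₀ : Finset A.V, S₀.card ≤ t ∧ A.IsComponentwiseCDS S₀) {k : ℤ}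
    (hk : ConnectedDominatingSetProblem _ (A.glue F) k) :
    ConnectedDominatingSetProblem _ (B.glue F) k := by
  obtain ⟨D, hDk, hD⟩ := hk
  obtain ⟨S₀, hS₀, hcds⟩ := hdom
  classical
  let DA := D.preimage (inL A F) inL_injective.injOn
  have hDA : ∀ a, a ∈ DA ↔ inL A F a ∈ D := fun a => Finset.mem_preimage
  by_cases hc : DA.card ≤ 2 * t
  · obtain ⟨D', h1, h2⟩ := connectedDominatingSet_swap h hL hA hDA hc hD
    exact ⟨D', by omega, h2⟩
  · obtain ⟨DB, D₁, hD₁, hc₁, hcd⟩ := exists_small_connected_exchange hS₀ hcds hDA hD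
    obtain ⟨D', h1, h2⟩ := connectedDominatingSet_swap h hL hA
      (fun a => (hD₁.inL_mem a).symm) hc₁ hcd
    have := hD₁.card_le
    exact ⟨D', by omega, h2⟩

end BoundariedGraph

/-! ### Encodings -/

/-- Offsets are nondecreasing, so every list lies below the last offset. Hence finitely many cells
determine the graph, and a fixed program can write them. -/
theorem Encodes.of_eq {t : ℕ} {s s' : Memory} {A : BoundariedGraph t} (h : Encodes s A)
    (h0 : s'.reg 0 = s.reg 0)
    (h1 : ∀ a < 3, ∀ i ≤ s.reg 0 + s.arr 0 (s.reg 0), s'.arr a i = s.arr a i) : Encodes s' A := by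
  obtain ⟨e, h00, he⟩ := h
  have hmono : ∀ k i, i + k = s.reg 0 → s.arr 0 i ≤ s.arr 0 (s.reg 0) := by
    intro k
    induction k with
    | zero => intro i hi; rw [← hi]; rfl
    | succ k ih =>
      intro i hi
      exact ((he ⟨i, by omega⟩).1).trans (ih (i + 1) (by omega))
  refine ⟨(finCongr h0).trans e, by rw [h1 0 (by omega) 0 (by omega), h00], fun i => ?_⟩
  have hi : (i : ℕ) < s.reg 0 := h0 ▸ i.2
  obtain ⟨g1, g2, g3, g4⟩ := he ⟨i, hi⟩
  have e0 : s'.arr 0 i = s.arr 0 i := h1 0 (by omega) _ (by omega)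
  have e1 : s'.arr 0 (i + 1) = s.arr 0 (i + 1) := h1 0 (by omega) _ (by omega)
  have e2 : s'.arr 2 i = s.arr 2 i := h1 2 (by omega) _ (by omega)
  have hle := hmono (s.reg 0 - (i + 1)) (i + 1) (by omega)
  refine ⟨by rw [e0, e1]; exact g1, ?_, fun h => e2.trans (g3 h), fun h => e2.trans (g4 h)⟩
  rw [e0, e1]
  refine Set.BijOn.congr (f₁ := s.arr 1) ?_ fun p hp => (h1 1 (by omega) p ?_).symm
  · convert g2 using 1
    ext j
    constructor
    · rintro ⟨hj, hadj⟩
      exact ⟨h0 ▸ hj, hadj⟩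
    · rintro ⟨hj, hadj⟩
      exact ⟨h0.symm ▸ hj, hadj⟩
  · have := hp.2
    omega

theorem Encodes.stores {t : ℕ} {s : Memory} {A : BoundariedGraph t} (h : Encodes s A) (x : ℕ → A.V) :
    ∃ e : ℕ → A.V, Stores 0 [] s ⟨A, x⟩ e := by
  obtain ⟨e, h00, he⟩ := h
  let f : ℕ → A.V := fun i => if h : i < s.reg 0 then e ⟨i, h⟩ else x 0
  have hf : ∀ i (h : i < s.reg 0), f i = e ⟨i, h⟩ := fun i h => dif_pos h
  refine ⟨f, ?_, ?_, fun i hi => (he ⟨i, hi⟩).1, ?_, ?_, ?_, ?_, by omega, by omega, by simp⟩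
  · intro i hi j hj h
    rw [hf i hi, hf j hj] at h
    simpa using e.injective h
  · intro v
    exact ⟨e.symm v, (e.symm v).2, by rw [hf _ (e.symm v).2]; simp⟩
  -- A list without repetitions of numbers below `n` has at most `n` entries.
  · intro i hi
    have h := (he ⟨i, hi⟩).2.1
    have := Finset.card_le_card_of_injOn (s := Finset.Ico (s.arr 0 i) (s.arr 0 (i + 1)))
      (t := Finset.range (s.reg 0)) (s.arr 1) (fun p hp => by
        obtain ⟨hj, -⟩ := h.mapsTo (Finset.mem_Ico.mp hp)
        exact Finset.mem_coe.mpr (Finset.mem_range.mpr hj)) (by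
        rw [Finset.coe_Ico]; exact h.injOn)
    rw [Nat.card_Ico, Finset.card_range] at this
    omega
  · intro i hi p h1 h2
    exact ((he ⟨i, hi⟩).2.1.mapsTo ⟨h1, h2⟩).1
  · intro i hi j hj
    rw [hf i hi, hf j hj]
    have h := (he ⟨i, hi⟩).2.1
    constructor
    · rintro ⟨p, h1, h2, rfl⟩
      exact (h.mapsTo ⟨h1, h2⟩).2
    · intro hadj
      obtain ⟨p, hp, hpj⟩ := h.surjOn ⟨hj, hadj⟩
      exact ⟨p, hp.1, hp.2, hpj⟩
  · intro i hi
    rw [hf i hi]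
    change _ = A.lab _
    unfold BoundariedGraph.lab
    split_ifs with h
    · exact (he ⟨i, hi⟩).2.2.1 h
    · exact (he ⟨i, hi⟩).2.2.2 h

theorem Encodes.card_eq {t : ℕ} {s : Memory} {A : BoundariedGraph t} (h : Encodes s A) :
    Nat.card A.V = s.reg 0 := by
  obtain ⟨e, -⟩ := h
  rw [← Nat.card_congr e, Nat.card_fin]

/-! ### Constant output -/

/-- Copy the given cells of the memory `s₀`. -/
def writeProgram (s₀ : Memory) : List (ℕ × ℕ) → Program
  | [] => .skip
  | (a, i) :: L => .seq (.const 3 i) (.seq (.const 4 (s₀.arr a i))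
      (.seq (.store a 3 4) (writeProgram s₀ L)))

theorem writeProgram_halts (s₀ : Memory) (L : List (ℕ × ℕ)) (s : Memory) :
    Halts (writeProgram s₀ L) s (3 * L.length + 1) fun s' =>
      ∀ a i, ((a, i) ∈ L ∨ s.arr a i = s₀.arr a i) → s'.arr a i = s₀.arr a i := by
  induction L generalizing s with
  | nil => exact .skip (by simp)
  | cons x L ih =>
    obtain ⟨a, i⟩ := x
    refine Halts.mono (.seq <| .const <| .seq <| .const <| .seq <| .store <| (ih _).mono le_rfl ?_)
      (N := 1 + (1 + (1 + (3 * L.length + 1)))) (by simp; omega) fun _ h => h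
    intro s' h b j hbj
    refine h b j ?_
    rw [Memory.setArr_arr]
    simp only [Memory.setReg_reg, Memory.setReg_arr, if_true, Nat.reduceEqDiff, if_false]
    by_cases hL : (b, j) ∈ L
    · exact .inl hL
    · right
      split_ifs with he
      · rw [he.1, he.2]
      · rcases hbj with h' | h'
        · rcases List.mem_cons.mp h' with h'' | h''
          · exact absurd (Prod.ext_iff.mp h'') he
          · exact absurd h'' hL
        · exact h'

theorem exists_output_program {t : ℕ} {s₀ : Memory} {A : BoundariedGraph t} (h : Encodes s₀ A) :
    ∃ p C, ∀ s, Halts p s C fun s' => Encodes s' A ∧ s'.reg 1 = 0 ∧ s'.reg 2 = 0 := by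
  let L := List.range 3 ×ˢ List.range (s₀.reg 0 + s₀.arr 0 (s₀.reg 0) + 1)
  refine ⟨.seq (writeProgram s₀ L) (.seq (.const 0 (s₀.reg 0)) (.seq (.const 1 0) (.const 2 0))),
    (3 * L.length + 1) + (1 + (1 + 1)), fun s => .seq ((writeProgram_halts s₀ L s).mono le_rfl ?_)⟩
  intro s' hs'
  refine .seq <| .const <| .seq <| .const <| .const ⟨h.of_eq ?_ fun a ha i hi => ?_, ?_, ?_⟩
  · simp [Memory.setReg_reg]
  · exact hs' a i (.inl (List.pair_mem_product.mpr
      ⟨List.mem_range.mpr ha, List.mem_range.mpr (by omega)⟩))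
  · simp [Memory.setReg_reg]
  · simp [Memory.setReg_reg]

/-- If finitely many predicates that are decidable in time `O(n ^ d)` determine the equivalence class
of a boundaried graph, then a small equivalent graph can be found in time `O(n ^ d)`. -/
theorem exists_program_of_determined {t d : ℕ} {Q : GraphProblem} {ι : Type} (I : Finset ι)
    (φ : ι → BoundariedGraph t → Prop) (Pre : BoundariedGraph t → Prop)
    (hφ : ∀ i ∈ I, Dec d 0 [] (fun c => Pre c.A) fun c => φ i c.A)
    (hQ : ∀ A B, Pre A → Pre B → (∀ i ∈ I, φ i A ↔ φ i B) → IsTranspositionConstant Q A B 0) :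
    ∃ ξ p C, ∀ A, Pre A → Nonempty A.V →
      OutputsSmallEquivalent Q p A ξ (C * Nat.card A.V ^ d) := by
  classical
  induction I using Finset.induction_on generalizing Pre with
  | empty =>
    -- At a leaf all graphs that satisfy `Pre` are equivalent with constant 0, so any encoded one
    -- serves as output. If there is none, no input reaches this leaf.
    by_cases hex : ∃ s₀ A₀, Pre A₀ ∧ Encodes s₀ A₀
    · obtain ⟨s₀, A₀, hA₀, hs₀⟩ := hex
      obtain ⟨p, C, hp⟩ := exists_output_program hs₀
      refine ⟨Nat.card A₀.V, p, C, fun A hA hne s hs => ?_⟩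
      obtain ⟨n, s', h1, h2, h3, h4, h5⟩ := hp s
      have hc := hQ A A₀ hA hA₀ (by simp)
      have : Finite A.V := A.finite
      refine ⟨n, s', A₀, h1, h2.trans ?_, h3, le_rfl, ⟨0, hc⟩, by simpa [h4, h5] using hc⟩
      exact Nat.le_mul_of_pos_right _ (Nat.pow_pos Nat.card_pos)
    · exact ⟨0, .skip, 0, fun A hA _ s hs => absurd ⟨s, A, hA, hs⟩ hex⟩
  | insert a I _ ih =>
    obtain ⟨p, C, hp⟩ := hφ a (by simp)
    -- Either answer to the question `a` is added to the precondition, and the remaining questions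
    -- are settled by induction.
    obtain ⟨ξ₁, p₁, C₁, h₁⟩ := ih (fun A => Pre A ∧ φ a A)
      (fun i hi => (hφ i (by simp [hi])).mono (fun c hc => hc.1) fun _ _ => Iff.rfl)
      (fun A B hA hB h => hQ A B hA.1 hB.1 fun i hi => by
        rcases Finset.mem_insert.mp hi with rfl | hi
        · exact iff_of_true hA.2 hB.2
        · exact h i hi)
    obtain ⟨ξ₂, p₂, C₂, h₂⟩ := ih (fun A => Pre A ∧ ¬ φ a A)
      (fun i hi => (hφ i (by simp [hi])).mono (fun c hc => hc.1) fun _ _ => Iff.rfl)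
      (fun A B hA hB h => hQ A B hA.1 hB.1 fun i hi => by
        rcases Finset.mem_insert.mp hi with rfl | hi
        · exact iff_of_false hA.2 hB.2
        · exact h i hi)
    refine ⟨max ξ₁ ξ₂, .seq p (.seq (.const 3 0) (.ite 3 1 p₁ p₂)), C + 2 + C₁ + C₂,
      fun A hA hne s hs => ?_⟩
    obtain ⟨v⟩ := hne
    obtain ⟨e, he⟩ := hs.stores fun _ => v
    obtain ⟨n, s', r1, r2, r3, r4⟩ := hp ⟨A, fun _ => v⟩ e s hA he
    have hcard := hs.card_eq
    have hpos : 0 < s.reg 0 ^ d := Nat.pow_pos he.pos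
    have hag : Agree 0 0 s (s'.setReg 3 0) := r3.setReg (by unfold KeptReg; omega)
    have hs' : Encodes (s'.setReg 3 0) A :=
      hs.of_eq hag.reg_zero fun a ha i _ => congrFun (hag.arr a (.inl ha)) i
    by_cases hφA : φ a A
    · obtain ⟨n', s'', B, g1, g2, g3, g4, g5⟩ := h₁ A ⟨hA, hφA⟩ ⟨v⟩ _ hs'
      refine ⟨_, s'', B, .seq r1 (.seq (.const _ _ _) (.ite_true ?_ g1)), ?_, g3,
        g4.trans (le_max_left _ _), g5⟩
      · simpa [Memory.setReg_reg] using r4.mpr hφA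
      · rw [hcard] at g2 ⊢
        nlinarith [Nat.zero_le (C₂ * s.reg 0 ^ d)]
    · obtain ⟨n', s'', B, g1, g2, g3, g4, g5⟩ := h₂ A ⟨hA, hφA⟩ ⟨v⟩ _ hs'
      refine ⟨_, s'', B, .seq r1 (.seq (.const _ _ _) (.ite_false ?_ g1)), ?_, g3,
        g4.trans (le_max_right _ _), g5⟩
      · simpa [Memory.setReg_reg] using fun h => hφA (r4.mp h)
      · rw [hcard] at g2 ⊢
        nlinarith [Nat.zero_le (C₁ * s.reg 0 ^ d)]

/-- The questions are which labels occur and which partial domination problems are solvable. Equal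
answers give `Transfers` in both directions, hence both directions of the equivalence. -/
theorem exists_program_of_transfers {t d : ℕ} {Q : GraphProblem} (hd : 1 ≤ d) (h b : ℕ) {κ : Type}
    (K : Finset κ) (ρ : κ → VRel t) (hρ : ∀ i ∈ K, VRel.Tabulable d (ρ i))
    (hsymm : ∀ i ∈ K, ∀ A v w, ρ i A v w → ρ i A w v) (Pre : BoundariedGraph t → Prop)
    (hPre : ∀ A, Pre A → BicliqueFree h b A.graph)
    (hQ : ∀ A B, Pre A → Pre B → A.SameLabels B → (∀ i ∈ K, BoundariedGraph.Transfers (ρ i) A B) →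
      ∀ F k, Q _ (A.glue F) k → Q _ (B.glue F) k) :
    ∃ ξ p C, ∀ A, Pre A → Nonempty A.V →
      OutputsSmallEquivalent Q p A ξ (C * Nat.card A.V ^ d) := by
  let J := (Finset.range (t + 1)).powerset ×ˢ ((Finset.range (t + 1)).powerset ×ˢ
    (Finset.range (2 * t + 1) ×ˢ K))
  let φ : ℕ ⊕ (Finset ℕ × Finset ℕ × ℕ × κ) → BoundariedGraph t → Prop :=
    Sum.elim (fun l A => ∃ a, A.lab a = l) fun j A =>
      ∃ D, (BoundariedGraph.partialDomination (ρ j.2.2.2) j.1 j.2.1 j.2.2.1).Sol A D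
  refine exists_program_of_determined ((Finset.range (t + 1)).disjSum J) φ Pre ?_ ?_
  · rintro (l | ⟨S, T, k, i⟩) hi
    · exact (Dec.nonempty hd (Loc.lab l)).mono (fun _ => id) fun _ _ => Iff.rfl
    · simp only [Finset.inr_mem_disjSum, J, Finset.mem_product] at hi
      exact (BoundariedGraph.partialDomination_effective (hρ i hi.2.2.2) (hsymm i hi.2.2.2)
        S T k).dec_exists hd h b fun c => hPre c.A
  · intro A B hA hB hAB
    have hL : A.SameLabels B := by
      intro l _
      by_cases hl : l < t + 1
      · exact hAB (.inl l) (by simpa using Nat.lt_succ_iff.mp hl)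
      · refine iff_of_false ?_ ?_
        · rintro ⟨a, rfl⟩
          exact hl (Nat.lt_succ_of_le (BoundariedGraph.lab_le a))
        · rintro ⟨a, rfl⟩
          exact hl (Nat.lt_succ_of_le (BoundariedGraph.lab_le a))
    have hT : ∀ i ∈ K, ∀ S ⊆ Finset.range (t + 1), ∀ T ⊆ Finset.range (t + 1), ∀ k ≤ 2 * t,
        ((∃ D, (BoundariedGraph.partialDomination (ρ i) S T k).Sol A D) ↔
          ∃ D, (BoundariedGraph.partialDomination (ρ i) S T k).Sol B D) := by
      intro i hi S hS T hT k hk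
      refine hAB (.inr (S, T, k, i)) ?_
      simp only [Finset.inr_mem_disjSum, J, Finset.mem_product, Finset.mem_powerset,
        Finset.mem_range]
      exact ⟨hS, hT, Nat.lt_succ_of_le hk, hi⟩
    intro F k
    rw [add_zero]
    exact ⟨hQ A B hA hB hL (fun i hi S hS T hT' k hk => (hT i hi S hS T hT' k hk).mp) F k,
      hQ B A hB hA (fun l hl => (hL l hl).symm)
        (fun i hi S hS T hT' k hk => (hT i hi S hS T hT' k hk).mpr) F k⟩

/-! ### Excluded topological minors -/

/-- In a large complete bipartite subgraph, `P` provides the branch vertices, and each edge of `H`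
is subdivided once by a vertex of `Q` of its own, chosen by an injection of `Sym2 W`. -/
theorem bicliqueFree_of_not_isTopologicalMinor {W V : Type} [Finite W] {H : SimpleGraph W}
    {G : SimpleGraph V} (h : ¬ IsTopologicalMinor H G) :
    BicliqueFree (Nat.card W) (Nat.card (Sym2 W)) G := by
  classical
  have := Fintype.ofFinite W
  intro P Q hP hPQ
  by_contra hQ
  refine h ?_
  obtain ⟨φ⟩ : Nonempty (W ≃ P) := by
    rw [← Finite.card_eq, hP.symm]; simp
  obtain ⟨r⟩ : Nonempty (Sym2 W ↪ Q) := by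
    refine Function.Embedding.nonempty_of_card_le ?_
    rw [Fintype.card_coe, ← Nat.card_eq_fintype_card]
    omega
  have hadj : ∀ w e, G.Adj (φ w) (r e) := fun w e => hPQ _ (φ w).2 _ (r e).2
  have hmem : ∀ u v (w : V), w ∈ (SimpleGraph.Walk.cons (hadj u s(u, v))
      (SimpleGraph.Walk.cons (hadj v s(u, v)).symm .nil)).support ↔
        w = φ u ∨ w = r s(u, v) ∨ w = φ v := by
    intro u v w; simp
  have hne : ∀ w e, (φ w : V) ≠ r e := fun w e => (hadj w e).ne
  have hφ : ∀ {u v}, (φ u : V) = φ v → u = v := fun h => φ.injective (Subtype.ext h)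
  refine ⟨⟨fun w => φ w, fun u v h => hφ h⟩, fun u v _ => .cons (hadj u s(u, v))
    (.cons (hadj v s(u, v)).symm .nil), ?_, ?_, ?_, ?_⟩
  · intro u v huv
    have : (φ u : V) ≠ φ v := fun h => huv.ne (hφ h)
    simp [SimpleGraph.Walk.isPath_def, (hne _ _).symm]
    exact ⟨hne _ _, this⟩
  · intro u v huv
    have key : ∀ e e', e = e' → (SimpleGraph.Walk.cons (hadj v e)
        (SimpleGraph.Walk.cons (hadj u e).symm .nil)) = (SimpleGraph.Walk.cons (hadj u e')
        (SimpleGraph.Walk.cons (hadj v e').symm .nil)).reverse := by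
      rintro e _ rfl
      simp
    exact key _ _ Sym2.eq_swap
  · intro u v huv w hw
    rcases (hmem u v _).mp hw with h | h | h
    · exact .inl (hφ h)
    · exact absurd h (hne _ _)
    · exact .inr (hφ h)
  · intro u v huv u' v' huv' hs x hx hx'
    rcases (hmem u v _).mp hx with h | h | h
    · exact ⟨u, h.symm⟩
    · rcases (hmem u' v' _).mp hx' with h' | h' | h'
      · exact ⟨u', h'.symm⟩
      · exact absurd (r.injective (Subtype.ext (h.symm.trans h'))) hs
      · exact ⟨v', h'.symm⟩
    · exact ⟨v, h.symm⟩

/-! ### From protrusions to the hypotheses of the decision procedure -/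

theorem exists_lab_eq_zero {t : ℕ} (A : BoundariedGraph t) (h : t < Nat.card A.V) :
    ∃ a, A.lab a = 0 := by
  obtain ⟨X, hX, hmX⟩ := A.card_boundary_le
  by_contra hcon
  push Not at hcon
  have : Finite A.V := A.finite
  have := Fintype.ofFinite A.V
  have huniv : X = Finset.univ := Finset.eq_univ_iff_forall.mpr fun v => (hmX v).mpr (hcon v)
  rw [huniv, Finset.card_univ, ← Nat.card_eq_fintype_card] at hX
  omega

theorem IsDSProtrusion.exists_finset {V : Type} [Finite V] {G : SimpleGraph V} {t : ℕ} {X : Set V}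
    (h : IsDSProtrusion G t X) :
    ∃ S : Finset X, S.card ≤ t ∧ ∀ v, ∃ w ∈ S, v ∈ (G.induce X).closedNbhd w := by
  obtain ⟨-, S, hS, hdom⟩ := h
  refine ⟨S.toFinite.toFinset, by rwa [← Set.ncard_eq_toFinset_card], fun v => ?_⟩
  obtain ⟨u, hu, h⟩ := BoundariedGraph.isDominatingSet_iff.mp hdom v
  exact ⟨u, by simpa using hu, h⟩

theorem IsCDSProtrusion.exists_finset {V : Type} [Finite V] {G : SimpleGraph V} {t : ℕ} {X : Set V}
    {lab : vertexBoundary G X → Fin t} (hlab : Function.Injective lab) (h : IsCDSProtrusion G t X) :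
    ∃ S : Finset X, S.card ≤ t ∧ (inducedBoundaried G X lab hlab).IsComponentwiseCDS S := by
  obtain ⟨-, S, hS, hdom⟩ := h
  have hmem : ∀ v, v ∈ S.toFinite.toFinset ↔ v ∈ S := by simp
  refine ⟨S.toFinite.toFinset, by rwa [← Set.ncard_eq_toFinset_card], fun v => ?_,
    fun u hu v hv huv => ?_⟩
  · obtain ⟨u, hu, h⟩ := BoundariedGraph.isDominatingSet_iff.mp
      (hdom ((G.induce X).connectedComponentMk v)).1 ⟨v, rfl⟩
    exact ⟨u.1, (hmem _).mpr hu, h.imp (congrArg Subtype.val) id⟩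
  · have hconn := (induce_connected_iff.mp (hdom ((G.induce X).connectedComponentMk v)).2).2
    have hu' : u ∈ ((G.induce X).connectedComponentMk v).supp :=
      SimpleGraph.ConnectedComponent.sound huv
    have := hconn ⟨u, hu'⟩ ((hmem _).mp hu) ⟨v, rfl⟩ ((hmem _).mp hv)
    exact reflTransGen_map Subtype.val (fun a b h =>
      ⟨h.1, (hmem _).mpr h.2.1, (hmem _).mpr h.2.2⟩) this

theorem mainTheorem6 :
    (∀ (W : Type) [Finite W] (H : SimpleGraph W) (t : ℕ),
      ∃ (ξ : ℕ) (p : Program) (C : ℕ),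
        ∀ (V : Type) [Finite V] (G : SimpleGraph V) (X : Set V)
          (lab : vertexBoundary G X → Fin t) (hlab : Function.Injective lab),
          IsDSProtrusion G t X → ξ < X.ncard → ¬ IsTopologicalMinor H (G.induce X) →
            OutputsSmallEquivalent DominatingSetProblem p (inducedBoundaried G X lab hlab)
              ξ (C * X.ncard)) ∧
    (∃ d : ℕ, ∀ (W : Type) [Finite W] (H : SimpleGraph W) (t : ℕ),
      ∃ (ξ : ℕ) (p : Program) (C : ℕ),
        ∀ (V : Type) [Finite V] (G : SimpleGraph V) (X : Set V)
          (lab : vertexBoundary G X → Fin t) (hlab : Function.Injective lab),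
          IsCDSProtrusion G t X → ξ < X.ncard → ¬ IsTopologicalMinor H (G.induce X) →
            OutputsSmallEquivalent ConnectedDominatingSetProblem p
              (inducedBoundaried G X lab hlab) ξ (C * X.ncard ^ d)) := by
  refine ⟨fun W _ H t => ?_, 2, fun W _ H t => ?_⟩
  -- The relation that always holds makes every set connected, so a single relation suffices and the
  -- time is linear.
  · obtain ⟨ξ, p, C, h⟩ := exists_program_of_transfers (t := t) (d := 1)
      (Q := DominatingSetProblem) le_rfl (Nat.card W) (Nat.card (Sym2 W)) {()}
      (fun _ _ _ _ => True) (fun _ _ => VRel.Tabulable.top le_rfl) (fun _ _ _ _ _ => id)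
      (fun A => BicliqueFree (Nat.card W) (Nat.card (Sym2 W)) A.graph ∧ (∃ a, A.lab a = 0) ∧
        ∃ S : Finset A.V, S.card ≤ t ∧ ∀ v, ∃ w ∈ S, v ∈ A.graph.closedNbhd w)
      (fun A hA => hA.1) fun A B hA hB hL hT F k =>
        BoundariedGraph.dominatingSet_of_transfers (hT () (by simp)) hL hA.2.1 hA.2.2
    -- With more than `t` vertices some vertex is unlabelled, as the exchange arguments require.
    refine ⟨max ξ t, p, C, fun V _ G X lab hlab hX hlt hH s hs => ?_⟩
    have hcard : Nat.card (inducedBoundaried G X lab hlab).V = X.ncard := Nat.card_coe_set_eq X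
    obtain ⟨a, ha⟩ := exists_lab_eq_zero (inducedBoundaried G X lab hlab)
      (by rw [hcard]; exact (le_max_right _ _).trans_lt hlt)
    obtain ⟨n, s', B, h1, h2, h3, h4, h5⟩ := h (inducedBoundaried G X lab hlab)
      ⟨bicliqueFree_of_not_isTopologicalMinor hH, ⟨a, ha⟩, hX.exists_finset⟩ ⟨a⟩ s hs
    rw [hcard, pow_one] at h2
    exact ⟨n, s', B, h1, h2, h3, h4.trans (le_max_left _ _), h5⟩
  · classical
    -- One relation for each symmetric set of virtual edges that some `F` might induce.
    let K := ((Finset.range (t + 1) ×ˢ Finset.range (t + 1)).powerset).filter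
      fun E => ∀ l l', (l, l') ∈ E → (l', l) ∈ E
    have hK : ∀ E ∈ K, ∀ l l', (l, l') ∈ E → (l', l) ∈ E := fun E hE =>
      (Finset.mem_filter.mp hE).2
    obtain ⟨ξ, p, C, h⟩ := exists_program_of_transfers (t := t) (d := 2)
      (Q := ConnectedDominatingSetProblem) (by omega) (Nat.card W) (Nat.card (Sym2 W)) K
      BoundariedGraph.adjOrLab (fun E _ => VRel.Tabulable.adj_or_lab le_rfl E)
      (fun E hE A v w h => h.imp (fun h => h.symm) (hK E hE _ _))
      (fun A => BicliqueFree (Nat.card W) (Nat.card (Sym2 W)) A.graph ∧ (∃ a, A.lab a = 0) ∧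
        ∃ S : Finset A.V, S.card ≤ t ∧ A.IsComponentwiseCDS S)
      (fun A hA => hA.1) fun A B hA hB hL hT F k =>
        BoundariedGraph.connectedDominatingSet_of_transfers (fun E hE hE' => hT E
          (Finset.mem_filter.mpr ⟨Finset.mem_powerset.mpr hE, hE'⟩)) hL hA.2.1 hA.2.2
    refine ⟨max ξ t, p, C, fun V _ G X lab hlab hX hlt hH s hs => ?_⟩
    have hcard : Nat.card (inducedBoundaried G X lab hlab).V = X.ncard := Nat.card_coe_set_eq X
    obtain ⟨a, ha⟩ := exists_lab_eq_zero (inducedBoundaried G X lab hlab)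
      (by rw [hcard]; exact (le_max_right _ _).trans_lt hlt)
    obtain ⟨n, s', B, h1, h2, h3, h4, h5⟩ := h (inducedBoundaried G X lab hlab)
      ⟨bicliqueFree_of_not_isTopologicalMinor hH, ⟨a, ha⟩, hX.exists_finset hlab⟩ ⟨a⟩ s hs
    rw [hcard] at h2
    exact ⟨n, s', B, h1, h2, h3, h4.trans (le_max_left _ _), h5⟩
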